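/- Let $(M^n,g)$ be a Hermitian manifold with Kähler form $\omega$, Chern connection $\nabla$, Chern torsion $T(x,y)=\nabla_xy-\nabla_yx-[x,y]$ and Chern curvature $R_{xyzw}=\langle \nabla_x\nabla_yz-\nabla_y\nabla_xz-\nabla_{[x,y]}z,\,w\rangle$, where $g=\langle\,,\rangle$ is extended complex-bilinearly. In a local unitary frame $e$ of type $(1,0)$ vectors with dual coframe $\varphi$, write $T(e_i,e_k)=\sum_jT^j_{ik}e_j$ and $R_{i\bar jk\bar\ell}=R_{e_i\bar e_je_k\bar e_\ell}$, so that $\omega=\sqrt{-1}\sum_i\varphi_i\wedge\overline{\varphi}_i$. Indices after a comma denote covariant derivatives with respect to $\nabla$. Let $\eta=\sum_i\eta_i\varphi_i$ with $\eta_i=\sum_kT^k_{ki}$ be Gauduchon's torsion $(1,0)$-form, and put $$\chi=\sum_i\eta_{i,\bar i},\quad |\eta|^2=\sum_i|\eta_i|^2,\quad |T|^2=\sum_{i,j,k}|T^j_{ik}|^2,$$ $$\xi=\sqrt{-1}\sum_{i,j}\xi_{i\bar j}\varphi_i\wedge\overline{\varphi}_j,\ \ \xi_{i\bar j}=\sum_rT^j_{ir,\bar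 r},\qquad \sigma=\sqrt{-1}\sum_{i,j}\sigma_{i\bar j}\varphi_i\wedge\overline{\varphi}_j,\ \ \sigma_{i\bar j}=\sum_{r,s}T^r_{is}\overline{T^r_{js}},$$ $$\rho^{(a)}=\sqrt{-1}\sum_{i,j}\rho^{(a)}_{i\bar j}\varphi_i\wedge\overline{\varphi}_j,\quad \rho^{(1)}_{i\bar j}=\sum_rR_{i\bar jr\bar r},\ \ \rho^{(2)}_{i\bar j}=\sum_rR_{r\bar ri\bar j},\ \ \rho^{(3)}_{i\bar j}=\sum_rR_{r\bar ji\bar r}.$$ **Theorem 2.** Suppose that $g$ is pluriclosed, i.e. $\partial\bar\partial\omega=0$, and that its Chern holomorphic sectional curvature $H(X)=R_{X\bar XX\bar X}/|X|^4$ (for $X\ne0$ of type $(1,0)$) is equal to a constant $c\in\mathbb R$. Then under any local unitary frame and for all $1\le i,j,k,\ell\le n$, $$T^j_{ik,\bar\ell}-T^\ell_{ik,\bar j}=\sum_rT^r_{ik}\overline{T^r_{j\ell}},$$ $$R_{i\bar jk\bar\ell}=\frac c2\big(\delta_{ij}\delta_{k\ell}+\delta_{i\ell}\delta_{kj}\big)-\frac14\sum_rT^r_{ik}\overline{T^r_{j\ell}}-\frac12\big(T^\ell_{ik,\bar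 j}+\overline{T^k_{j\ell,\bar i}}\big).$$ Moreover $$\xi_{i\bar j}+\eta_{i,\bar j}=\sigma_{i\bar j},\qquad \xi=\sqrt{-1}\,\bar\partial\eta+\sigma,\qquad 2\chi=|T|^2,$$ $$\rho^{(1)}=\frac c2(n+1)\omega-\frac14\sigma+\frac{\sqrt{-1}}2(\partial\bar\eta-\bar\partial\eta),$$ $$\rho^{(2)}=\frac c2(n+1)\omega+\frac34\sigma-\frac{\sqrt{-1}}2(\partial\bar\eta-\bar\partial\eta),$$ $$\rho^{(3)}=\frac c2(n+1)\omega-\frac14\sigma+\frac{\sqrt{-1}}2(\partial\bar\eta+\bar\partial\eta).$$ If in addition $M$ is compact, then $2\int_M|\eta|^2=\int_M|T|^2$, the integrals being taken with respect to the volume form $\omega^n/n!$. -/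

import Mathlib

open scoped ContDiff Manifold BigOperators
open MeasureTheory

noncomputable section

namespace ChernGeometry

/-! ### Wirtinger derivatives on `ℂⁿ`

A vector `u : Fin n → ℂ` stands for the `(1,0)`-vector `∑ uₖ ∂/∂zₖ`, and also for the real
tangent vector whose `(1,0)`-part it is. -/

section Wirtinger

variable {n : ℕ} {F : Type*} [NormedAddCommGroup F] [NormedSpace ℂ F]

/-- `∂_u f = ∑ uₖ ∂f/∂zₖ`, the derivative of `f` in the direction of the `(1,0)`-vector `u`. -/
def wirt (u : Fin n → ℂ) (f : (Fin n → ℂ) → F) (y : Fin n → ℂ) : F :=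
  (1 / 2 : ℂ) • (fderiv ℝ f y u - Complex.I • fderiv ℝ f y (Complex.I • u))

/-- `∂_ū f = ∑ conj(uₖ) ∂f/∂z̄ₖ`, the derivative of `f` in the direction of the conjugate of the
`(1,0)`-vector `u`. -/
def wirtBar (u : Fin n → ℂ) (f : (Fin n → ℂ) → F) (y : Fin n → ℂ) : F :=
  (1 / 2 : ℂ) • (fderiv ℝ f y u + Complex.I • fderiv ℝ f y (Complex.I • u))

end Wirtinger

/-! ### Complex-valued differential forms on open subsets of `ℂⁿ` -/

section Forms

variable {n : ℕ}

/-- Multiplication by `√-1`, the complex structure `J` of `ℂⁿ`. -/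
def cplxJ (n : ℕ) : (Fin n → ℂ) →L[ℝ] (Fin n → ℂ) :=
  Complex.I • ContinuousLinearMap.id ℝ (Fin n → ℂ)

/-- The twisted differential `dᶜ = J⁻¹ d J`, where `J` acts on forms by
`(Jα)(v₁, …, vₖ) = α(Jv₁, …, Jvₖ)`. As `J = i^(p-q)` on forms of type `(p,q)`,
`dᶜ = √-1 (∂̄ - ∂)`. -/
def dc {k : ℕ} (α : (Fin n → ℂ) → (Fin n → ℂ) [⋀^Fin k]→L[ℝ] ℂ) (y : Fin n → ℂ) :
    (Fin n → ℂ) [⋀^Fin (k + 1)]→L[ℝ] ℂ :=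
  (extDeriv (fun z => (α z).compContinuousLinearMap (cplxJ n)) y).compContinuousLinearMap
    (-cplxJ n)

/-- The Dolbeault operator `∂`, from `d = ∂ + ∂̄` and `dᶜ = √-1 (∂̄ - ∂)`. -/
def del {k : ℕ} (α : (Fin n → ℂ) → (Fin n → ℂ) [⋀^Fin k]→L[ℝ] ℂ) (y : Fin n → ℂ) :
    (Fin n → ℂ) [⋀^Fin (k + 1)]→L[ℝ] ℂ :=
  (1 / 2 : ℂ) • (extDeriv α y + Complex.I • dc α y)

/-- The Dolbeault operator `∂̄`, from `d = ∂ + ∂̄` and `dᶜ = √-1 (∂̄ - ∂)`. -/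
def delbar {k : ℕ} (α : (Fin n → ℂ) → (Fin n → ℂ) [⋀^Fin k]→L[ℝ] ℂ) (y : Fin n → ℂ) :
    (Fin n → ℂ) [⋀^Fin (k + 1)]→L[ℝ] ℂ :=
  (1 / 2 : ℂ) • (extDeriv α y - Complex.I • dc α y)

theorem del_add_delbar {k : ℕ} (α : (Fin n → ℂ) → (Fin n → ℂ) [⋀^Fin k]→L[ℝ] ℂ)
    (y : Fin n → ℂ) : del α y + delbar α y = extDeriv α y := by
  simp only [del, delbar]
  module

/-- The covector `dzₐ`. -/
def dz (a : Fin n) : (Fin n → ℂ) →L[ℝ] ℂ := ContinuousLinearMap.proj a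

/-- The complex conjugate of a covector. -/
def conjForm (α : (Fin n → ℂ) →L[ℝ] ℂ) : (Fin n → ℂ) →L[ℝ] ℂ :=
  (Complex.conjCLE : ℂ →L[ℝ] ℂ).comp α

/-- A covector as an alternating form of degree one. -/
def oneForm (α : (Fin n → ℂ) →L[ℝ] ℂ) : (Fin n → ℂ) [⋀^Fin 1]→L[ℝ] ℂ :=
  ContinuousAlternatingMap.ofSubsingleton ℝ (Fin n → ℂ) ℂ (0 : Fin 1) α

/-- The wedge product of two covectors. -/
def wedge (α β : (Fin n → ℂ) →L[ℝ] ℂ) : (Fin n → ℂ) [⋀^Fin 2]→L[ℝ] ℂ :=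
  ContinuousMultilinearMap.alternatization
    ((ContinuousMultilinearMap.mkPiAlgebra ℝ (Fin 2) ℂ).compContinuousLinearMap ![α, β])

theorem wedge_apply (α β : (Fin n → ℂ) →L[ℝ] ℂ) (u v : Fin n → ℂ) :
    wedge α β ![u, v] = α u * β v - α v * β u := by
  have hu : (Finset.univ : Finset (Equiv.Perm (Fin 2))) = {1, Equiv.swap 0 1} := by decide
  rw [wedge, ContinuousMultilinearMap.alternatization_apply_apply, hu,
    Finset.sum_pair (by decide)]
  simp [Fin.prod_univ_two]
  ring

end Forms

/-! ### Chern geometry of a Hermitian metric in holomorphic coordinates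

`G y` is the matrix `g_{i j̄} = ⟨∂_i, ∂̄_j⟩` of the metric at the point `y`. -/

section Local

variable {n : ℕ} (G : (Fin n → ℂ) → Matrix (Fin n) (Fin n) ℂ)

/-- `⟨u, v̄⟩ = ∑ g_{i j̄} uᵢ conj(vⱼ)`. -/
def pair (y u v : Fin n → ℂ) : ℂ := ∑ i, ∑ j, G y i j * u i * star (v j)

/-- The matrix `θ(u)` of the Chern connection form `θ = ∂g · g⁻¹` in the coordinate frame, so that
`∇_u ∂_i = ∑ⱼ θ(u)ᵢⱼ ∂_j`. -/
def chernMatrix (u y : Fin n → ℂ) : Matrix (Fin n) (Fin n) ℂ :=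
  (Matrix.of fun i j => wirt u (fun z => G z i j) y) * (G y)⁻¹

/-- The Chern connection `∇_u X` of a local vector field `X = ∑ Xᵏ ∂_k` of type `(1,0)` in the
direction of the `(1,0)`-vector `u`. -/
def nabla (u : Fin n → ℂ) (X : (Fin n → ℂ) → Fin n → ℂ) (y : Fin n → ℂ) : Fin n → ℂ :=
  wirt u X y + Matrix.vecMul (X y) (chernMatrix G u y)

/-- The Chern connection `∇_ū X = ∂̄_ū X` of a local vector field `X` of type `(1,0)` in the
direction of the conjugate of the `(1,0)`-vector `u`. -/
def nablaBar (u : Fin n → ℂ) (X : (Fin n → ℂ) → Fin n → ℂ) (y : Fin n → ℂ) : Fin n → ℂ :=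
  wirtBar u X y

/-- The torsion `T(u, v) = ∇_u v - ∇_v u - [u, v]` on `(1,0)`-vectors, computed on the extensions
of `u` and `v` with constant coefficients in the coordinate frame, which commute. -/
def torsion (y u v : Fin n → ℂ) : Fin n → ℂ :=
  nabla G u (fun _ => v) y - nabla G v (fun _ => u) y

/-- The covariant derivative `(∇_w̄ T)(u, v)` of the torsion in the direction of the conjugate of
the `(1,0)`-vector `w`. -/
def nablaBarTorsion (w y u v : Fin n → ℂ) : Fin n → ℂ :=
  nablaBar w (fun z => torsion G z u v) y - torsion G y (nablaBar w (fun _ => u) y) v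
    - torsion G y u (nablaBar w (fun _ => v) y)

/-- The curvature `R(u, v̄) w = ∇_u ∇_v̄ w - ∇_v̄ ∇_u w - ∇_[u, v̄] w` of the Chern connection,
computed on the extensions with constant coefficients, for which `[u, v̄] = 0`. -/
def curvatureOp (y u v w : Fin n → ℂ) : Fin n → ℂ :=
  nabla G u (fun z => nablaBar v (fun _ => w) z) y
    - nablaBar v (fun z => nabla G u (fun _ => w) z) y

/-- The Chern curvature tensor `R_{u v̄ w x̄} = ⟨R(u, v̄) w, x̄⟩`. -/
def curvature (y u v w x : Fin n → ℂ) : ℂ := pair G y (curvatureOp G y u v w) x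

/-- The holomorphic sectional curvature `H(X) = R_{X X̄ X X̄} / |X|⁴`. -/
def holSec (y X : Fin n → ℂ) : ℂ := curvature G y X X X X / pair G y X X ^ 2

/-- Gauduchon's torsion `(1,0)`-form `η`: `η(u)` is the trace of `v ↦ T(v, u)`. -/
def etaForm (y : Fin n → ℂ) : (Fin n → ℂ) →L[ℝ] ℂ :=
  ∑ a, (∑ k, torsion G y (Pi.single k 1) (Pi.single a 1) k) • dz a

/-- The covariant derivative `(∇_w̄ η)(u)` of the torsion `1`-form. -/
def nablaBarEta (w y u : Fin n → ℂ) : ℂ :=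
  wirtBar w (fun z => etaForm G z u) y - etaForm G y (nablaBar w (fun _ => u) y)

/-- The Kähler form `ω = √-1 ∑ g_{i j̄} dzᵢ ∧ dz̄ⱼ`. -/
def kahlerForm (y : Fin n → ℂ) : (Fin n → ℂ) [⋀^Fin 2]→L[ℝ] ℂ :=
  Complex.I • ∑ i, ∑ j, G y i j • wedge (dz i) (conjForm (dz j))

/-- The `2`-form `∂̄η` at `y`. -/
def delbarEta (y : Fin n → ℂ) : (Fin n → ℂ) [⋀^Fin 2]→L[ℝ] ℂ :=
  delbar (fun z => oneForm (etaForm G z)) y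

/-- The `2`-form `∂η̄` at `y`. -/
def delEtaBar (y : Fin n → ℂ) : (Fin n → ℂ) [⋀^Fin 2]→L[ℝ] ℂ :=
  del (fun z => oneForm (conjForm (etaForm G z))) y

/-! #### Components in a unitary frame -/

variable (y : Fin n → ℂ) (e : Fin n → Fin n → ℂ)

/-- `e₁, …, eₙ` is a unitary frame of type `(1,0)` tangent vectors at `y`. -/
def IsUnitaryFrame : Prop := ∀ i j, pair G y (e i) (e j) = if i = j then 1 else 0

/-- The dual coframe `φᵢ = ⟨·, ēᵢ⟩` of a unitary frame. -/
def coframe (i : Fin n) : (Fin n → ℂ) →L[ℝ] ℂ := ∑ a, pair G y (Pi.single a 1) (e i) • dz a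

/-- The `(1,1)`-form `√-1 ∑ a_{i j̄} φᵢ ∧ φ̄ⱼ`. -/
def formOf (a : Fin n → Fin n → ℂ) : (Fin n → ℂ) [⋀^Fin 2]→L[ℝ] ℂ :=
  Complex.I • ∑ i, ∑ j, a i j • wedge (coframe G y e i) (conjForm (coframe G y e j))

/-- `torsionC i k j` is `T^j_{ik}`, where `T(eᵢ, eₖ) = ∑ T^j_{ik} eⱼ`. -/
def torsionC (i k j : Fin n) : ℂ := pair G y (torsion G y (e i) (e k)) (e j)

/-- `torsionD i k j l` is `T^j_{ik, l̄}`. -/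
def torsionD (i k j l : Fin n) : ℂ := pair G y (nablaBarTorsion G (e l) y (e i) (e k)) (e j)

/-- `curvC i j k l` is `R_{i j̄ k l̄}`. -/
def curvC (i j k l : Fin n) : ℂ := curvature G y (e i) (e j) (e k) (e l)

/-- `ηᵢ`. -/
def etaC (i : Fin n) : ℂ := etaForm G y (e i)

/-- `η_{i, j̄}`. -/
def etaD (i j : Fin n) : ℂ := nablaBarEta G (e j) y (e i)

/-- `χ = ∑ η_{i, ī}`. -/
def chi : ℂ := ∑ i, etaD G y e i i

/-- `ξ_{i j̄} = ∑ᵣ T^j_{ir, r̄}`. -/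
def xiC (i j : Fin n) : ℂ := ∑ r, torsionD G y e i r j r

/-- `σ_{i j̄} = ∑_{r,s} T^r_{is} conj(T^r_{js})`. -/
def sigmaC (i j : Fin n) : ℂ := ∑ r, ∑ s, torsionC G y e i s r * star (torsionC G y e j s r)

/-- The first Chern Ricci tensor `∑ᵣ R_{i j̄ r r̄}`. -/
def ricci1 (i j : Fin n) : ℂ := ∑ r, curvC G y e i j r r

/-- The second Chern Ricci tensor `∑ᵣ R_{r r̄ i j̄}`. -/
def ricci2 (i j : Fin n) : ℂ := ∑ r, curvC G y e r r i j

/-- The third Chern Ricci tensor `∑ᵣ R_{r j̄ i r̄}`. -/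
def ricci3 (i j : Fin n) : ℂ := ∑ r, curvC G y e r j i r

/-- `|η|² = ∑ |ηᵢ|²`. -/
def normSqEta : ℝ := ∑ i, ‖etaC G y e i‖ ^ 2

/-- `|T|² = ∑ |T^j_{ik}|²`. -/
def normSqTorsion : ℝ := ∑ i, ∑ j, ∑ k, ‖torsionC G y e i k j‖ ^ 2

/-! #### The connection is the Chern connection -/

variable {G} {y}

/-- The `(1,0)`-part of the connection matrix is determined by the metric. -/
theorem eq_chernMatrix_iff (hG : IsUnit (G y).det) (u : Fin n → ℂ)
    (A : Matrix (Fin n) (Fin n) ℂ) :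
    A = chernMatrix G u y ↔ (Matrix.of fun i j => wirt u (fun z => G z i j) y) = A * G y := by
  constructor
  · rintro rfl
    rw [chernMatrix, Matrix.mul_assoc, Matrix.nonsing_inv_mul _ hG, Matrix.mul_one]
  · intro h
    rw [chernMatrix, h, Matrix.mul_assoc, Matrix.mul_nonsing_inv _ hG, Matrix.mul_one]

/-- The connection is compatible with the metric: `∂_u ⟨X, Ȳ⟩ = ⟨∇_u X, Ȳ⟩ + ⟨X, conj(∇_ū Y)⟩`. -/
theorem wirt_pair (hG : IsUnit (G y).det) (hd : ∀ i j, DifferentiableAt ℝ (fun z => G z i j) y)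
    (u : Fin n → ℂ) {X Y : (Fin n → ℂ) → Fin n → ℂ}
    (hX : DifferentiableAt ℝ X y) (hY : DifferentiableAt ℝ Y y) :
    wirt u (fun z => pair G z (X z) (Y z)) y =
      pair G y (nabla G u X y) (Y y) + pair G y (X y) (nablaBar u Y y) := by
  have hX' := fun i => (hasFDerivAt_pi'.1 hX.hasFDerivAt) i
  have hY' := fun i => (hasFDerivAt_pi'.1 hY.hasFDerivAt) i
  have key : ∀ w, fderiv ℝ (fun z => pair G z (X z) (Y z)) y w =
      ∑ i, ∑ j, (fderiv ℝ (fun z => G z i j) y w * X y i * star (Y y j)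
        + G y i j * (fderiv ℝ X y w i) * star (Y y j)
        + G y i j * X y i * star (fderiv ℝ Y y w j)) := by
    intro w
    have H : HasFDerivAt (fun z => pair G z (X z) (Y z)) _ y :=
      HasFDerivAt.fun_sum fun i _ => HasFDerivAt.fun_sum fun j _ =>
        ((hd i j).hasFDerivAt.mul (hX' i)).mul
          ((Complex.conjCLE : ℂ →L[ℝ] ℂ).hasFDerivAt.comp y (hY' j))
    rw [H.fderiv]
    simp only [FunLike.coe_sum, Finset.sum_apply, add_apply,
      smul_apply, ContinuousLinearMap.comp_apply,
      ContinuousLinearMap.proj_apply, smul_eq_mul]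
    refine Finset.sum_congr rfl fun i _ => Finset.sum_congr rfl fun j _ => ?_
    simp only [ContinuousLinearEquiv.coe_coe, Complex.conjCLE_apply, Pi.mul_apply,
      Complex.star_def]
    ring
  have hθ := (eq_chernMatrix_iff hG u (chernMatrix G u y)).1 rfl
  have h1 : ∑ i, ∑ j, G y i j * Matrix.vecMul (X y) (chernMatrix G u y) i * star (Y y j) =
      ∑ i, ∑ j, wirt u (fun z => G z i j) y * X y i * star (Y y j) := by
    have h2 : ∀ i j, wirt u (fun z => G z i j) y = ∑ k, chernMatrix G u y i k * G y k j := by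
      intro i j
      have := congrFun (congrFun hθ i) j
      simpa [Matrix.mul_apply] using this
    simp only [h2, Matrix.vecMul, dotProduct, Finset.mul_sum, Finset.sum_mul]
    rw [Finset.sum_comm]
    conv_rhs => rw [Finset.sum_comm]
    refine Finset.sum_congr rfl fun j _ => ?_
    rw [Finset.sum_comm]
    refine Finset.sum_congr rfl fun i _ => Finset.sum_congr rfl fun k _ => ?_
    ring
  have h3 : pair G y (nabla G u X y) (Y y) =
      ∑ i, ∑ j, wirt u (fun z => G z i j) y * X y i * star (Y y j)
        + ∑ i, ∑ j, G y i j * wirt u X y i * star (Y y j) := by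
    rw [← h1, ← Finset.sum_add_distrib, pair]
    refine Finset.sum_congr rfl fun i _ => ?_
    rw [← Finset.sum_add_distrib]
    refine Finset.sum_congr rfl fun j _ => ?_
    simp only [nabla, Pi.add_apply]
    ring
  rw [h3, pair, wirt, key, key]
  simp only [Finset.smul_sum, ← Finset.sum_add_distrib, ← Finset.sum_sub_distrib]
  refine Finset.sum_congr rfl fun i _ => Finset.sum_congr rfl fun j _ => ?_
  simp only [wirt, wirtBar, nablaBar, Pi.smul_apply, Pi.add_apply, Pi.sub_apply, smul_eq_mul,
    star_add, star_mul', Complex.star_def, map_div₀, map_one, map_ofNat, Complex.conj_I]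
  ring

end Local

/-! ### Hermitian manifolds

A complex manifold of dimension `n` is a space with holomorphic charts in `ℂⁿ`. Its holomorphic
tangent space at `p` is the space of tangent vectors of type `(1,0)`. -/

section Manifold

variable {n : ℕ} {M : Type*} [TopologicalSpace M] [ChartedSpace (Fin n → ℂ) M]

/-- The coordinate vector `∂_i` of the chart `φ` at the point with coordinates `y`. -/
def coordVec (φ : OpenPartialHomeomorph M (Fin n → ℂ)) (y : Fin n → ℂ) (i : Fin n) :
    TangentSpace 𝓘(ℂ, Fin n → ℂ) (φ.symm y) :=
  mfderiv 𝓘(ℂ, Fin n → ℂ) 𝓘(ℂ, Fin n → ℂ) φ.symm y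
    (Pi.single i 1 : Fin n → ℂ)

variable (n M) in
/-- A smooth Hermitian metric on a complex manifold: `inner p u v` is `⟨u, v̄⟩`. -/
structure HermitianMetric where
  inner : ∀ p : M, TangentSpace 𝓘(ℂ, Fin n → ℂ) p →ₗ[ℂ]
    TangentSpace 𝓘(ℂ, Fin n → ℂ) p →ₛₗ[starRingEnd ℂ] ℂ
  conj_symm : ∀ p u v, star (inner p u v) = inner p v u
  pos : ∀ p u, u ≠ 0 → 0 < (inner p u u).re
  smooth : ∀ φ ∈ IsManifold.maximalAtlas 𝓘(ℂ, Fin n → ℂ) ω M, ∀ i j,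
    ContDiffOn ℝ ∞ (fun y => inner (φ.symm y) (coordVec φ y i) (coordVec φ y j)) φ.target

variable (h : HermitianMetric n M)

/-- The matrix `g_{i j̄}` of the metric in a chart. -/
def HermitianMetric.coord (φ : OpenPartialHomeomorph M (Fin n → ℂ)) (y : Fin n → ℂ) :
    Matrix (Fin n) (Fin n) ℂ :=
  Matrix.of fun i j => h.inner (φ.symm y) (coordVec φ y i) (coordVec φ y j)

/-- The metric is pluriclosed: `∂∂̄ω = 0`. -/
def HermitianMetric.IsPluriclosed : Prop :=
  ∀ φ ∈ IsManifold.maximalAtlas 𝓘(ℂ, Fin n → ℂ) ω M, ∀ y ∈ φ.target,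
    del (fun z => delbar (kahlerForm (h.coord φ)) z) y = 0

/-- The holomorphic sectional curvature of the Chern connection is equal to the constant `c`. -/
def HermitianMetric.HasConstantHolSec (c : ℝ) : Prop :=
  ∀ φ ∈ IsManifold.maximalAtlas 𝓘(ℂ, Fin n → ℂ) ω M, ∀ y ∈ φ.target,
    ∀ X : Fin n → ℂ, X ≠ 0 → holSec (h.coord φ) y X = (c : ℂ)

/-- The volume measure `ωⁿ/n!` of the metric. In a holomorphic chart `ωⁿ/n!` is `2ⁿ det(g_{i j̄})`
times Lebesgue measure; the measures so obtained on the chart domains agree on overlaps, and the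
volume measure is their supremum. -/
def HermitianMetric.volume [MeasurableSpace M] : Measure M :=
  ⨆ φ : IsManifold.maximalAtlas 𝓘(ℂ, Fin n → ℂ) ω M,
    Measure.map φ.1.symm
      ((MeasureTheory.volume.restrict φ.1.target).withDensity
        fun y => ENNReal.ofReal (2 ^ n * (h.coord φ.1 y).det.re))

end Manifold

end ChernGeometry

end

open ChernGeometry

namespace ChernGeometry

/-! ### Calculus of Wirtinger derivatives -/

section WirtingerCalculus

variable {n : ℕ} {F : Type*} [NormedAddCommGroup F] [NormedSpace ℂ F]

/-! Everything local is computed in a holomorphic chart on vector fields with constant coefficients.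
On such fields `∇̄` vanishes, metric compatibility reads `⟨∇_u v, x̄⟩ = ∂_u ⟨v, x̄⟩`, and the
curvature becomes `R(u,v̄,w,x̄) = ⟨∇_u w, conj(∇_v x)⟩ - ∂̄_v ∂_u ⟨w, x̄⟩` (`curvature_eq`). Since
`T(u,v) = ∇_u v - ∇_v u`, applying `∂̄` yields the first Bianchi identity: `∇̄T` is the part of `R`
that is skew in the two linear arguments (`pair_nablaBarTorsion`).

The form `∂∂̄ω` has only a `(2,2)`-component, which skew-symmetrizes the second derivatives `∂∂̄g`
in both the linear and the conjugate-linear arguments. Expressing these derivatives through `R` and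
`⟨∇, ∇⟩`, pluriclosedness says that the doubly skew part of `R` is `⟨T, T̄⟩`; by Bianchi this is the
commutation rule for `∇̄T` (`pair_nablaBarTorsion_sub`). Constancy of `H`, polarized, prescribes the
doubly symmetric part of `R` (`curvature_symmetrized`). The four curvatures in that symmetrization
differ from one another by components of `∇̄T`, so the symmetrization determines `R`
(`curvature_eq_of_pluriclosed`). The Ricci formulas, `ξ + ∇̄η = σ` and `2χ = |T|²` are contractions
of these two identities.

For the integral identity it remains to prove `∫ χ = ∫ |η|²`. The vector field dual to `η`, weighted
by `det g`, has `∂̄`-divergence `det g · (χ - |η|²)` (`sum_wirtBar_etaField`), because the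
derivatives of `det g` and of `g⁻¹` combine to `-|η|²`. Integration by parts against a cut-off `f`
leaves the pairing of `η` with `∂̄f`. Summed over a partition of unity these pairings cancel.

Passing to the manifold requires that `η`, `|T|²` and the density `2ⁿ det g` do not depend on the
chart. Coordinate changes are holomorphic isometries. Torsion is natural under them because the
second derivative of the coordinate change is symmetric, and the densities match because the real
Jacobian of a holomorphic map is the squared modulus of its complex Jacobian. -/

theorem complex_smul_eq {V : Type*} [AddCommGroup V] [Module ℂ V] (c : ℂ) (u : V) :
    c • u = c.re • u + c.im • (Complex.I • u) := by
  conv_lhs => rw [← Complex.re_add_im c, add_smul, mul_smul]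
  rfl

theorem wirt_add_left (u v : Fin n → ℂ) (f : (Fin n → ℂ) → F) (y : Fin n → ℂ) :
    wirt (u + v) f y = wirt u f y + wirt v f y := by
  simp only [wirt, smul_add, map_add]
  module

theorem wirtBar_add_left (u v : Fin n → ℂ) (f : (Fin n → ℂ) → F) (y : Fin n → ℂ) :
    wirtBar (u + v) f y = wirtBar u f y + wirtBar v f y := by
  simp only [wirtBar, smul_add, map_add]
  module

theorem fderiv_complex_smul (c : ℂ) (u : Fin n → ℂ) (f : (Fin n → ℂ) → F) (y : Fin n → ℂ) :
    fderiv ℝ f y (c • u) =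
      (c.re : ℂ) • fderiv ℝ f y u + (c.im : ℂ) • fderiv ℝ f y (Complex.I • u) := by
  rw [complex_smul_eq, map_add, map_smul, map_smul]
  rfl

theorem I_smul_I_smul {V : Type*} [AddCommGroup V] [Module ℂ V] (u : V) :
    Complex.I • Complex.I • u = -u := by
  rw [smul_smul, Complex.I_mul_I, neg_one_smul]

/-- `wirt` is the complex-linear part of the real differential and `wirtBar` below is its
conjugate-linear part. Both are therefore tensorial over `ℂ` in the direction. -/
theorem wirt_smul_left (c : ℂ) (u : Fin n → ℂ) (f : (Fin n → ℂ) → F) (y : Fin n → ℂ) :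
    wirt (c • u) f y = c • wirt u f y := by
  simp only [wirt, smul_comm Complex.I c u]
  rw [fderiv_complex_smul, fderiv_complex_smul c (Complex.I • u), I_smul_I_smul, map_neg]
  conv_rhs => rw [← Complex.re_add_im c]
  simp only [smul_add, smul_sub, smul_neg, smul_smul]
  have h := Complex.I_mul_I
  match_scalars <;> first | ring1 | linear_combination (1 / 2 * (c.im : ℂ)) * h

theorem wirtBar_smul_left (c : ℂ) (u : Fin n → ℂ) (f : (Fin n → ℂ) → F) (y : Fin n → ℂ) :
    wirtBar (c • u) f y = star c • wirtBar u f y := by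
  simp only [wirtBar, smul_comm Complex.I c u]
  rw [fderiv_complex_smul, fderiv_complex_smul c (Complex.I • u), I_smul_I_smul, map_neg]
  conv_rhs => rw [← Complex.re_add_im c]
  simp only [smul_add, smul_neg, smul_smul, star_add, star_mul', Complex.star_def,
    Complex.conj_ofReal, Complex.conj_I]
  have h := Complex.I_mul_I
  match_scalars <;> first | ring1 | linear_combination (1 / 2 * (c.im : ℂ)) * h

theorem wirt_congr {u : Fin n → ℂ} {f g : (Fin n → ℂ) → F} {y : Fin n → ℂ}
    (h : f =ᶠ[nhds y] g) : wirt u f y = wirt u g y := by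
  simp only [wirt, h.fderiv_eq]

theorem wirtBar_congr {u : Fin n → ℂ} {f g : (Fin n → ℂ) → F} {y : Fin n → ℂ}
    (h : f =ᶠ[nhds y] g) : wirtBar u f y = wirtBar u g y := by
  simp only [wirtBar, h.fderiv_eq]

@[simp] theorem wirt_const (u : Fin n → ℂ) (a : F) (y : Fin n → ℂ) :
    wirt u (fun _ => a) y = 0 := by
  simp [wirt]

@[simp] theorem wirtBar_const (u : Fin n → ℂ) (a : F) (y : Fin n → ℂ) :
    wirtBar u (fun _ => a) y = 0 := by
  simp [wirtBar]

theorem wirt_add (u : Fin n → ℂ) {f g : (Fin n → ℂ) → F} {y : Fin n → ℂ}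
    (hf : DifferentiableAt ℝ f y) (hg : DifferentiableAt ℝ g y) :
    wirt u (fun z => f z + g z) y = wirt u f y + wirt u g y := by
  simp only [wirt, fderiv_fun_add hf hg, add_apply]
  module

theorem wirtBar_add (u : Fin n → ℂ) {f g : (Fin n → ℂ) → F} {y : Fin n → ℂ}
    (hf : DifferentiableAt ℝ f y) (hg : DifferentiableAt ℝ g y) :
    wirtBar u (fun z => f z + g z) y = wirtBar u f y + wirtBar u g y := by
  simp only [wirtBar, fderiv_fun_add hf hg, add_apply]
  module

theorem wirt_sub (u : Fin n → ℂ) {f g : (Fin n → ℂ) → F} {y : Fin n → ℂ}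
    (hf : DifferentiableAt ℝ f y) (hg : DifferentiableAt ℝ g y) :
    wirt u (fun z => f z - g z) y = wirt u f y - wirt u g y := by
  simp only [wirt, fderiv_fun_sub hf hg, sub_apply]
  module

theorem wirtBar_sub (u : Fin n → ℂ) {f g : (Fin n → ℂ) → F} {y : Fin n → ℂ}
    (hf : DifferentiableAt ℝ f y) (hg : DifferentiableAt ℝ g y) :
    wirtBar u (fun z => f z - g z) y = wirtBar u f y - wirtBar u g y := by
  simp only [wirtBar, fderiv_fun_sub hf hg, sub_apply]
  module

theorem wirtBar_sum {ι : Type*} (s : Finset ι) (u : Fin n → ℂ) {f : ι → (Fin n → ℂ) → F}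
    {y : Fin n → ℂ} (hf : ∀ i ∈ s, DifferentiableAt ℝ (f i) y) :
    wirtBar u (fun z => ∑ i ∈ s, f i z) y = ∑ i ∈ s, wirtBar u (f i) y := by
  simp only [wirtBar, fderiv_fun_sum hf, sum_apply, Finset.smul_sum, ← Finset.sum_add_distrib]

theorem wirtBar_mul (u : Fin n → ℂ) {f g : (Fin n → ℂ) → ℂ} {y : Fin n → ℂ}
    (hf : DifferentiableAt ℝ f y) (hg : DifferentiableAt ℝ g y) :
    wirtBar u (fun z => f z * g z) y = wirtBar u f y * g y + f y * wirtBar u g y := by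
  simp only [wirtBar, fderiv_fun_mul hf hg, add_apply, smul_apply, smul_eq_mul]
  ring

theorem wirt_clm_comp (u : Fin n → ℂ) {F' : Type*} [NormedAddCommGroup F'] [NormedSpace ℂ F']
    (L : F →L[ℂ] F') {f : (Fin n → ℂ) → F} {y : Fin n → ℂ} (hf : DifferentiableAt ℝ f y) :
    wirt u (fun z => L (f z)) y = L (wirt u f y) := by
  have h : HasFDerivAt (fun z => L (f z)) ((L.restrictScalars ℝ).comp (fderiv ℝ f y)) y :=
    (L.restrictScalars ℝ).hasFDerivAt.comp y hf.hasFDerivAt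
  simp [wirt, h.fderiv]

theorem wirtBar_clm_comp (u : Fin n → ℂ) {F' : Type*} [NormedAddCommGroup F'] [NormedSpace ℂ F']
    (L : F →L[ℂ] F') {f : (Fin n → ℂ) → F} {y : Fin n → ℂ} (hf : DifferentiableAt ℝ f y) :
    wirtBar u (fun z => L (f z)) y = L (wirtBar u f y) := by
  have h : HasFDerivAt (fun z => L (f z)) ((L.restrictScalars ℝ).comp (fderiv ℝ f y)) y :=
    (L.restrictScalars ℝ).hasFDerivAt.comp y hf.hasFDerivAt
  simp [wirtBar, h.fderiv]

theorem fderiv_star_apply {f : (Fin n → ℂ) → ℂ} {y : Fin n → ℂ} (hf : DifferentiableAt ℝ f y)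
    (w : Fin n → ℂ) : fderiv ℝ (fun z => star (f z)) y w = star (fderiv ℝ f y w) := by
  have h : HasFDerivAt (fun z => star (f z))
      ((Complex.conjCLE : ℂ →L[ℝ] ℂ).comp (fderiv ℝ f y)) y :=
    (Complex.conjCLE : ℂ →L[ℝ] ℂ).hasFDerivAt.comp y hf.hasFDerivAt
  rw [h.fderiv]
  rfl

theorem wirt_star (u : Fin n → ℂ) {f : (Fin n → ℂ) → ℂ} {y : Fin n → ℂ}
    (hf : DifferentiableAt ℝ f y) :
    wirt u (fun z => star (f z)) y = star (wirtBar u f y) := by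
  rw [wirt, wirtBar, fderiv_star_apply hf, fderiv_star_apply hf]
  simp only [smul_eq_mul, star_mul', star_add,
    Complex.star_def, map_div₀, map_one, map_ofNat, Complex.conj_I]
  ring

theorem wirtBar_star (u : Fin n → ℂ) {f : (Fin n → ℂ) → ℂ} {y : Fin n → ℂ}
    (hf : DifferentiableAt ℝ f y) :
    wirtBar u (fun z => star (f z)) y = star (wirt u f y) := by
  rw [wirt, wirtBar, fderiv_star_apply hf, fderiv_star_apply hf]
  simp only [smul_eq_mul, star_mul', star_sub,
    Complex.star_def, map_div₀, map_one, map_ofNat, Complex.conj_I]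
  ring

theorem wirtBar_pi_apply (u : Fin n → ℂ) {f : (Fin n → ℂ) → Fin n → ℂ} {y : Fin n → ℂ}
    (hf : DifferentiableAt ℝ f y) (i : Fin n) :
    wirtBar u f y i = wirtBar u (fun z => f z i) y :=
  (wirtBar_clm_comp u (ContinuousLinearMap.proj (R := ℂ) (φ := fun _ : Fin n => ℂ) i) hf).symm

theorem ContDiffOn.wirt {f : (Fin n → ℂ) → F} {U : Set (Fin n → ℂ)} (hU : IsOpen U)
    (hf : ContDiffOn ℝ ∞ f U) (u : Fin n → ℂ) : ContDiffOn ℝ ∞ (fun z => wirt u f z) U := by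
  have h : ∀ v : Fin n → ℂ, ContDiffOn ℝ ∞ (fun z => fderiv ℝ f z v) U := fun v =>
    (hf.fderiv_of_isOpen hU (m := ∞) (by simp)).clm_apply contDiffOn_const
  exact contDiffOn_const.smul ((h u).sub (contDiffOn_const.smul (h _)))

theorem ContDiffOn.wirtBar {f : (Fin n → ℂ) → F} {U : Set (Fin n → ℂ)} (hU : IsOpen U)
    (hf : ContDiffOn ℝ ∞ f U) (u : Fin n → ℂ) : ContDiffOn ℝ ∞ (fun z => wirtBar u f z) U := by
  have h : ∀ v : Fin n → ℂ, ContDiffOn ℝ ∞ (fun z => fderiv ℝ f z v) U := fun v =>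
    (hf.fderiv_of_isOpen hU (m := ∞) (by simp)).clm_apply contDiffOn_const
  exact contDiffOn_const.smul ((h u).add (contDiffOn_const.smul (h _)))

theorem fderiv_fderiv_apply {f : (Fin n → ℂ) → F} {y : Fin n → ℂ}
    (hf : DifferentiableAt ℝ (fderiv ℝ f) y) (u v : Fin n → ℂ) :
    fderiv ℝ (fun z => fderiv ℝ f z u) y v = fderiv ℝ (fderiv ℝ f) y v u := by
  rw [fderiv_clm_apply hf (differentiableAt_const _)]
  simp

theorem fderiv_wirt {f : (Fin n → ℂ) → F} {y : Fin n → ℂ}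
    (hf : DifferentiableAt ℝ (fderiv ℝ f) y) (u v : Fin n → ℂ) :
    fderiv ℝ (fun z => wirt u f z) y v = (1 / 2 : ℂ) • (fderiv ℝ (fderiv ℝ f) y v u
      - Complex.I • fderiv ℝ (fderiv ℝ f) y v (Complex.I • u)) := by
  have h : ∀ w : Fin n → ℂ, DifferentiableAt ℝ (fun z => fderiv ℝ f z w) y := fun w =>
    hf.clm_apply (differentiableAt_const _)
  have h1 : HasFDerivAt (fun z => wirt u f z) _ y :=
    ((h u).hasFDerivAt.sub ((h (Complex.I • u)).hasFDerivAt.const_smul Complex.I)).const_smul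
      (1 / 2 : ℂ)
  rw [h1.fderiv]
  simp [fderiv_fderiv_apply hf]

theorem fderiv_wirtBar {f : (Fin n → ℂ) → F} {y : Fin n → ℂ}
    (hf : DifferentiableAt ℝ (fderiv ℝ f) y) (u v : Fin n → ℂ) :
    fderiv ℝ (fun z => wirtBar u f z) y v = (1 / 2 : ℂ) • (fderiv ℝ (fderiv ℝ f) y v u
      + Complex.I • fderiv ℝ (fderiv ℝ f) y v (Complex.I • u)) := by
  have h : ∀ w : Fin n → ℂ, DifferentiableAt ℝ (fun z => fderiv ℝ f z w) y := fun w =>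
    hf.clm_apply (differentiableAt_const _)
  have h1 : HasFDerivAt (fun z => wirtBar u f z) _ y :=
    ((h u).hasFDerivAt.add ((h (Complex.I • u)).hasFDerivAt.const_smul Complex.I)).const_smul
      (1 / 2 : ℂ)
  rw [h1.fderiv]
  simp [fderiv_fderiv_apply hf]

theorem differentiableAt_fderiv {f : (Fin n → ℂ) → F} {y : Fin n → ℂ}
    (hf : ContDiffAt ℝ 2 f y) : DifferentiableAt ℝ (fderiv ℝ f) y :=
  (hf.fderiv_right (m := 1) (by norm_num)).differentiableAt (by norm_num)

/-- Both sides are the same combination of the second real derivative at `u`, `I • u`, `v`, `I • v`,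
so its symmetry suffices. -/
theorem wirt_wirtBar_comm {f : (Fin n → ℂ) → F} {y : Fin n → ℂ} (hf : ContDiffAt ℝ 2 f y)
    (u v : Fin n → ℂ) :
    wirt u (fun z => wirtBar v f z) y = wirtBar v (fun z => wirt u f z) y := by
  have hd := differentiableAt_fderiv hf
  have hs := hf.isSymmSndFDerivAt (by simp)
  rw [wirt, wirtBar, fderiv_wirtBar hd, fderiv_wirtBar hd, fderiv_wirt hd, fderiv_wirt hd,
    hs.eq u v, hs.eq u, hs.eq (Complex.I • u) v, hs.eq (Complex.I • u)]
  module

end WirtingerCalculus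

/-! ### The pairing -/

section Pairing

variable {n : ℕ} {G : (Fin n → ℂ) → Matrix (Fin n) (Fin n) ℂ} {y : Fin n → ℂ}

theorem pair_add_left (u u' v : Fin n → ℂ) :
    pair G y (u + u') v = pair G y u v + pair G y u' v := by
  simp only [pair, Pi.add_apply, mul_add, add_mul, Finset.sum_add_distrib]

theorem pair_add_right (u v v' : Fin n → ℂ) :
    pair G y u (v + v') = pair G y u v + pair G y u v' := by
  simp only [pair, Pi.add_apply, star_add, mul_add, Finset.sum_add_distrib]

theorem pair_smul_left (c : ℂ) (u v : Fin n → ℂ) : pair G y (c • u) v = c * pair G y u v := by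
  simp only [pair, Pi.smul_apply, smul_eq_mul, Finset.mul_sum]
  exact Finset.sum_congr rfl fun i _ => Finset.sum_congr rfl fun j _ => by ring

theorem pair_smul_right (c : ℂ) (u v : Fin n → ℂ) :
    pair G y u (c • v) = star c * pair G y u v := by
  simp only [pair, Pi.smul_apply, smul_eq_mul, Finset.mul_sum, star_mul']
  exact Finset.sum_congr rfl fun i _ => Finset.sum_congr rfl fun j _ => by ring

@[simp] theorem pair_zero_left (v : Fin n → ℂ) : pair G y 0 v = 0 := by simp [pair]

@[simp] theorem pair_zero_right (v : Fin n → ℂ) : pair G y v 0 = 0 := by simp [pair]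

theorem pair_neg_left (u v : Fin n → ℂ) : pair G y (-u) v = -pair G y u v := by
  simp [pair]

theorem pair_neg_right (u v : Fin n → ℂ) : pair G y u (-v) = -pair G y u v := by
  simp [pair]

theorem pair_sub_left (u u' v : Fin n → ℂ) :
    pair G y (u - u') v = pair G y u v - pair G y u' v := by
  rw [sub_eq_add_neg, pair_add_left, pair_neg_left, sub_eq_add_neg]

theorem pair_sub_right (u v v' : Fin n → ℂ) :
    pair G y u (v - v') = pair G y u v - pair G y u v' := by
  rw [sub_eq_add_neg, pair_add_right, pair_neg_right, sub_eq_add_neg]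

theorem pair_sum_left {ι : Type*} (s : Finset ι) (u : ι → Fin n → ℂ) (v : Fin n → ℂ) :
    pair G y (∑ i ∈ s, u i) v = ∑ i ∈ s, pair G y (u i) v := by
  induction s using Finset.cons_induction with
  | empty => simp
  | cons a s ha ih => rw [Finset.sum_cons, Finset.sum_cons, pair_add_left, ih]

theorem star_pair (hG : (G y).IsHermitian) (u v : Fin n → ℂ) :
    star (pair G y u v) = pair G y v u := by
  simp only [pair, star_sum, star_mul', star_star]
  rw [Finset.sum_comm]
  refine Finset.sum_congr rfl fun i _ => Finset.sum_congr rfl fun j _ => ?_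
  rw [hG.apply]
  ring

theorem pair_single_single (a b : Fin n) :
    pair G y (Pi.single a 1) (Pi.single b 1) = G y a b := by
  rw [pair, Finset.sum_eq_single a, Finset.sum_eq_single b]
  · simp
  · intro j _ hj; simp [hj]
  · simp
  · intro j _ hj; simp [hj]
  · simp

variable {e : Fin n → Fin n → ℂ}

theorem IsUnitaryFrame.matrix_eq (he : IsUnitaryFrame G y e) :
    Matrix.of e * G y * (Matrix.of e).conjTranspose = 1 := by
  ext i j
  rw [Matrix.one_apply, ← he i j, pair, Finset.sum_comm]
  simp only [Matrix.mul_apply, Matrix.conjTranspose_apply, Matrix.of_apply, Finset.sum_mul]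
  exact Finset.sum_congr rfl fun i _ => Finset.sum_congr rfl fun j _ => by ring

/-- Unitarity says `E G Eᴴ = 1` for the square matrix `E` of the frame. A one-sided inverse is
two-sided, so `G Eᴴ E = 1` as well, and that is the expansion in the frame. -/
theorem IsUnitaryFrame.sum_smul (he : IsUnitaryFrame G y e) (u : Fin n → ℂ) :
    ∑ i, pair G y u (e i) • e i = u := by
  have h := he.matrix_eq
  rw [Matrix.mul_assoc, mul_eq_one_comm] at h
  have h2 : Matrix.vecMul (Matrix.vecMul u (G y * (Matrix.of e).conjTranspose)) (Matrix.of e)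
      = u := by
    rw [Matrix.vecMul_vecMul, h, Matrix.vecMul_one]
  conv_rhs => rw [← h2]
  ext k
  rw [Finset.sum_apply, Matrix.vecMul, dotProduct]
  refine Finset.sum_congr rfl fun i _ => ?_
  rw [Pi.smul_apply, smul_eq_mul, Matrix.of_apply]
  congr 1
  rw [Matrix.vecMul, dotProduct, pair]
  refine Finset.sum_congr rfl fun a _ => ?_
  rw [Matrix.mul_apply, Finset.mul_sum]
  refine Finset.sum_congr rfl fun b _ => ?_
  simp only [Matrix.conjTranspose_apply, Matrix.of_apply]
  ring

/-- Parseval's identity in a unitary frame. -/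
theorem IsUnitaryFrame.pair_eq_sum (he : IsUnitaryFrame G y e) (hG : (G y).IsHermitian)
    (u v : Fin n → ℂ) :
    pair G y u v = ∑ r, pair G y u (e r) * star (pair G y v (e r)) := by
  conv_lhs => rw [← he.sum_smul u]
  simp only [pair_sum_left, pair_smul_left, star_pair hG]

/-- The trace of a linear map in a unitary frame. -/
theorem IsUnitaryFrame.trace_eq (he : IsUnitaryFrame G y e)
    (L : (Fin n → ℂ) →ₗ[ℂ] (Fin n → ℂ)) :
    ∑ k, L (Pi.single k 1) k = ∑ k, pair G y (L (e k)) (e k) := by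
  have h : ∀ k, L (Pi.single k 1) k =
      ∑ i, pair G y (Pi.single k 1) (e i) * L (e i) k := by
    intro k
    conv_lhs => rw [← he.sum_smul (Pi.single k 1)]
    simp [Finset.sum_apply]
  simp only [h]
  rw [Finset.sum_comm]
  refine Finset.sum_congr rfl fun i _ => ?_
  conv_rhs => rw [pi_eq_sum_univ' (L (e i)), pair_sum_left]
  refine Finset.sum_congr rfl fun k _ => ?_
  rw [pair_smul_left, mul_comm]

end Pairing

open scoped ComplexOrder

/-! ### Local geometry of a Hermitian metric -/

/-- `G` is a smooth Hermitian metric on the open set `U`. -/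
structure IsHermitianOn {n : ℕ} (G : (Fin n → ℂ) → Matrix (Fin n) (Fin n) ℂ)
    (U : Set (Fin n → ℂ)) : Prop where
  isOpen : IsOpen U
  contDiffOn : ∀ i j, ContDiffOn ℝ ∞ (fun z => G z i j) U
  posDef : ∀ z ∈ U, (G z).PosDef

section LocalGeometry

variable {n : ℕ} {G : (Fin n → ℂ) → Matrix (Fin n) (Fin n) ℂ} {U : Set (Fin n → ℂ)}
  {y : Fin n → ℂ}

theorem nabla_const_add (u v w z : Fin n → ℂ) :
    nabla G u (fun _ => v + w) z = nabla G u (fun _ => v) z + nabla G u (fun _ => w) z := by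
  simp [nabla, Matrix.add_vecMul]

theorem nabla_const_smul (c : ℂ) (u v z : Fin n → ℂ) :
    nabla G u (fun _ => c • v) z = c • nabla G u (fun _ => v) z := by
  simp [nabla, Matrix.smul_vecMul]

theorem chernMatrix_add (u v z : Fin n → ℂ) :
    chernMatrix G (u + v) z = chernMatrix G u z + chernMatrix G v z := by
  simp only [chernMatrix, ← Matrix.add_mul]
  congr 1
  ext i j
  simp [wirt_add_left]

theorem chernMatrix_smul (c : ℂ) (u z : Fin n → ℂ) :
    chernMatrix G (c • u) z = c • chernMatrix G u z := by
  simp only [chernMatrix, ← Matrix.smul_mul]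
  congr 1
  ext i j
  simp [wirt_smul_left]

theorem nabla_const_add_left (u v w z : Fin n → ℂ) :
    nabla G (u + v) (fun _ => w) z = nabla G u (fun _ => w) z + nabla G v (fun _ => w) z := by
  simp [nabla, chernMatrix_add, Matrix.vecMul_add]

theorem nabla_const_smul_left (c : ℂ) (u v z : Fin n → ℂ) :
    nabla G (c • u) (fun _ => v) z = c • nabla G u (fun _ => v) z := by
  simp [nabla, chernMatrix_smul, Matrix.vecMul_smul]

theorem torsion_add_left (u v w z : Fin n → ℂ) :
    torsion G z (u + v) w = torsion G z u w + torsion G z v w := by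
  simp only [torsion, nabla_const_add, nabla_const_add_left]
  abel

theorem torsion_smul_left (c : ℂ) (u v z : Fin n → ℂ) :
    torsion G z (c • u) v = c • torsion G z u v := by
  simp only [torsion, nabla_const_smul, nabla_const_smul_left, smul_sub]

theorem torsion_swap (u v z : Fin n → ℂ) : torsion G z u v = -torsion G z v u := by
  simp [torsion]

theorem torsion_add_right (u v w z : Fin n → ℂ) :
    torsion G z u (v + w) = torsion G z u v + torsion G z u w := by
  rw [torsion_swap, torsion_add_left, torsion_swap v, torsion_swap w]
  abel

theorem torsion_smul_right (c : ℂ) (u v z : Fin n → ℂ) :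
    torsion G z u (c • v) = c • torsion G z u v := by
  rw [torsion_swap, torsion_smul_left, torsion_swap v, smul_neg, neg_neg]

@[simp] theorem nablaBar_const (w v z : Fin n → ℂ) : nablaBar w (fun _ => v) z = 0 := by
  simp [nablaBar]

@[simp] theorem torsion_zero_left (v z : Fin n → ℂ) : torsion G z 0 v = 0 := by
  simpa using torsion_smul_left (G := G) 0 0 v z

@[simp] theorem torsion_zero_right (v z : Fin n → ℂ) : torsion G z v 0 = 0 := by
  rw [torsion_swap, torsion_zero_left, neg_zero]

/-- The extension of `w` is constant, so `∇_v̄ w` vanishes identically and only the second term of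
the commutator survives. -/
theorem curvatureOp_eq (u v w z : Fin n → ℂ) :
    curvatureOp G z u v w = -wirtBar v (fun t => nabla G u (fun _ => w) t) z := by
  simp only [curvatureOp, nabla, nablaBar, wirt_const]
  simp

theorem nablaBarTorsion_eq (w u v z : Fin n → ℂ) :
    nablaBarTorsion G w z u v = wirtBar w (fun t => torsion G t u v) z := by
  simp only [nablaBarTorsion, nablaBar_const, torsion_zero_left, torsion_zero_right, sub_zero]
  rfl

namespace IsHermitianOn

variable (hG : IsHermitianOn G U)

include hG

theorem isHermitian {z : Fin n → ℂ} (hz : z ∈ U) : (G z).IsHermitian := (hG.posDef z hz).1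

theorem isUnit_det {z : Fin n → ℂ} (hz : z ∈ U) : IsUnit (G z).det :=
  (Matrix.isUnit_iff_isUnit_det _).1 (hG.posDef z hz).isUnit

theorem contDiffOn_pair (u v : Fin n → ℂ) : ContDiffOn ℝ ∞ (fun z => pair G z u v) U :=
  ContDiffOn.sum fun i _ => ContDiffOn.sum fun j _ =>
    ((hG.contDiffOn i j).mul contDiffOn_const).mul contDiffOn_const

theorem contDiffOn_det : ContDiffOn ℝ ∞ (fun z => (G z).det) U := by
  simp only [Matrix.det_apply']
  exact ContDiffOn.sum fun σ _ => contDiffOn_const.mul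
    (contDiffOn_prod fun i _ => hG.contDiffOn _ _)

/-- Cramer's rule: the entries of the adjugate are polynomials in the entries of `G`, and `det G`
does not vanish on `U`. -/
theorem contDiffOn_inv (i j : Fin n) : ContDiffOn ℝ ∞ (fun z => (G z)⁻¹ i j) U := by
  have h : ContDiffOn ℝ ∞ (fun z => ((G z).det)⁻¹ * (G z).adjugate i j) U := by
    refine (hG.contDiffOn_det.inv fun z hz => (hG.isUnit_det hz).ne_zero).mul ?_
    simp only [Matrix.adjugate_apply, Matrix.det_apply']
    refine ContDiffOn.sum fun σ _ => contDiffOn_const.mul (contDiffOn_prod fun k _ => ?_)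
    by_cases hk : σ k = j
    · simp only [hk, Matrix.updateRow_self]
      exact contDiffOn_const
    · simp only [ne_eq, hk, not_false_eq_true, Matrix.updateRow_ne]
      exact hG.contDiffOn _ _
  refine h.congr fun z _ => ?_
  rw [Matrix.inv_def, Ring.inverse_eq_inv', Matrix.smul_apply, smul_eq_mul]

theorem contDiffOn_nabla (u v : Fin n → ℂ) :
    ContDiffOn ℝ ∞ (fun z => nabla G u (fun _ => v) z) U := by
  rw [contDiffOn_pi]
  intro i
  simp only [nabla, wirt_const, zero_add, Matrix.vecMul, dotProduct, chernMatrix,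
    Matrix.mul_apply]
  exact ContDiffOn.sum fun k _ => contDiffOn_const.mul <| ContDiffOn.sum fun l _ =>
    (ContDiffOn.wirt hG.isOpen (hG.contDiffOn k l) u).mul (hG.contDiffOn_inv l i)

theorem contDiffOn_torsion (u v : Fin n → ℂ) :
    ContDiffOn ℝ ∞ (fun z => torsion G z u v) U :=
  (hG.contDiffOn_nabla u v).sub (hG.contDiffOn_nabla v u)

theorem contDiffAt_of {F : Type*} [NormedAddCommGroup F] [NormedSpace ℝ F]
    {f : (Fin n → ℂ) → F} (hf : ContDiffOn ℝ ∞ f U) (hy : y ∈ U) : ContDiffAt ℝ ∞ f y :=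
  hf.contDiffAt (hG.isOpen.mem_nhds hy)

theorem differentiableAt_of {F : Type*} [NormedAddCommGroup F] [NormedSpace ℝ F]
    {f : (Fin n → ℂ) → F} (hf : ContDiffOn ℝ ∞ f U) (hy : y ∈ U) : DifferentiableAt ℝ f y :=
  (hG.contDiffAt_of hf hy).differentiableAt (by simp)

theorem contDiffAt_two_of {F : Type*} [NormedAddCommGroup F] [NormedSpace ℝ F]
    {f : (Fin n → ℂ) → F} (hf : ContDiffOn ℝ ∞ f U) (hy : y ∈ U) : ContDiffAt ℝ 2 f y :=
  (hG.contDiffAt_of hf hy).of_le (WithTop.coe_le_coe.2 (le_top : (2 : ℕ∞) ≤ ⊤))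

theorem differentiableAt_entry (hy : y ∈ U) (i j : Fin n) :
    DifferentiableAt ℝ (fun z => G z i j) y := hG.differentiableAt_of (hG.contDiffOn i j) hy

variable (hy : y ∈ U)

include hy

/-- Metric compatibility when the second argument is constant: its `∇̄` is zero. This trades the
connection for first derivatives of the metric without inverting a matrix. -/
theorem pair_nabla (u v x : Fin n → ℂ) :
    pair G y (nabla G u (fun _ => v) y) x = wirt u (fun z => pair G z v x) y := by
  rw [wirt_pair (hG.isUnit_det hy) (hG.differentiableAt_entry hy) u
    (differentiableAt_const _) (differentiableAt_const _), nablaBar_const, pair_zero_right,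
    add_zero]

theorem differentiableAt_pair {X Y : (Fin n → ℂ) → Fin n → ℂ}
    (hX : DifferentiableAt ℝ X y) (hY : DifferentiableAt ℝ Y y) :
    DifferentiableAt ℝ (fun z => pair G z (X z) (Y z)) y := by
  have hX' := differentiableAt_pi.1 hX
  have hY' := differentiableAt_pi.1 hY
  exact DifferentiableAt.fun_sum fun i _ => DifferentiableAt.fun_sum fun j _ =>
    ((hG.differentiableAt_entry hy i j).mul (hX' i)).mul (hY' j).star

/-- The conjugate of `wirt_pair`, obtained from the Hermitian symmetry of the pairing. -/
theorem wirtBar_pair (u : Fin n → ℂ) {X Y : (Fin n → ℂ) → Fin n → ℂ}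
    (hX : DifferentiableAt ℝ X y) (hY : DifferentiableAt ℝ Y y) :
    wirtBar u (fun z => pair G z (X z) (Y z)) y =
      pair G y (wirtBar u X y) (Y y) + pair G y (X y) (nabla G u Y y) := by
  have h : (fun z => pair G z (X z) (Y z)) =ᶠ[nhds y]
      fun z => star (pair G z (Y z) (X z)) := by
    filter_upwards [hG.isOpen.mem_nhds hy] with z hz
    rw [star_pair (hG.isHermitian hz)]
  rw [wirtBar_congr h, wirtBar_star u (hG.differentiableAt_pair hy hY hX),
    wirt_pair (hG.isUnit_det hy) (hG.differentiableAt_entry hy) u hY hX, star_add,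
    star_pair (hG.isHermitian hy), star_pair (hG.isHermitian hy), add_comm]
  rfl

theorem pair_wirtBar_nabla (u v w x : Fin n → ℂ) :
    pair G y (wirtBar v (fun z => nabla G u (fun _ => w) z) y) x =
      wirtBar v (fun z => wirt u (fun t => pair G t w x) z) y
        - pair G y (nabla G u (fun _ => w) y) (nabla G v (fun _ => x) y) := by
  have h : (fun z => wirt u (fun t => pair G t w x) z) =ᶠ[nhds y]
      fun z => pair G z (nabla G u (fun _ => w) z) x := by
    filter_upwards [hG.isOpen.mem_nhds hy] with z hz
    rw [hG.pair_nabla hz]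
  rw [wirtBar_congr h, hG.wirtBar_pair hy v
    (hG.differentiableAt_of (hG.contDiffOn_nabla u w) hy) (differentiableAt_const x)]
  ring

/-- The classical `R = -∂∂̄g + ∂g · g⁻¹ · ∂̄g`, with the quadratic term written as a pairing of
covariant derivatives. -/
theorem curvature_eq (u v w x : Fin n → ℂ) :
    curvature G y u v w x =
      pair G y (nabla G u (fun _ => w) y) (nabla G v (fun _ => x) y)
        - wirtBar v (fun z => wirt u (fun t => pair G t w x) z) y := by
  rw [curvature, curvatureOp_eq, pair_neg_left, hG.pair_wirtBar_nabla hy]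
  ring

/-- In `curvature_eq` the quadratic term is visibly Hermitian; for the second-order term one needs
that `∂` and `∂̄` commute. This transfers additivity and homogeneity from the linear to the
conjugate-linear arguments. -/
theorem star_curvature (u v w x : Fin n → ℂ) :
    star (curvature G y u v w x) = curvature G y v u x w := by
  have h : (fun z => wirt v (fun t => pair G t x w) z) =ᶠ[nhds y]
      fun z => star (wirtBar v (fun t => pair G t w x) z) := by
    filter_upwards [hG.isOpen.mem_nhds hy] with z hz
    rw [← wirt_star v (hG.differentiableAt_of (hG.contDiffOn_pair w x) hz)]
    refine wirt_congr ?_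
    filter_upwards [hG.isOpen.mem_nhds hz] with t ht
    rw [star_pair (hG.isHermitian ht)]
  rw [hG.curvature_eq hy, hG.curvature_eq hy, star_sub, star_pair (hG.isHermitian hy),
    wirtBar_congr h, wirtBar_star u (hG.differentiableAt_of
      (ContDiffOn.wirtBar hG.isOpen (hG.contDiffOn_pair w x) v) hy),
    wirt_wirtBar_comm (hG.contDiffAt_two_of (hG.contDiffOn_pair w x) hy)]

/-- The first Bianchi identity of the Chern connection. -/
theorem nablaBarTorsion_eq_curvatureOp (w u v : Fin n → ℂ) :
    nablaBarTorsion G w y u v = curvatureOp G y v w u - curvatureOp G y u w v := by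
  rw [nablaBarTorsion_eq, curvatureOp_eq, curvatureOp_eq, sub_neg_eq_add, neg_add_eq_sub,
    ← wirtBar_sub w (hG.differentiableAt_of (hG.contDiffOn_nabla u v) hy)
      (hG.differentiableAt_of (hG.contDiffOn_nabla v u) hy)]
  rfl

theorem pair_nablaBarTorsion (w u v x : Fin n → ℂ) :
    pair G y (nablaBarTorsion G w y u v) x = curvature G y v w u x - curvature G y u w v x := by
  rw [hG.nablaBarTorsion_eq_curvatureOp hy, pair_sub_left]
  rfl

theorem curvatureOp_add_left (u u' v w : Fin n → ℂ) :
    curvatureOp G y (u + u') v w = curvatureOp G y u v w + curvatureOp G y u' v w := by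
  simp only [curvatureOp_eq, nabla_const_add_left]
  rw [wirtBar_add v (hG.differentiableAt_of (hG.contDiffOn_nabla u w) hy)
      (hG.differentiableAt_of (hG.contDiffOn_nabla u' w) hy), neg_add]

theorem curvatureOp_add_right (u v w w' : Fin n → ℂ) :
    curvatureOp G y u v (w + w') = curvatureOp G y u v w + curvatureOp G y u v w' := by
  simp only [curvatureOp_eq, nabla_const_add]
  rw [wirtBar_add v (hG.differentiableAt_of (hG.contDiffOn_nabla u w) hy)
      (hG.differentiableAt_of (hG.contDiffOn_nabla u w') hy), neg_add]

theorem curvatureOp_smul_left (c : ℂ) (u v w : Fin n → ℂ) :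
    curvatureOp G y (c • u) v w = c • curvatureOp G y u v w := by
  simp only [curvatureOp_eq, nabla_const_smul_left]
  rw [smul_neg]
  exact congrArg Neg.neg (wirtBar_clm_comp v (c • ContinuousLinearMap.id ℂ (Fin n → ℂ))
    (hG.differentiableAt_of (hG.contDiffOn_nabla u w) hy))

theorem curvatureOp_smul_right (c : ℂ) (u v w : Fin n → ℂ) :
    curvatureOp G y u v (c • w) = c • curvatureOp G y u v w := by
  simp only [curvatureOp_eq, nabla_const_smul]
  rw [smul_neg]
  exact congrArg Neg.neg (wirtBar_clm_comp v (c • ContinuousLinearMap.id ℂ (Fin n → ℂ))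
    (hG.differentiableAt_of (hG.contDiffOn_nabla u w) hy))

end IsHermitianOn

end LocalGeometry

/-! ### The Dolbeault operators on forms of pure type -/

section Dolbeault

variable {n k : ℕ} {α : (Fin n → ℂ) → (Fin n → ℂ) [⋀^Fin k]→L[ℝ] ℂ} {y : Fin n → ℂ} {c : ℂ}

theorem cplxJ_apply (u : Fin n → ℂ) : cplxJ n u = Complex.I • u := rfl

theorem apply_smul_I (hJ : (α y).compContinuousLinearMap (cplxJ n) = c • α y)
    (u : Fin k → Fin n → ℂ) : α y (fun j => Complex.I • u j) = c * α y u := by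
  exact DFunLike.congr_fun hJ u

/-- For an eigenform of `J` the eigenvalue produced by the inner `J` is undone by the outer `J⁻¹ =
-J` on the arguments left in `α`. Only the direction of differentiation stays rotated. -/
theorem dc_apply (hα : DifferentiableAt ℝ α y)
    (hJ : ∀ᶠ z in nhds y, (α z).compContinuousLinearMap (cplxJ n) = c • α z)
    (v : Fin (k + 1) → Fin n → ℂ) :
    dc α y v = -∑ i : Fin (k + 1), (-1 : ℂ) ^ (i : ℕ) *
      fderiv ℝ (fun z => α z (i.removeNth v)) y (Complex.I • v i) := by
  have h1 : (fun z => (α z).compContinuousLinearMap (cplxJ n)) =ᶠ[nhds y] fun z => c • α z := hJ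
  have hd : DifferentiableAt ℝ (fun z => c • α z) y := hα.const_smul c
  rw [dc, h1.extDeriv_eq, ContinuousAlternatingMap.compContinuousLinearMap_apply,
    extDeriv_apply hd, ← Finset.sum_neg_distrib]
  refine Finset.sum_congr rfl fun i _ => ?_
  have h2 : (fun z => (c • α z) (i.removeNth (⇑(-cplxJ n) ∘ v))) =ᶠ[nhds y]
      fun z => α z (i.removeNth v) := by
    filter_upwards [hJ] with z hz
    have := apply_smul_I hz (i.removeNth (⇑(-cplxJ n) ∘ v))
    rw [ContinuousAlternatingMap.smul_apply, smul_eq_mul, ← this]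
    congr 1
    ext j : 1
    simp [Fin.removeNth, cplxJ_apply, I_smul_I_smul]
  rw [h2.fderiv_eq]
  simp [cplxJ_apply]

theorem extDeriv_apply_mul (hα : DifferentiableAt ℝ α y) (v : Fin (k + 1) → Fin n → ℂ) :
    extDeriv α y v = ∑ i : Fin (k + 1), (-1 : ℂ) ^ (i : ℕ) *
      fderiv ℝ (fun z => α z (i.removeNth v)) y (v i) := by
  rw [extDeriv_apply hα]
  simp

/-- On an eigenform of `J` the real operators `d` and `dᶜ` combine term by term, so `∂̄` is the
alternating sum of Wirtinger derivatives, as on forms of pure type. -/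
theorem delbar_apply (hα : DifferentiableAt ℝ α y)
    (hJ : ∀ᶠ z in nhds y, (α z).compContinuousLinearMap (cplxJ n) = c • α z)
    (v : Fin (k + 1) → Fin n → ℂ) :
    delbar α y v = ∑ i : Fin (k + 1), (-1 : ℂ) ^ (i : ℕ) *
      wirtBar (v i) (fun z => α z (i.removeNth v)) y := by
  simp only [delbar, ContinuousAlternatingMap.smul_apply, ContinuousAlternatingMap.sub_apply,
    dc_apply hα hJ, extDeriv_apply_mul hα, wirtBar, smul_eq_mul, mul_neg, sub_neg_eq_add,
    Finset.mul_sum, ← Finset.sum_add_distrib]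
  exact Finset.sum_congr rfl fun i _ => by ring

theorem del_apply (hα : DifferentiableAt ℝ α y)
    (hJ : ∀ᶠ z in nhds y, (α z).compContinuousLinearMap (cplxJ n) = c • α z)
    (v : Fin (k + 1) → Fin n → ℂ) :
    del α y v = ∑ i : Fin (k + 1), (-1 : ℂ) ^ (i : ℕ) *
      wirt (v i) (fun z => α z (i.removeNth v)) y := by
  simp only [del, ContinuousAlternatingMap.smul_apply, ContinuousAlternatingMap.add_apply,
    dc_apply hα hJ, extDeriv_apply_mul hα, wirt, smul_eq_mul, mul_neg, ← sub_eq_add_neg,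
    Finset.mul_sum, ← Finset.sum_sub_distrib]
  exact Finset.sum_congr rfl fun i _ => by ring

/-- `∂̄` raises `q` by one, which multiplies `i^(p-q)` by `-i`. Hence `∂̄α` is again an eigenform
and `del_apply` can be used on it. -/
theorem delbar_comp_cplxJ (hα : DifferentiableAt ℝ α y)
    (hJ : ∀ᶠ z in nhds y, (α z).compContinuousLinearMap (cplxJ n) = c • α z) :
    (delbar α y).compContinuousLinearMap (cplxJ n) = (-Complex.I * c) • delbar α y := by
  ext v
  rw [ContinuousAlternatingMap.compContinuousLinearMap_apply, delbar_apply hα hJ,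
    ContinuousAlternatingMap.smul_apply, delbar_apply hα hJ, smul_eq_mul, Finset.mul_sum]
  refine Finset.sum_congr rfl fun i _ => ?_
  have h : (fun z => α z (i.removeNth (⇑(cplxJ n) ∘ v))) =ᶠ[nhds y]
      fun z => (c • ContinuousLinearMap.id ℂ ℂ) (α z (i.removeNth v)) := by
    filter_upwards [hJ] with z hz
    exact apply_smul_I hz (i.removeNth v)
  have hd : DifferentiableAt ℝ (fun z => α z (i.removeNth v)) y :=
    hα.continuousAlternatingMap_apply_const _
  rw [wirtBar_congr h, wirtBar_clm_comp _ _ hd, Function.comp_apply, cplxJ_apply,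
    wirtBar_smul_left]
  simp
  ring

theorem ContDiffOn.extDeriv {U : Set (Fin n → ℂ)} (hU : IsOpen U) (hα : ContDiffOn ℝ ∞ α U) :
    ContDiffOn ℝ ∞ (fun z => extDeriv α z) U := by
  have h := hα.fderiv_of_isOpen hU (m := ∞) (by simp)
  exact (ContinuousAlternatingMap.alternatizeUncurryFinCLM ℝ (Fin n → ℂ) ℂ
    (n := k)).contDiff.comp_contDiffOn h

theorem ContDiffOn.compContinuousLinearMap {U : Set (Fin n → ℂ)}
    (hα : ContDiffOn ℝ ∞ α U) (f : (Fin n → ℂ) →L[ℝ] (Fin n → ℂ)) :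
    ContDiffOn ℝ ∞ (fun z => (α z).compContinuousLinearMap f) U :=
  (ContinuousAlternatingMap.compContinuousLinearMapCLM (F := ℂ) (ι := Fin k)
    f).contDiff.comp_contDiffOn hα

theorem ContDiffOn.delbar {U : Set (Fin n → ℂ)} (hU : IsOpen U) (hα : ContDiffOn ℝ ∞ α U) :
    ContDiffOn ℝ ∞ (fun z => delbar α z) U := by
  have h1 := ContDiffOn.extDeriv hU hα
  have h2 : ContDiffOn ℝ ∞ (fun z => dc α z) U :=
    ContDiffOn.compContinuousLinearMap
      (ContDiffOn.extDeriv hU (ContDiffOn.compContinuousLinearMap hα _)) _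
  exact (h1.sub (h2.const_smul Complex.I)).const_smul (1 / 2 : ℂ)

end Dolbeault

/-! ### Pluriclosed metrics -/

section Pluriclosed

variable {n : ℕ} {G : (Fin n → ℂ) → Matrix (Fin n) (Fin n) ℂ} {U : Set (Fin n → ℂ)}
  {y : Fin n → ℂ}

theorem kahlerForm_apply (u v : Fin n → ℂ) :
    kahlerForm G y ![u, v] = Complex.I * (pair G y u v - pair G y v u) := by
  simp only [kahlerForm, ContinuousAlternatingMap.smul_apply, ContinuousAlternatingMap.sum_apply,
    wedge_apply, smul_eq_mul, pair, ← Finset.sum_sub_distrib]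
  congr 1
  refine Finset.sum_congr rfl fun i _ => Finset.sum_congr rfl fun j _ => ?_
  simp only [dz, conjForm, ContinuousLinearMap.comp_apply, ContinuousLinearMap.proj_apply,
    ContinuousLinearEquiv.coe_coe, Complex.conjCLE_apply, Complex.star_def]
  ring

/-- A form of type `(1,1)` is invariant under `J`, since `I` and its conjugate multiply to one. -/
theorem kahlerForm_comp_cplxJ :
    (kahlerForm G y).compContinuousLinearMap (cplxJ n) = (1 : ℂ) • kahlerForm G y := by
  ext v
  have h : v = ![v 0, v 1] := by ext i; fin_cases i <;> rfl
  have h' : ⇑(cplxJ n) ∘ v = ![Complex.I • v 0, Complex.I • v 1] := by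
    ext i; fin_cases i <;> rfl
  rw [ContinuousAlternatingMap.compContinuousLinearMap_apply, h', one_smul, h]
  simp only [kahlerForm_apply, pair_smul_left, pair_smul_right, Complex.star_def, Complex.conj_I]
  simp only [Matrix.cons_val_zero, Matrix.cons_val_one]
  linear_combination (-Complex.I * (pair G y (v 0) (v 1) - pair G y (v 1) (v 0)))
    * Complex.I_mul_I

namespace IsHermitianOn

variable (hG : IsHermitianOn G U)

include hG

theorem contDiffOn_kahlerForm : ContDiffOn ℝ ∞ (fun z => kahlerForm G z) U :=
  (ContDiffOn.sum fun i _ => ContDiffOn.sum fun j _ =>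
    (hG.contDiffOn i j).smul contDiffOn_const).const_smul Complex.I

variable (hy : y ∈ U)

include hy

theorem wirt_wirtBar_kahlerForm (a x u v : Fin n → ℂ) :
    wirt a (fun z => wirtBar x (fun t => kahlerForm G t ![u, v]) z) y =
      Complex.I * (wirt a (fun z => wirtBar x (fun t => pair G t u v) z) y
        - wirt a (fun z => wirtBar x (fun t => pair G t v u) z) y) := by
  have h : (fun z => wirtBar x (fun t => kahlerForm G t ![u, v]) z) =ᶠ[nhds y]
      fun z => (Complex.I • ContinuousLinearMap.id ℂ ℂ)
        (wirtBar x (fun t => pair G t u v) z - wirtBar x (fun t => pair G t v u) z) := by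
    filter_upwards [hG.isOpen.mem_nhds hy] with z hz
    have h1 := hG.differentiableAt_of (hG.contDiffOn_pair u v) hz
    have h2 := hG.differentiableAt_of (hG.contDiffOn_pair v u) hz
    simp only [kahlerForm_apply]
    rw [← wirtBar_sub x h1 h2]
    exact wirtBar_clm_comp x (Complex.I • ContinuousLinearMap.id ℂ ℂ) (h1.fun_sub h2)
  have h1 := hG.differentiableAt_of
    (ContDiffOn.wirtBar hG.isOpen (hG.contDiffOn_pair u v) x) hy
  have h2 := hG.differentiableAt_of
    (ContDiffOn.wirtBar hG.isOpen (hG.contDiffOn_pair v u) x) hy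
  rw [wirt_congr h, wirt_clm_comp a _ (h1.fun_sub h2), wirt_sub a h1 h2]
  rfl

theorem delbar_kahlerForm_apply (v : Fin 3 → Fin n → ℂ) :
    delbar (kahlerForm G) y v = wirtBar (v 0) (fun z => kahlerForm G z ![v 1, v 2]) y
      - wirtBar (v 1) (fun z => kahlerForm G z ![v 0, v 2]) y
      + wirtBar (v 2) (fun z => kahlerForm G z ![v 0, v 1]) y := by
  rw [delbar_apply (hG.differentiableAt_of hG.contDiffOn_kahlerForm hy)
    (Filter.Eventually.of_forall fun z => kahlerForm_comp_cplxJ)]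
  have h0 : (0 : Fin 3).removeNth v = ![v 1, v 2] := by ext i; fin_cases i <;> rfl
  have h1 : (1 : Fin 3).removeNth v = ![v 0, v 2] := by ext i; fin_cases i <;> rfl
  have h2 : (2 : Fin 3).removeNth v = ![v 0, v 1] := by ext i; fin_cases i <;> rfl
  rw [Fin.sum_univ_three, h0, h1, h2]
  simp
  ring

theorem wirt_delbar_kahlerForm (a v₀ v₁ v₂ : Fin n → ℂ) :
    wirt a (fun z => delbar (kahlerForm G) z ![v₀, v₁, v₂]) y =
      wirt a (fun z => wirtBar v₀ (fun t => kahlerForm G t ![v₁, v₂]) z) y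
      - wirt a (fun z => wirtBar v₁ (fun t => kahlerForm G t ![v₀, v₂]) z) y
      + wirt a (fun z => wirtBar v₂ (fun t => kahlerForm G t ![v₀, v₁]) z) y := by
  have h : (fun z => delbar (kahlerForm G) z ![v₀, v₁, v₂]) =ᶠ[nhds y] fun z =>
      wirtBar v₀ (fun t => kahlerForm G t ![v₁, v₂]) z
      - wirtBar v₁ (fun t => kahlerForm G t ![v₀, v₂]) z
      + wirtBar v₂ (fun t => kahlerForm G t ![v₀, v₁]) z := by
    filter_upwards [hG.isOpen.mem_nhds hy] with z hz
    exact hG.delbar_kahlerForm_apply hz ![v₀, v₁, v₂]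
  have hd : ∀ x u v : Fin n → ℂ,
      DifferentiableAt ℝ (fun z => wirtBar x (fun t => kahlerForm G t ![u, v]) z) y := by
    intro x u v
    refine hG.differentiableAt_of (ContDiffOn.wirtBar hG.isOpen ?_ x) hy
    simp only [kahlerForm_apply]
    exact contDiffOn_const.mul ((hG.contDiffOn_pair u v).sub (hG.contDiffOn_pair v u))
  rw [wirt_congr h, wirt_add a ((hd _ _ _).fun_sub (hd _ _ _)) (hd _ _ _),
    wirt_sub a (hd _ _ _) (hd _ _ _)]

theorem del_delbar_kahlerForm_apply (v₀ v₁ v₂ v₃ : Fin n → ℂ) :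
    del (fun z => delbar (kahlerForm G) z) y ![v₀, v₁, v₂, v₃] =
      wirt v₀ (fun z => delbar (kahlerForm G) z ![v₁, v₂, v₃]) y
      - wirt v₁ (fun z => delbar (kahlerForm G) z ![v₀, v₂, v₃]) y
      + wirt v₂ (fun z => delbar (kahlerForm G) z ![v₀, v₁, v₃]) y
      - wirt v₃ (fun z => delbar (kahlerForm G) z ![v₀, v₁, v₂]) y := by
  have hJ : ∀ᶠ z in nhds y, (delbar (kahlerForm G) z).compContinuousLinearMap (cplxJ n) =
      (-Complex.I * 1) • delbar (kahlerForm G) z := by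
    filter_upwards [hG.isOpen.mem_nhds hy] with z hz
    exact delbar_comp_cplxJ (hG.differentiableAt_of hG.contDiffOn_kahlerForm hz)
      (Filter.Eventually.of_forall fun z => kahlerForm_comp_cplxJ)
  rw [del_apply (hG.differentiableAt_of
    (ContDiffOn.delbar hG.isOpen hG.contDiffOn_kahlerForm) hy) hJ]
  have h0 : (0 : Fin 4).removeNth ![v₀, v₁, v₂, v₃] = ![v₁, v₂, v₃] := by
    ext i; fin_cases i <;> rfl
  have h1 : (1 : Fin 4).removeNth ![v₀, v₁, v₂, v₃] = ![v₀, v₂, v₃] := by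
    ext i; fin_cases i <;> rfl
  have h2 : (2 : Fin 4).removeNth ![v₀, v₁, v₂, v₃] = ![v₀, v₁, v₃] := by
    ext i; fin_cases i <;> rfl
  have h3 : (3 : Fin 4).removeNth ![v₀, v₁, v₂, v₃] = ![v₀, v₁, v₂] := by
    ext i; fin_cases i <;> rfl
  rw [Fin.sum_univ_four, h0, h1, h2, h3]
  simp
  ring

/-- `curvature_eq` solved for the second derivative of the metric, which makes its complex linearity
or conjugate linearity in each of the four arguments available. -/
theorem wirt_wirtBar_pair_eq (a x u v : Fin n → ℂ) :
    wirt a (fun z => wirtBar x (fun t => pair G t u v) z) y =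
      pair G y (nabla G a (fun _ => u) y) (nabla G x (fun _ => v) y) - curvature G y a x u v := by
  rw [hG.curvature_eq hy, wirt_wirtBar_comm (hG.contDiffAt_two_of (hG.contDiffOn_pair u v) hy)]
  ring

/-- The `(2,2)`-component of `∂∂̄ω = 0`. -/
theorem pluriclosed_component
    (hpl : del (fun z => delbar (kahlerForm G) z) y = 0) (u v x w : Fin n → ℂ) :
    wirt u (fun z => wirtBar x (fun t => pair G t v w) z) y
      - wirt v (fun z => wirtBar x (fun t => pair G t u w) z) y
      - wirt u (fun z => wirtBar w (fun t => pair G t v x) z) y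
      + wirt v (fun z => wirtBar w (fun t => pair G t u x) z) y = 0 := by
  have key : ∀ v₀ v₁ v₂ v₃, del (fun z => delbar (kahlerForm G) z) y ![v₀, v₁, v₂, v₃] = 0 := by
    simp [hpl]
  simp only [hG.del_delbar_kahlerForm_apply hy, hG.wirt_delbar_kahlerForm hy,
    hG.wirt_wirtBar_kahlerForm hy, hG.wirt_wirtBar_pair_eq hy] at key
  -- Evaluating the real 4-form on `(u, v, x, w)` mixes all distributions of types. Averaging over
  -- `u ↦ I • u` and `v ↦ I • v` projects onto the part that is complex-linear in `u` and `v`; it is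
  -- then conjugate-linear in `x` and `w`, as only type `(2,2)` occurs. The coefficients below are
  -- those of this projection times `I`, which cancels the factor `√-1` of `ω`.
  have k1 := key u v x w
  have k2 := key (Complex.I • u) v x w
  have k3 := key u (Complex.I • v) x w
  have k4 := key (Complex.I • u) (Complex.I • v) x w
  have hR1 : ∀ a b c d, curvature G y (Complex.I • a) b c d = Complex.I * curvature G y a b c d :=
    fun a b c d => by rw [curvature, hG.curvatureOp_smul_left hy, pair_smul_left]; rfl
  have hR2 : ∀ a b c d, curvature G y a b (Complex.I • c) d = Complex.I * curvature G y a b c d :=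
    fun a b c d => by rw [curvature, hG.curvatureOp_smul_right hy, pair_smul_left]; rfl
  have hR3 : ∀ a b c d,
      curvature G y a (Complex.I • b) c d = -Complex.I * curvature G y a b c d := fun a b c d => by
    rw [← hG.star_curvature hy, hR1, star_mul', hG.star_curvature hy]; simp
  have hR4 : ∀ a b c d,
      curvature G y a b c (Complex.I • d) = -Complex.I * curvature G y a b c d := fun a b c d => by
    rw [curvature, pair_smul_right]; simp [curvature]
  simp only [hR1, hR2, hR3, hR4, nabla_const_smul, nabla_const_smul_left, pair_smul_left,
    pair_smul_right, Complex.star_def, Complex.conj_I] at k2 k3 k4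
  simp only [hG.wirt_wirtBar_pair_eq hy]
  linear_combination (norm := skip)
    (Complex.I / 4) * k1 + (1 / 4) * k2 + (1 / 4) * k3 - (Complex.I / 4) * k4
  ring_nf
  simp only [Complex.I_sq, Complex.I_pow_four]
  ring

end IsHermitianOn

end Pluriclosed

/-! ### Polarization -/

section Polarization

variable {V : Type*} [AddCommGroup V] [Module ℂ V]

/-- A form of bidegree `(2,2)` which is symmetric in its two linear and in its two conjugate-linear
arguments vanishes if it vanishes on the diagonal. -/
theorem eq_zero_of_diagonal_eq_zero {S : V → V → V → V → ℂ}
    (add₁ : ∀ u u' v w x, S (u + u') v w x = S u v w x + S u' v w x)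
    (add₂ : ∀ u v v' w x, S u (v + v') w x = S u v w x + S u v' w x)
    (smul₁ : ∀ (c : ℂ) u v w x, S (c • u) v w x = c * S u v w x)
    (smul₂ : ∀ (c : ℂ) u v w x, S u (c • v) w x = star c * S u v w x)
    (symm₁ : ∀ u v w x, S u v w x = S w v u x) (symm₂ : ∀ u v w x, S u v w x = S u x w v)
    (diag : ∀ a, S a a a a = 0) (u v w x : V) : S u v w x = 0 := by
  have add₃ : ∀ u v w w' x, S u v (w + w') x = S u v w x + S u v w' x := fun u v w w' x => by
    rw [symm₁, add₁, symm₁, symm₁ w']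
  have add₄ : ∀ u v w x x', S u v w (x + x') = S u v w x + S u v w x' := fun u v w x x' => by
    rw [symm₂, add₂, symm₂, symm₂ _ x']
  have smul₃ : ∀ (c : ℂ) u v w x, S u v (c • w) x = c * S u v w x := fun c u v w x => by
    rw [symm₁, smul₁, symm₁]
  have smul₄ : ∀ (c : ℂ) u v w x, S u v w (c • x) = star c * S u v w x := fun c u v w x => by
    rw [symm₂, smul₂, symm₂]
  -- Evaluate the diagonal at `a + ζ b` with `ζ` running over the fourth roots of unity. A term with
  -- `p` linear and `q` conjugate-linear entries `b` carries `ζ^(p-q)`; alternating signs keep only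
  -- `p - q = ±2`.
  have h1 : ∀ a b, S b a b a + S a b a b = 0 := by
    intro a b
    have e1 := diag (a + b)
    have e2 := diag (a + Complex.I • b)
    have e3 := diag (a + (-1 : ℂ) • b)
    have e4 := diag (a + (-Complex.I) • b)
    simp only [add₁, add₂, add₃, add₄, smul₁, smul₂, smul₃, smul₄, Complex.star_def, map_neg,
      Complex.conj_I, map_one] at e1 e2 e3 e4
    linear_combination (norm := skip) (1 / 4) * (e1 - e2 + e3 - e4)
    ring_nf
    simp only [Complex.I_sq, Complex.I_pow_four]
    ring
  -- As `(1 + I)² = 2I`, replacing `b` by `(1 + I) • b` multiplies the two surviving terms by `2I`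
  -- and `-2I`, which separates them.
  have h2 : ∀ a b, S b a b a = 0 := by
    intro a b
    have e1 := h1 a b
    have e2 := h1 a ((1 + Complex.I) • b)
    simp only [smul₁, smul₂, smul₃, smul₄, Complex.star_def, map_add, Complex.conj_I,
      map_one] at e2
    have hI : Complex.I ≠ 0 := Complex.I_ne_zero
    refine mul_left_cancel₀ (mul_ne_zero (by norm_num : (4 : ℂ) ≠ 0) hI) ?_
    linear_combination e2 + 2 * Complex.I * e1 - (S b a b a + S a b a b) * Complex.I_mul_I
  -- What remains is ordinary polarization of symmetric forms, first in the linear pair and then in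
  -- the conjugate-linear pair.
  have h3 : ∀ a b b', S b a b' a = 0 := by
    intro a b b'
    have e1 := h2 a (b + b')
    simp only [add₁, add₃, h2, symm₁ b' a b a] at e1
    linear_combination (1 / 2) * e1
  have e1 := h3 (v + x) u w
  simp only [add₂, add₄, h3, symm₂ u x w v] at e1
  linear_combination (1 / 2) * e1

end Polarization

/-! ### Pointwise identities for curvature and torsion, and their contractions -/

section Pointwise

variable {n : ℕ} {G : (Fin n → ℂ) → Matrix (Fin n) (Fin n) ℂ} {U : Set (Fin n → ℂ)}
  {y : Fin n → ℂ} {c : ℂ}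

namespace IsHermitianOn

variable (hG : IsHermitianOn G U) (hy : y ∈ U)

include hG hy

theorem pair_self_ne_zero {X : Fin n → ℂ} (hX : X ≠ 0) : pair G y X X ≠ 0 := by
  have h := (hG.posDef y hy).dotProduct_mulVec_pos (x := star X) (by simpa using hX)
  refine fun h0 => h.ne' ?_
  rw [← h0, pair]
  simp only [dotProduct, Matrix.mulVec, Finset.mul_sum, star_star, Pi.star_apply]
  exact Finset.sum_congr rfl fun i _ => Finset.sum_congr rfl fun j _ => by ring

theorem curvature_diagonal (hH : ∀ X, X ≠ 0 → holSec G y X = c) (X : Fin n → ℂ) :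
    curvature G y X X X X = c * pair G y X X ^ 2 := by
  rcases eq_or_ne X 0 with rfl | hX
  · simp [curvature]
  · rw [← hH X hX, holSec, div_mul_cancel₀]
    exact pow_ne_zero 2 (hG.pair_self_ne_zero hy hX)

theorem curvature_add₁ (u u' v w x : Fin n → ℂ) :
    curvature G y (u + u') v w x = curvature G y u v w x + curvature G y u' v w x := by
  rw [curvature, hG.curvatureOp_add_left hy, pair_add_left]
  rfl

theorem curvature_smul₁ (a : ℂ) (u v w x : Fin n → ℂ) :
    curvature G y (a • u) v w x = a * curvature G y u v w x := by
  rw [curvature, hG.curvatureOp_smul_left hy, pair_smul_left]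
  rfl

theorem curvature_add₂ (u v v' w x : Fin n → ℂ) :
    curvature G y u (v + v') w x = curvature G y u v w x + curvature G y u v' w x := by
  rw [← hG.star_curvature hy, hG.curvature_add₁ hy, star_add, hG.star_curvature hy,
    hG.star_curvature hy]

theorem curvature_smul₂ (a : ℂ) (u v w x : Fin n → ℂ) :
    curvature G y u (a • v) w x = star a * curvature G y u v w x := by
  rw [← hG.star_curvature hy, hG.curvature_smul₁ hy, star_mul', hG.star_curvature hy]

theorem curvature_add₃ (u v w w' x : Fin n → ℂ) :
    curvature G y u v (w + w') x = curvature G y u v w x + curvature G y u v w' x := by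
  rw [curvature, hG.curvatureOp_add_right hy, pair_add_left]
  rfl

theorem curvature_smul₃ (a : ℂ) (u v w x : Fin n → ℂ) :
    curvature G y u v (a • w) x = a * curvature G y u v w x := by
  rw [curvature, hG.curvatureOp_smul_right hy, pair_smul_left]
  rfl

omit hG hy in
theorem curvature_add₄ (u v w x x' : Fin n → ℂ) :
    curvature G y u v w (x + x') = curvature G y u v w x + curvature G y u v w x' :=
  pair_add_right _ _ _

omit hG hy in
theorem curvature_smul₄ (a : ℂ) (u v w x : Fin n → ℂ) :
    curvature G y u v w (a • x) = star a * curvature G y u v w x :=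
  pair_smul_right _ _ _

/-- Constant holomorphic sectional curvature, polarized. -/
theorem curvature_symmetrized (hH : ∀ X, X ≠ 0 → holSec G y X = c) (u v w x : Fin n → ℂ) :
    curvature G y u v w x + curvature G y w v u x + curvature G y u x w v
        + curvature G y w x u v =
      2 * c * (pair G y u v * pair G y w x + pair G y u x * pair G y w v) := by
  rw [← sub_eq_zero]
  refine eq_zero_of_diagonal_eq_zero (S := fun u v w x => curvature G y u v w x
    + curvature G y w v u x + curvature G y u x w v + curvature G y w x u v
    - 2 * c * (pair G y u v * pair G y w x + pair G y u x * pair G y w v))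
    ?_ ?_ ?_ ?_ ?_ ?_ ?_ u v w x
  · intro u u' v w x
    simp only [hG.curvature_add₁ hy, hG.curvature_add₃ hy, pair_add_left]
    ring
  · intro u v v' w x
    simp only [hG.curvature_add₂ hy, curvature_add₄, pair_add_right]
    ring
  · intro a u v w x
    simp only [hG.curvature_smul₁ hy, hG.curvature_smul₃ hy, pair_smul_left]
    ring
  · intro a u v w x
    simp only [hG.curvature_smul₂ hy, curvature_smul₄, pair_smul_right]
    ring
  · intro u v w x
    ring
  · intro u v w x
    ring
  · intro X
    simp only [hG.curvature_diagonal hy hH]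
    ring

/-- After `∂∂̄g` is replaced by `⟨∇, ∇⟩ - R` in the `(2,2)`-component, the four pairings of
covariant derivatives assemble to the pairing of two torsions. The four curvatures group in pairs,
each a component of `∇̄T` by Bianchi. -/
theorem pair_nablaBarTorsion_sub (hpl : del (fun z => delbar (kahlerForm G) z) y = 0)
    (u v w x : Fin n → ℂ) :
    pair G y (nablaBarTorsion G w y u v) x - pair G y (nablaBarTorsion G x y u v) w =
      pair G y (torsion G y u v) (torsion G y x w) := by
  have h := hG.pluriclosed_component hy hpl u v x w
  simp only [hG.wirt_wirtBar_pair_eq hy] at h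
  simp only [hG.pair_nablaBarTorsion hy, torsion, pair_sub_left, pair_sub_right]
  linear_combination -h

/-- Write `A = ⟨(∇_v̄ T)(u,w), x̄⟩` and `B = ⟨(∇_ū T)(v,x), w̄⟩`. By Bianchi, exchanging `u, w` in
`R(u,v̄,w,x̄)` adds `A`, and exchanging `v, x` adds `conj B`. Doing both adds `conj B + ⟨(∇_x̄
T)(u,w), v̄⟩`, whose last term is `A + ⟨T(u,w), conj T(v,x)⟩` by pluriclosedness. The polarized
identity thus reads `4R + 2A + 2 conj B + ⟨T, T̄⟩ = 2c(…)`. -/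
theorem curvature_eq_of_pluriclosed (hpl : del (fun z => delbar (kahlerForm G) z) y = 0)
    (hH : ∀ X, X ≠ 0 → holSec G y X = c) (u v w x : Fin n → ℂ) :
    curvature G y u v w x =
      c / 2 * (pair G y u v * pair G y w x + pair G y u x * pair G y w v)
        - 1 / 4 * pair G y (torsion G y u w) (torsion G y v x)
        - 1 / 2 * (pair G y (nablaBarTorsion G v y u w) x
          + star (pair G y (nablaBarTorsion G u y v x) w)) := by
  rw [← hG.pair_nablaBarTorsion_sub hy hpl]
  simp only [hG.pair_nablaBarTorsion hy, star_sub, hG.star_curvature hy]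
  linear_combination (1 / 4) * hG.curvature_symmetrized hy hH u v w x

theorem nablaBarTorsion_swap (u v w : Fin n → ℂ) :
    nablaBarTorsion G w y u v = -nablaBarTorsion G w y v u := by
  rw [hG.nablaBarTorsion_eq_curvatureOp hy, hG.nablaBarTorsion_eq_curvatureOp hy, neg_sub]

/-- The covariant derivative of the torsion as a linear map in its first argument. -/
noncomputable def nablaBarTorsionLin (w v : Fin n → ℂ) : (Fin n → ℂ) →ₗ[ℂ] (Fin n → ℂ) where
  toFun u := nablaBarTorsion G w y u v
  map_add' u u' := by
    simp only [hG.nablaBarTorsion_eq_curvatureOp hy, hG.curvatureOp_add_left hy,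
      hG.curvatureOp_add_right hy]
    abel
  map_smul' a u := by
    simp only [hG.nablaBarTorsion_eq_curvatureOp hy, hG.curvatureOp_smul_left hy,
      hG.curvatureOp_smul_right hy, smul_sub, RingHom.id_apply]

end IsHermitianOn

/-- The torsion as a linear map in its first argument. -/
noncomputable def torsionLin (G : (Fin n → ℂ) → Matrix (Fin n) (Fin n) ℂ)
    (y v : Fin n → ℂ) : (Fin n → ℂ) →ₗ[ℂ] (Fin n → ℂ) where
  toFun u := torsion G y u v
  map_add' u u' := torsion_add_left u u' v y
  map_smul' a u := torsion_smul_left a u v y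

theorem torsionLin_apply (u v : Fin n → ℂ) : torsionLin G y v u = torsion G y u v := rfl

theorem etaForm_apply (u : Fin n → ℂ) :
    etaForm G y u = ∑ k, torsion G y (Pi.single k 1) u k := by
  have h : ∀ k, torsion G y (Pi.single k 1) u =
      ∑ a, u a • torsion G y (Pi.single k 1) (Pi.single a 1) := by
    intro k
    rw [torsion_swap, ← torsionLin_apply]
    conv_lhs => rw [pi_eq_sum_univ' u, map_sum]
    rw [← Finset.sum_neg_distrib]
    refine Finset.sum_congr rfl fun a _ => ?_
    rw [map_smul, torsionLin_apply, ← smul_neg, ← torsion_swap]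
  simp only [h, etaForm, sum_apply, smul_apply, Finset.sum_apply, Pi.smul_apply, smul_eq_mul]
  rw [Finset.sum_comm]
  refine Finset.sum_congr rfl fun a _ => ?_
  rw [Finset.sum_mul]
  exact Finset.sum_congr rfl fun k _ => mul_comm _ _

theorem etaForm_smul (a : ℂ) (u : Fin n → ℂ) : etaForm G y (a • u) = a * etaForm G y u := by
  simp only [etaForm_apply, torsion_smul_right, Pi.smul_apply, smul_eq_mul, Finset.mul_sum]

theorem nablaBarEta_eq (w u : Fin n → ℂ) :
    nablaBarEta G w y u = wirtBar w (fun z => etaForm G z u) y := by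
  simp [nablaBarEta]

section Frame

variable {e : Fin n → Fin n → ℂ}

theorem IsUnitaryFrame.etaForm_eq (he : IsUnitaryFrame G y e) (u : Fin n → ℂ) :
    etaForm G y u = ∑ k, pair G y (torsion G y (e k) u) (e k) := by
  rw [etaForm_apply]
  exact he.trace_eq (torsionLin G y u)

theorem sum_sigmaC :
    ∑ i, sigmaC G y e i i = (normSqTorsion G y e : ℂ) := by
  simp only [sigmaC, normSqTorsion, Complex.ofReal_sum, Complex.ofReal_pow]
  refine Finset.sum_congr rfl fun i _ => Finset.sum_congr rfl fun r _ =>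
    Finset.sum_congr rfl fun s _ => ?_
  rw [Complex.star_def, Complex.mul_conj']

variable (hG : IsHermitianOn G U) (hy : y ∈ U)

include hG hy

theorem IsHermitianOn.nablaBarEta_eq_sum (w u : Fin n → ℂ) :
    nablaBarEta G w y u = ∑ k, nablaBarTorsion G w y (Pi.single k 1) u k := by
  have hd : ∀ k : Fin n, DifferentiableAt ℝ (fun z => torsion G z (Pi.single k 1) u) y :=
    fun k => hG.differentiableAt_of (hG.contDiffOn_torsion _ _) hy
  simp only [nablaBarEta_eq, etaForm_apply, nablaBarTorsion_eq]
  rw [wirtBar_sum _ _ fun k _ => differentiableAt_pi.1 (hd k) k]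
  exact Finset.sum_congr rfl fun k _ => (wirtBar_pi_apply w (hd k) k).symm

/-- In the coordinate frame, whose `∇̄` vanishes, the trace commutes with `∇̄`. The resulting trace
is independent of the frame, so the formula holds in a unitary frame given only at the point `y`. -/
theorem IsUnitaryFrame.nablaBarEta_eq_sum (he : IsUnitaryFrame G y e) (w u : Fin n → ℂ) :
    nablaBarEta G w y u = ∑ k, pair G y (nablaBarTorsion G w y (e k) u) (e k) := by
  rw [hG.nablaBarEta_eq_sum hy]
  exact he.trace_eq (hG.nablaBarTorsionLin hy w u)

theorem IsUnitaryFrame.sigmaC_eq (he : IsUnitaryFrame G y e) (i j : Fin n) :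
    sigmaC G y e i j = ∑ s, pair G y (torsion G y (e i) (e s)) (torsion G y (e j) (e s)) := by
  rw [sigmaC, Finset.sum_comm]
  exact Finset.sum_congr rfl fun s _ => (he.pair_eq_sum (hG.isHermitian hy) _ _).symm

theorem IsUnitaryFrame.star_sigmaC (he : IsUnitaryFrame G y e) (i j : Fin n) :
    star (sigmaC G y e i j) = sigmaC G y e j i := by
  rw [he.sigmaC_eq hG hy, he.sigmaC_eq hG hy, star_sum]
  exact Finset.sum_congr rfl fun s _ => star_pair (hG.isHermitian hy) _ _

variable (hpl : del (fun z => delbar (kahlerForm G) z) y = 0)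

include hpl

theorem IsUnitaryFrame.torsionD_sub (he : IsUnitaryFrame G y e) (i j k l : Fin n) :
    torsionD G y e i k j l - torsionD G y e i k l j =
      ∑ r, torsionC G y e i k r * star (torsionC G y e j l r) := by
  rw [torsionD, torsionD, hG.pair_nablaBarTorsion_sub hy hpl,
    he.pair_eq_sum (hG.isHermitian hy)]
  rfl

/-- Contract the commutation rule for `∇̄T` over `k = l = r`. The subtracted term `∑ᵣ T^r_{ir, j̄}`
is `-η_{i, j̄}` because `T` is skew. -/
theorem IsUnitaryFrame.xiC_add_etaD (he : IsUnitaryFrame G y e) (i j : Fin n) :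
    xiC G y e i j + etaD G y e i j = sigmaC G y e i j := by
  rw [etaD, he.nablaBarEta_eq_sum hG hy, xiC, he.sigmaC_eq hG hy, ← Finset.sum_add_distrib]
  refine Finset.sum_congr rfl fun r _ => ?_
  rw [← hG.pair_nablaBarTorsion_sub hy hpl, torsionD, hG.nablaBarTorsion_swap hy (e i) (e r) (e j),
    pair_neg_left]
  ring

/-- The traces of `ξ` and of `η_{i, j̄}` are the same double sum `∑ T^k_{ki, ī}` read in two orders,
so the trace of `ξ + ∇̄η = σ` is `2χ`. -/
theorem IsUnitaryFrame.two_mul_chi (he : IsUnitaryFrame G y e) :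
    2 * chi G y e = (normSqTorsion G y e : ℂ) := by
  rw [← sum_sigmaC]
  simp only [← he.xiC_add_etaD hG hy hpl, Finset.sum_add_distrib]
  have h : ∑ i, xiC G y e i i = chi G y e := by
    simp only [chi, xiC, etaD, he.nablaBarEta_eq_sum hG hy]
    rw [Finset.sum_comm]
    rfl
  rw [h, ← chi, two_mul]

variable (hH : ∀ X, X ≠ 0 → holSec G y X = c)

include hH

theorem IsUnitaryFrame.curvC_eq (he : IsUnitaryFrame G y e) (i j k l : Fin n) :
    curvC G y e i j k l =
      (c / 2 : ℂ) * ((if i = j then 1 else 0) * (if k = l then 1 else 0)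
          + (if i = l then 1 else 0) * (if k = j then 1 else 0))
        - (1 / 4 : ℂ) * ∑ r, torsionC G y e i k r * star (torsionC G y e j l r)
        - (1 / 2 : ℂ) * (torsionD G y e i k l j + star (torsionD G y e j l k i)) := by
  rw [curvC, hG.curvature_eq_of_pluriclosed hy hpl hH, he i j, he k l, he i l, he k j,
    he.pair_eq_sum (hG.isHermitian hy) (torsion G y _ _)]
  rfl

/-- Setting `k = l = r` turns both `∇̄T` terms into traces defining `∇̄η`, with a sign from
skewness. In all three contractions the `c`-term sums to `n + 1`: one delta product gives `n`, the
other gives one. -/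
theorem IsUnitaryFrame.ricci1_eq (he : IsUnitaryFrame G y e) (i j : Fin n) :
    ricci1 G y e i j = c / 2 * (n + 1) * (if i = j then 1 else 0) - 1 / 4 * sigmaC G y e i j
      + 1 / 2 * (etaD G y e i j + star (etaD G y e j i)) := by
  have h : ∀ r, curvC G y e i j r r = (c / 2 : ℂ) * ((if i = j then 1 else 0)
          + (if i = r then 1 else 0) * (if r = j then 1 else 0))
        - (1 / 4 : ℂ) * pair G y (torsion G y (e i) (e r)) (torsion G y (e j) (e r))
        + (1 / 2 : ℂ) * (pair G y (nablaBarTorsion G (e j) y (e r) (e i)) (e r)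
          + star (pair G y (nablaBarTorsion G (e i) y (e r) (e j)) (e r))) := by
    intro r
    rw [curvC, hG.curvature_eq_of_pluriclosed hy hpl hH, he i j, he r r, he i r, he r j,
      hG.nablaBarTorsion_swap hy (e i), hG.nablaBarTorsion_swap hy (e j), pair_neg_left,
      pair_neg_left, if_pos rfl, star_neg]
    ring
  simp only [ricci1, h, etaD, he.nablaBarEta_eq_sum hG hy, he.sigmaC_eq hG hy, star_sum,
    Finset.sum_add_distrib, Finset.sum_sub_distrib, ← Finset.mul_sum]
  rcases eq_or_ne i j with rfl | hij
  · simp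
  · simp [hij]

/-- This contraction produces `ξ` and its adjoint instead of `∇̄η`. Replacing `ξ` by `σ - ∇̄η`
twice, with weight `1/2`, changes the coefficient of `σ` from `-1/4` to `3/4`. -/
theorem IsUnitaryFrame.ricci2_eq (he : IsUnitaryFrame G y e) (i j : Fin n) :
    ricci2 G y e i j = c / 2 * (n + 1) * (if i = j then 1 else 0) + 3 / 4 * sigmaC G y e i j
      - 1 / 2 * (etaD G y e i j + star (etaD G y e j i)) := by
  have h : ∀ r, curvC G y e r r i j = (c / 2 : ℂ) * ((if i = j then 1 else 0)
          + (if i = r then 1 else 0) * (if r = j then 1 else 0))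
        - (1 / 4 : ℂ) * pair G y (torsion G y (e i) (e r)) (torsion G y (e j) (e r))
        + (1 / 2 : ℂ) * (torsionD G y e i r j r + star (torsionD G y e j r i r)) := by
    intro r
    rw [curvC, hG.curvature_eq_of_pluriclosed hy hpl hH, he i j, he r r, he i r, he r j,
      torsionD, torsionD,
      hG.nablaBarTorsion_swap hy (e i), hG.nablaBarTorsion_swap hy (e j), pair_neg_left,
      pair_neg_left, if_pos rfl, star_neg, torsion_swap (e r), torsion_swap (e r),
      pair_neg_left, pair_neg_right]
    ring
  have hx : ∀ i j, xiC G y e i j = sigmaC G y e i j - etaD G y e i j := fun i j =>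
    eq_sub_of_add_eq (he.xiC_add_etaD hG hy hpl i j)
  have h' : ricci2 G y e i j = c / 2 * (n + 1) * (if i = j then 1 else 0)
      - 1 / 4 * sigmaC G y e i j + 1 / 2 * (xiC G y e i j + star (xiC G y e j i)) := by
    simp only [ricci2, h, xiC, he.sigmaC_eq hG hy, star_sum,
      Finset.sum_add_distrib, Finset.sum_sub_distrib, ← Finset.mul_sum]
    rcases eq_or_ne i j with rfl | hij
    · simp
    · simp [hij]
  rw [h', hx, hx, star_sub, he.star_sigmaC hG hy]
  ring

/-- The mixed case: one `∇̄T` term traces to `∇̄η` and the other to the adjoint of `ξ`. The torsion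
product first appears with sign `+`, since only one of the two torsions is reversed; eliminating `ξ`
then brings `1/4` to `-1/4`. -/
theorem IsUnitaryFrame.ricci3_eq (he : IsUnitaryFrame G y e) (i j : Fin n) :
    ricci3 G y e i j = c / 2 * (n + 1) * (if i = j then 1 else 0) - 1 / 4 * sigmaC G y e i j
      + 1 / 2 * (star (etaD G y e j i) - etaD G y e i j) := by
  have h : ∀ r, curvC G y e r j i r = (c / 2 : ℂ) * ((if i = j then 1 else 0)
          + (if i = r then 1 else 0) * (if r = j then 1 else 0))
        + (1 / 4 : ℂ) * pair G y (torsion G y (e i) (e r)) (torsion G y (e j) (e r))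
        - (1 / 2 : ℂ) * (pair G y (nablaBarTorsion G (e j) y (e r) (e i)) (e r)
          + star (torsionD G y e j r i r)) := by
    intro r
    rw [curvC, hG.curvature_eq_of_pluriclosed hy hpl hH, he i j, he r r, he i r, he r j,
      torsionD, if_pos rfl, torsion_swap (e r), pair_neg_left]
    ring
  have hx : ∀ i j, xiC G y e i j = sigmaC G y e i j - etaD G y e i j := fun i j =>
    eq_sub_of_add_eq (he.xiC_add_etaD hG hy hpl i j)
  have h' : ricci3 G y e i j = c / 2 * (n + 1) * (if i = j then 1 else 0)
      + 1 / 4 * sigmaC G y e i j - 1 / 2 * (etaD G y e i j + star (xiC G y e j i)) := by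
    simp only [ricci3, h, xiC, he.sigmaC_eq hG hy, star_sum, etaD, he.nablaBarEta_eq_sum hG hy,
      Finset.sum_add_distrib, Finset.sum_sub_distrib, ← Finset.mul_sum]
    rcases eq_or_ne i j with rfl | hij
    · simp
    · simp [hij]
  rw [h', hx, star_sub, he.star_sigmaC hG hy]
  ring

end Frame

end Pointwise

/-! ### Forms of type `(1,1)` in a unitary frame -/

/-- `B` is linear in its first and conjugate-linear in its second argument. -/
structure IsSesquilinear {V : Type*} [AddCommGroup V] [Module ℂ V] (B : V → V → ℂ) : Prop where
  add_left : ∀ u u' v, B (u + u') v = B u v + B u' v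
  smul_left : ∀ (c : ℂ) u v, B (c • u) v = c * B u v
  add_right : ∀ u v v', B u (v + v') = B u v + B u v'
  smul_right : ∀ (c : ℂ) u v, B u (c • v) = star c * B u v

theorem IsSesquilinear.sum_smul_sum_smul {V ι : Type*} [AddCommGroup V] [Module ℂ V] [Fintype ι]
    {B : V → V → ℂ} (hB : IsSesquilinear B) (a b : ι → ℂ) (f : ι → V) :
    B (∑ i, a i • f i) (∑ j, b j • f j) = ∑ i, ∑ j, a i * star (b j) * B (f i) (f j) := by
  let L : V → V →ₗ[ℂ] ℂ := fun v =>
    { toFun := fun u => B u v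
      map_add' := fun u u' => hB.add_left u u' v
      map_smul' := fun c u => hB.smul_left c u v }
  let R : V → V →ₛₗ[starRingEnd ℂ] ℂ := fun u =>
    { toFun := fun v => B u v
      map_add' := fun v v' => hB.add_right u v v'
      map_smul' := fun c v => hB.smul_right c u v }
  refine (map_sum (L _) _ _).trans (Finset.sum_congr rfl fun i _ => ?_)
  refine (map_sum (R _) _ _).trans (Finset.sum_congr rfl fun j _ => ?_)
  change B (a i • f i) (b j • f j) = _
  rw [hB.smul_left, hB.smul_right]
  ring

section FrameForms

variable {n : ℕ} {G : (Fin n → ℂ) → Matrix (Fin n) (Fin n) ℂ} {U : Set (Fin n → ℂ)}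
  {y : Fin n → ℂ} {e : Fin n → Fin n → ℂ}

theorem ext_two_form {α β : (Fin n → ℂ) [⋀^Fin 2]→L[ℝ] ℂ} (h : ∀ u v, α ![u, v] = β ![u, v]) :
    α = β := by
  ext w
  have hw : w = ![w 0, w 1] := by ext i; fin_cases i <;> rfl
  rw [hw, h]

theorem coframe_apply (i : Fin n) (u : Fin n → ℂ) : coframe G y e i u = pair G y u (e i) := by
  conv_rhs => rw [pi_eq_sum_univ' u, pair_sum_left]
  simp only [coframe, sum_apply, smul_apply, smul_eq_mul, dz, ContinuousLinearMap.proj_apply,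
    pair_smul_left]
  exact Finset.sum_congr rfl fun a _ => mul_comm _ _

theorem conjForm_apply (α : (Fin n → ℂ) →L[ℝ] ℂ) (u : Fin n → ℂ) :
    conjForm α u = star (α u) := rfl

theorem formOf_apply (a : Fin n → Fin n → ℂ) (u v : Fin n → ℂ) :
    formOf G y e a ![u, v] = Complex.I * ∑ i, ∑ j, a i j *
      (pair G y u (e i) * star (pair G y v (e j)) - pair G y v (e i) * star (pair G y u (e j))) := by
  simp only [formOf, ContinuousAlternatingMap.smul_apply, ContinuousAlternatingMap.sum_apply,
    wedge_apply, coframe_apply, conjForm_apply, smul_eq_mul]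

theorem formOf_add (a b : Fin n → Fin n → ℂ) :
    formOf G y e (fun i j => a i j + b i j) = formOf G y e a + formOf G y e b := by
  refine ext_two_form fun u v => ?_
  simp only [ContinuousAlternatingMap.add_apply, formOf_apply, add_mul, Finset.sum_add_distrib,
    mul_add]

theorem formOf_sub (a b : Fin n → Fin n → ℂ) :
    formOf G y e (fun i j => a i j - b i j) = formOf G y e a - formOf G y e b := by
  refine ext_two_form fun u v => ?_
  simp only [ContinuousAlternatingMap.sub_apply, formOf_apply, sub_mul, Finset.sum_sub_distrib,
    mul_sub]
  ring

theorem formOf_smul (t : ℂ) (a : Fin n → Fin n → ℂ) :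
    formOf G y e (fun i j => t * a i j) = t • formOf G y e a := by
  simp only [formOf, mul_smul, ← Finset.smul_sum, smul_comm Complex.I t]

theorem isSesquilinear_pair : IsSesquilinear (pair G y) :=
  ⟨pair_add_left, pair_smul_left, pair_add_right, pair_smul_right⟩

/-- Both arguments are expanded in the frame. This reduces an identity between `(1,1)`-forms to one
between their frame components. -/
theorem IsUnitaryFrame.sesquilinear_eq (he : IsUnitaryFrame G y e)
    {B : (Fin n → ℂ) → (Fin n → ℂ) → ℂ} (hB : IsSesquilinear B) (u v : Fin n → ℂ) :
    B u v = ∑ i, ∑ j, pair G y u (e i) * star (pair G y v (e j)) * B (e i) (e j) := by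
  rw [← hB.sum_smul_sum_smul, he.sum_smul, he.sum_smul]

theorem IsUnitaryFrame.kahlerForm_eq (he : IsUnitaryFrame G y e) :
    kahlerForm G y = formOf G y e (fun i j => if i = j then 1 else 0) := by
  refine ext_two_form fun u v => ?_
  have h := he.sesquilinear_eq (isSesquilinear_pair (G := G) (y := y))
  rw [kahlerForm_apply, formOf_apply, h u v, h v u]
  simp only [← Finset.sum_sub_distrib]
  congr 1
  refine Finset.sum_congr rfl fun i _ => Finset.sum_congr rfl fun j _ => ?_
  rw [he i j]
  ring

theorem oneForm_apply (α : (Fin n → ℂ) →L[ℝ] ℂ) (v : Fin 1 → Fin n → ℂ) :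
    oneForm α v = α (v 0) := rfl

theorem oneForm_etaForm_comp_cplxJ :
    (oneForm (etaForm G y)).compContinuousLinearMap (cplxJ n) =
      Complex.I • oneForm (etaForm G y) := by
  ext v
  exact etaForm_smul Complex.I (v 0)

theorem oneForm_conjForm_etaForm_comp_cplxJ :
    (oneForm (conjForm (etaForm G y))).compContinuousLinearMap (cplxJ n) =
      (-Complex.I) • oneForm (conjForm (etaForm G y)) := by
  ext v
  change star (etaForm G y (Complex.I • v 0)) = -Complex.I * star (etaForm G y (v 0))
  rw [etaForm_smul, star_mul', Complex.star_def, Complex.conj_I]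

variable (hG : IsHermitianOn G U)

include hG

theorem IsHermitianOn.contDiffOn_etaForm_apply (u : Fin n → ℂ) :
    ContDiffOn ℝ ∞ (fun z => etaForm G z u) U := by
  simp only [etaForm_apply]
  exact ContDiffOn.sum fun k _ => contDiffOn_pi.1 (hG.contDiffOn_torsion _ _) k

theorem IsHermitianOn.contDiffOn_oneForm_etaForm :
    ContDiffOn ℝ ∞ (fun z => oneForm (etaForm G z)) U := by
  have h : (fun z => oneForm (etaForm G z)) =
      fun z => ∑ a, etaForm G z (Pi.single a 1) • oneForm (dz a) := by
    funext z
    ext v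
    rw [oneForm_apply, ContinuousAlternatingMap.sum_apply]
    conv_lhs => rw [pi_eq_sum_univ' (v 0), map_sum]
    refine Finset.sum_congr rfl fun a _ => ?_
    rw [etaForm_smul, ContinuousAlternatingMap.smul_apply, smul_eq_mul, mul_comm]
    rfl
  rw [h]
  exact ContDiffOn.sum fun a _ => (hG.contDiffOn_etaForm_apply _).smul contDiffOn_const

theorem IsHermitianOn.contDiffOn_oneForm_conjForm_etaForm :
    ContDiffOn ℝ ∞ (fun z => oneForm (conjForm (etaForm G z))) U := by
  have h : (fun z => oneForm (conjForm (etaForm G z))) =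
      fun z => ∑ a, star (etaForm G z (Pi.single a 1)) • oneForm (conjForm (dz a)) := by
    funext z
    ext v
    rw [oneForm_apply, ContinuousAlternatingMap.sum_apply, conjForm_apply]
    conv_lhs => rw [pi_eq_sum_univ' (v 0), map_sum, star_sum]
    refine Finset.sum_congr rfl fun a _ => ?_
    rw [etaForm_smul, ContinuousAlternatingMap.smul_apply, smul_eq_mul, mul_comm, star_mul']
    rfl
  rw [h]
  exact ContDiffOn.sum fun a _ =>
    (Complex.conjCLE.contDiff.comp_contDiffOn (hG.contDiffOn_etaForm_apply _)).smul
      contDiffOn_const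

variable (hy : y ∈ U)

include hy

theorem IsHermitianOn.delbarEta_apply (u v : Fin n → ℂ) :
    delbarEta G y ![u, v] = nablaBarEta G u y v - nablaBarEta G v y u := by
  rw [delbarEta, delbar_apply (hG.differentiableAt_of hG.contDiffOn_oneForm_etaForm hy)
    (Filter.Eventually.of_forall fun z => oneForm_etaForm_comp_cplxJ), Fin.sum_univ_two]
  simp [oneForm_apply, nablaBarEta_eq, Fin.removeNth, sub_eq_add_neg]

theorem IsHermitianOn.delEtaBar_apply (u v : Fin n → ℂ) :
    delEtaBar G y ![u, v] = star (nablaBarEta G u y v) - star (nablaBarEta G v y u) := by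
  have h : ∀ w, DifferentiableAt ℝ (fun z => etaForm G z w) y := fun w =>
    hG.differentiableAt_of (hG.contDiffOn_etaForm_apply w) hy
  rw [delEtaBar, del_apply (hG.differentiableAt_of hG.contDiffOn_oneForm_conjForm_etaForm hy)
    (Filter.Eventually.of_forall fun z => oneForm_conjForm_etaForm_comp_cplxJ), Fin.sum_univ_two]
  simp only [oneForm_apply, conjForm_apply, wirt_star _ (h _), nablaBarEta_eq]
  simp [Fin.removeNth, sub_eq_add_neg]

theorem IsHermitianOn.isSesquilinear_nablaBarEta :
    IsSesquilinear (fun u w => nablaBarEta G w y u) := by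
  refine ⟨?_, ?_, ?_, ?_⟩
  · intro u u' w
    simp only [nablaBarEta_eq, map_add]
    exact wirtBar_add w (hG.differentiableAt_of (hG.contDiffOn_etaForm_apply u) hy)
      (hG.differentiableAt_of (hG.contDiffOn_etaForm_apply u') hy)
  · intro c u w
    simp only [nablaBarEta_eq, etaForm_smul]
    exact wirtBar_clm_comp w (c • ContinuousLinearMap.id ℂ ℂ)
      (hG.differentiableAt_of (hG.contDiffOn_etaForm_apply u) hy)
  · intro u w w'
    simp only [nablaBarEta_eq, wirtBar_add_left]
  · intro c u w
    simp only [nablaBarEta_eq, wirtBar_smul_left, smul_eq_mul]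

theorem IsUnitaryFrame.nablaBarEta_expand (he : IsUnitaryFrame G y e) (w u : Fin n → ℂ) :
    nablaBarEta G w y u =
      ∑ i, ∑ j, pair G y u (e i) * star (pair G y w (e j)) * etaD G y e i j :=
  he.sesquilinear_eq (hG.isSesquilinear_nablaBarEta hy) u w

/-- The sign comes from reordering: `∂̄η = ∑ η_{i, j̄} φ̄ⱼ ∧ φᵢ`. For `∂η̄` below the factors
already stand in the right order. -/
theorem IsUnitaryFrame.I_smul_delbarEta (he : IsUnitaryFrame G y e) :
    Complex.I • delbarEta G y = formOf G y e (fun i j => -etaD G y e i j) := by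
  refine ext_two_form fun u v => ?_
  rw [ContinuousAlternatingMap.smul_apply, hG.delbarEta_apply hy, formOf_apply,
    he.nablaBarEta_expand hG hy, he.nablaBarEta_expand hG hy, smul_eq_mul]
  simp only [← Finset.sum_sub_distrib]
  congr 1
  exact Finset.sum_congr rfl fun i _ => Finset.sum_congr rfl fun j _ => by ring

theorem IsUnitaryFrame.I_smul_delEtaBar (he : IsUnitaryFrame G y e) :
    Complex.I • delEtaBar G y = formOf G y e (fun i j => star (etaD G y e j i)) := by
  refine ext_two_form fun u v => ?_
  rw [ContinuousAlternatingMap.smul_apply, hG.delEtaBar_apply hy, formOf_apply,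
    he.nablaBarEta_expand hG hy, he.nablaBarEta_expand hG hy, smul_eq_mul]
  simp only [star_sum, star_mul', star_star]
  rw [Finset.sum_comm, Finset.sum_comm (f := fun i j => star (pair G y u (e i)) * _ * _)]
  simp only [← Finset.sum_sub_distrib]
  congr 1
  exact Finset.sum_congr rfl fun i _ => Finset.sum_congr rfl fun j _ => by ring

variable {c : ℂ} (hpl : del (fun z => delbar (kahlerForm G) z) y = 0)

include hpl

theorem IsUnitaryFrame.formOf_xiC (he : IsUnitaryFrame G y e) :
    formOf G y e (xiC G y e) =
      Complex.I • delbarEta G y + formOf G y e (sigmaC G y e) := by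
  rw [he.I_smul_delbarEta hG hy, ← formOf_add]
  congr 1
  funext i j
  rw [← he.xiC_add_etaD hG hy hpl]
  ring

variable (hH : ∀ X, X ≠ 0 → holSec G y X = c)

include hH

theorem IsUnitaryFrame.formOf_ricci1 (he : IsUnitaryFrame G y e) :
    formOf G y e (ricci1 G y e) =
      (c / 2 * (n + 1) : ℂ) • kahlerForm G y - (1 / 4 : ℂ) • formOf G y e (sigmaC G y e)
        + (Complex.I / 2) • (delEtaBar G y - delbarEta G y) := by
  have h : (Complex.I / 2) • (delEtaBar G y - delbarEta G y) =
      (1 / 2 : ℂ) • (Complex.I • delEtaBar G y) + (-1 / 2 : ℂ) • (Complex.I • delbarEta G y) := by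
    module
  rw [h, he.I_smul_delbarEta hG hy, he.I_smul_delEtaBar hG hy, he.kahlerForm_eq]
  simp only [← formOf_smul, ← formOf_add, ← formOf_sub]
  congr 1
  funext i j
  rw [he.ricci1_eq hG hy hpl hH]
  ring

theorem IsUnitaryFrame.formOf_ricci2 (he : IsUnitaryFrame G y e) :
    formOf G y e (ricci2 G y e) =
      (c / 2 * (n + 1) : ℂ) • kahlerForm G y + (3 / 4 : ℂ) • formOf G y e (sigmaC G y e)
        - (Complex.I / 2) • (delEtaBar G y - delbarEta G y) := by
  have h : (Complex.I / 2) • (delEtaBar G y - delbarEta G y) =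
      (1 / 2 : ℂ) • (Complex.I • delEtaBar G y) + (-1 / 2 : ℂ) • (Complex.I • delbarEta G y) := by
    module
  rw [h, he.I_smul_delbarEta hG hy, he.I_smul_delEtaBar hG hy, he.kahlerForm_eq]
  simp only [← formOf_smul, ← formOf_add, ← formOf_sub]
  congr 1
  funext i j
  rw [he.ricci2_eq hG hy hpl hH]
  ring

theorem IsUnitaryFrame.formOf_ricci3 (he : IsUnitaryFrame G y e) :
    formOf G y e (ricci3 G y e) =
      (c / 2 * (n + 1) : ℂ) • kahlerForm G y - (1 / 4 : ℂ) • formOf G y e (sigmaC G y e)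
        + (Complex.I / 2) • (delEtaBar G y + delbarEta G y) := by
  have h : (Complex.I / 2) • (delEtaBar G y + delbarEta G y) =
      (1 / 2 : ℂ) • (Complex.I • delEtaBar G y) + (1 / 2 : ℂ) • (Complex.I • delbarEta G y) := by
    module
  rw [h, he.I_smul_delbarEta hG hy, he.I_smul_delEtaBar hG hy, he.kahlerForm_eq]
  simp only [← formOf_smul, ← formOf_add, ← formOf_sub]
  congr 1
  funext i j
  rw [he.ricci3_eq hG hy hpl hH]
  ring

end FrameForms

/-! ### Traces with respect to a Hermitian metric -/

section Trace

variable {n : ℕ} {G : (Fin n → ℂ) → Matrix (Fin n) (Fin n) ℂ} {U : Set (Fin n → ℂ)}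
  {y : Fin n → ℂ} {e : Fin n → Fin n → ℂ}

/-- The trace `∑ g^{a b̄} B(∂_a, ∂_b)` of a sesquilinear form. -/
noncomputable def hermTrace (G : (Fin n → ℂ) → Matrix (Fin n) (Fin n) ℂ) (y : Fin n → ℂ)
    (B : (Fin n → ℂ) → (Fin n → ℂ) → ℂ) : ℂ :=
  ∑ a, ∑ b, (G y)⁻¹ b a * B (Pi.single a 1) (Pi.single b 1)

theorem IsUnitaryFrame.inv_eq (he : IsUnitaryFrame G y e) :
    (G y)⁻¹ = (Matrix.of e).conjTranspose * Matrix.of e := by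
  have h := he.matrix_eq
  rw [Matrix.mul_assoc, mul_eq_one_comm, Matrix.mul_assoc] at h
  exact Matrix.inv_eq_right_inv h

/-- With `E` the matrix of the frame, `G⁻¹ = Eᴴ E`. Sums over a unitary frame thereby become
coordinate expressions in which no frame is chosen, and these can be differentiated in `y`. -/
theorem IsUnitaryFrame.hermTrace_eq (he : IsUnitaryFrame G y e)
    {B : (Fin n → ℂ) → (Fin n → ℂ) → ℂ} (hB : IsSesquilinear B) :
    hermTrace G y B = ∑ i, B (e i) (e i) := by
  have h : ∀ i, B (e i) (e i) =
      ∑ a, ∑ b, e i a * star (e i b) * B (Pi.single a 1) (Pi.single b 1) := by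
    intro i
    rw [← hB.sum_smul_sum_smul, ← pi_eq_sum_univ' (e i)]
  simp only [h]
  rw [hermTrace, Finset.sum_comm' (t' := Finset.univ) (s' := fun _ => Finset.univ) (by simp)]
  conv_rhs => rw [Finset.sum_comm]
  rw [Finset.sum_comm]
  refine Finset.sum_congr rfl fun a _ => ?_
  conv_rhs => rw [Finset.sum_comm]
  refine Finset.sum_congr rfl fun b _ => ?_
  rw [he.inv_eq, Matrix.mul_apply, Finset.sum_mul]
  refine Finset.sum_congr rfl fun i _ => ?_
  simp only [Matrix.conjTranspose_apply, Matrix.of_apply]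
  ring

/-- `|η|²` in coordinates. -/
noncomputable def etaSq (G : (Fin n → ℂ) → Matrix (Fin n) (Fin n) ℂ) (y : Fin n → ℂ) : ℂ :=
  hermTrace G y fun u v => etaForm G y u * star (etaForm G y v)

/-- `|T|²` in coordinates. -/
noncomputable def torsionSq (G : (Fin n → ℂ) → Matrix (Fin n) (Fin n) ℂ) (y : Fin n → ℂ) : ℂ :=
  hermTrace G y fun u v => hermTrace G y fun s t =>
    pair G y (torsion G y u s) (torsion G y v t)

/-- `χ` in coordinates. -/
noncomputable def chiCoord (G : (Fin n → ℂ) → Matrix (Fin n) (Fin n) ℂ) (y : Fin n → ℂ) : ℂ :=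
  hermTrace G y fun u v => nablaBarEta G v y u

/-- The pairing `⟨η, ∂f̄⟩` in coordinates. -/
noncomputable def gradPair (G : (Fin n → ℂ) → Matrix (Fin n) (Fin n) ℂ) (f : (Fin n → ℂ) → ℂ)
    (y : Fin n → ℂ) : ℂ :=
  hermTrace G y fun u v => etaForm G y u * wirtBar v f y

theorem isSesquilinear_etaForm_mul_star :
    IsSesquilinear (fun u v => etaForm G y u * star (etaForm G y v)) where
  add_left u u' v := by rw [map_add, add_mul]
  smul_left c u v := by rw [etaForm_smul, mul_assoc]
  add_right u v v' := by rw [map_add, star_add, mul_add]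
  smul_right c u v := by rw [etaForm_smul, star_mul']; ring

theorem isSesquilinear_gradPair (f : (Fin n → ℂ) → ℂ) :
    IsSesquilinear (fun u v => etaForm G y u * wirtBar v f y) where
  add_left u u' v := by rw [map_add, add_mul]
  smul_left c u v := by rw [etaForm_smul, mul_assoc]
  add_right u v v' := by rw [wirtBar_add_left, mul_add]
  smul_right c u v := by rw [wirtBar_smul_left, smul_eq_mul]; ring

theorem isSesquilinear_torsion (u v : Fin n → ℂ) :
    IsSesquilinear (fun s t => pair G y (torsion G y u s) (torsion G y v t)) where
  add_left s s' t := by rw [torsion_add_right, pair_add_left]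
  smul_left c s t := by rw [torsion_smul_right, pair_smul_left]
  add_right s t t' := by rw [torsion_add_right, pair_add_right]
  smul_right c s t := by rw [torsion_smul_right, pair_smul_right]

theorem isSesquilinear_hermTrace_torsion :
    IsSesquilinear (fun u v => hermTrace G y fun s t =>
      pair G y (torsion G y u s) (torsion G y v t)) where
  add_left u u' v := by
    simp only [hermTrace, torsion_add_left, pair_add_left, mul_add, Finset.sum_add_distrib]
  smul_left c u v := by
    simp only [hermTrace, torsion_smul_left, pair_smul_left, Finset.mul_sum, mul_left_comm]
  add_right u v v' := by
    simp only [hermTrace, torsion_add_left, pair_add_right, mul_add, Finset.sum_add_distrib]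
  smul_right c u v := by
    simp only [hermTrace, torsion_smul_left, pair_smul_right, Finset.mul_sum, mul_left_comm]

theorem IsUnitaryFrame.etaSq_eq (he : IsUnitaryFrame G y e) :
    etaSq G y = (normSqEta G y e : ℂ) := by
  rw [etaSq, he.hermTrace_eq isSesquilinear_etaForm_mul_star, normSqEta]
  push_cast
  refine Finset.sum_congr rfl fun i _ => ?_
  rw [Complex.star_def, Complex.mul_conj', etaC]

theorem IsUnitaryFrame.gradPair_eq (he : IsUnitaryFrame G y e) (f : (Fin n → ℂ) → ℂ) :
    gradPair G f y = ∑ i, etaForm G y (e i) * wirtBar (e i) f y :=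
  he.hermTrace_eq (isSesquilinear_gradPair f)

theorem IsUnitaryFrame.torsionSq_eq (hG : IsHermitianOn G U) (hy : y ∈ U)
    (he : IsUnitaryFrame G y e) : torsionSq G y = (normSqTorsion G y e : ℂ) := by
  rw [torsionSq, he.hermTrace_eq isSesquilinear_hermTrace_torsion, ← sum_sigmaC]
  refine Finset.sum_congr rfl fun i _ => ?_
  rw [he.hermTrace_eq (isSesquilinear_torsion _ _), he.sigmaC_eq hG hy]

theorem IsUnitaryFrame.chiCoord_eq (hG : IsHermitianOn G U) (hy : y ∈ U)
    (he : IsUnitaryFrame G y e) : chiCoord G y = chi G y e :=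
  he.hermTrace_eq (hG.isSesquilinear_nablaBarEta hy)

namespace IsHermitianOn

variable (hG : IsHermitianOn G U)

include hG

theorem contDiffOn_pair_of {X Y : (Fin n → ℂ) → Fin n → ℂ} (hX : ContDiffOn ℝ ∞ X U)
    (hY : ContDiffOn ℝ ∞ Y U) : ContDiffOn ℝ ∞ (fun z => pair G z (X z) (Y z)) U :=
  ContDiffOn.sum fun i _ => ContDiffOn.sum fun j _ =>
    ((hG.contDiffOn i j).mul (contDiffOn_pi.1 hX i)).mul
      (Complex.conjCLE.contDiff.comp_contDiffOn (contDiffOn_pi.1 hY j))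

theorem contDiffOn_hermTrace {B : (Fin n → ℂ) → (Fin n → ℂ) → (Fin n → ℂ) → ℂ}
    (hB : ∀ u v, ContDiffOn ℝ ∞ (fun z => B z u v) U) :
    ContDiffOn ℝ ∞ (fun z => hermTrace G z (B z)) U :=
  ContDiffOn.sum fun _ _ => ContDiffOn.sum fun _ _ => (hG.contDiffOn_inv _ _).mul (hB _ _)

theorem contDiffOn_etaSq : ContDiffOn ℝ ∞ (etaSq G) U :=
  hG.contDiffOn_hermTrace fun u v => (hG.contDiffOn_etaForm_apply u).mul
    (Complex.conjCLE.contDiff.comp_contDiffOn (hG.contDiffOn_etaForm_apply v))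

theorem contDiffOn_torsionSq : ContDiffOn ℝ ∞ (torsionSq G) U :=
  hG.contDiffOn_hermTrace fun u v => hG.contDiffOn_hermTrace fun s t =>
    hG.contDiffOn_pair_of (hG.contDiffOn_torsion u s) (hG.contDiffOn_torsion v t)

theorem contDiffOn_gradPair {f : (Fin n → ℂ) → ℂ} (hf : ContDiffOn ℝ ∞ f U) :
    ContDiffOn ℝ ∞ (gradPair G f) U :=
  hG.contDiffOn_hermTrace fun u v => (hG.contDiffOn_etaForm_apply u).mul
    (ContDiffOn.wirtBar hG.isOpen hf v)

end IsHermitianOn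

end Trace

/-! ### The divergence of the dual of the torsion form -/

section Divergence

variable {n : ℕ} {G : (Fin n → ℂ) → Matrix (Fin n) (Fin n) ℂ} {U : Set (Fin n → ℂ)}
  {y : Fin n → ℂ}

theorem wirtBar_prod {ι : Type*} [DecidableEq ι] (s : Finset ι) (u : Fin n → ℂ)
    {f : ι → (Fin n → ℂ) → ℂ} (hf : ∀ i ∈ s, DifferentiableAt ℝ (f i) y) :
    wirtBar u (fun z => ∏ i ∈ s, f i z) y =
      ∑ i ∈ s, (∏ j ∈ s.erase i, f j y) * wirtBar u (f i) y := by
  have h := HasFDerivAt.finsetProd fun i hi => (hf i hi).hasFDerivAt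
  rw [wirtBar, h.fderiv]
  simp only [sum_apply, smul_apply, smul_eq_mul, wirtBar, Finset.mul_sum,
    ← Finset.sum_add_distrib]
  exact Finset.sum_congr rfl fun i _ => by ring

/-- Jacobi's formula for `∂̄`. -/
theorem wirtBar_det (hd : ∀ i j, DifferentiableAt ℝ (fun z => G z i j) y) (u : Fin n → ℂ) :
    wirtBar u (fun z => (G z).det) y =
      ∑ i, ∑ j, (G y).adjugate i j * wirtBar u (fun z => G z j i) y := by
  have h1 : ∀ σ : Equiv.Perm (Fin n),
      DifferentiableAt ℝ (fun z => ∏ i, G z (σ i) i) y := fun σ =>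
    (HasFDerivAt.finsetProd fun i _ => (hd (σ i) i).hasFDerivAt).differentiableAt
  -- By Cramer's rule the inner sum is the determinant with column `i` replaced by its derivative;
  -- expanding by permutations then reproduces the product rule.
  have h2 : ∀ i, ∑ j, (G y).adjugate i j * wirtBar u (fun z => G z j i) y =
      ((G y).updateCol i fun j => wirtBar u (fun z => G z j i) y).det := by
    intro i
    rw [← Matrix.cramer_apply, Matrix.cramer_eq_adjugate_mulVec]
    rfl
  simp only [h2, Matrix.det_apply']
  rw [wirtBar_sum _ _ fun σ _ => (h1 σ).const_mul _, Finset.sum_comm]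
  refine Finset.sum_congr rfl fun σ _ => ?_
  rw [wirtBar_mul u (differentiableAt_const _) (h1 σ), wirtBar_const, zero_mul, zero_add,
    wirtBar_prod _ _ fun i _ => hd _ _, Finset.mul_sum]
  refine Finset.sum_congr rfl fun i _ => ?_
  congr 1
  rw [← Finset.prod_erase_mul _ _ (Finset.mem_univ i), Matrix.updateCol_self]
  congr 1
  refine Finset.prod_congr rfl fun k hk => ?_
  rw [Matrix.updateCol_ne (Finset.ne_of_mem_erase hk)]

/-- Differentiate `G⁻¹ G = 1`, which holds near `y`. -/
theorem wirtBar_inv (hG : IsHermitianOn G U) (hy : y ∈ U) (u : Fin n → ℂ) (i j : Fin n) :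
    wirtBar u (fun z => (G z)⁻¹ i j) y =
      -∑ k, ∑ l, (G y)⁻¹ i k * wirtBar u (fun z => G z k l) y * (G y)⁻¹ l j := by
  have hd := hG.differentiableAt_entry hy
  have hi : ∀ i j, DifferentiableAt ℝ (fun z => (G z)⁻¹ i j) y := fun i j =>
    hG.differentiableAt_of (hG.contDiffOn_inv i j) hy
  set D : Matrix (Fin n) (Fin n) ℂ := Matrix.of fun k l => wirtBar u (fun z => G z k l) y
  set D' : Matrix (Fin n) (Fin n) ℂ := Matrix.of fun k l => wirtBar u (fun z => (G z)⁻¹ k l) y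
  have h : D' * G y + (G y)⁻¹ * D = 0 := by
    ext k l
    have h0 : (fun z => ∑ m, (G z)⁻¹ k m * G z m l) =ᶠ[nhds y]
        fun _ => (1 : Matrix (Fin n) (Fin n) ℂ) k l := by
      filter_upwards [hG.isOpen.mem_nhds hy] with z hz
      rw [← Matrix.nonsing_inv_mul (G z) (hG.isUnit_det hz), Matrix.mul_apply]
    have h1 := wirtBar_congr (u := u) h0
    rw [wirtBar_const, wirtBar_sum _ _ fun m _ => (hi k m).fun_mul (hd m l)] at h1
    rw [Matrix.add_apply, Matrix.mul_apply, Matrix.mul_apply, ← Finset.sum_add_distrib,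
      Matrix.zero_apply, ← h1]
    exact Finset.sum_congr rfl fun m _ => (wirtBar_mul u (hi k m) (hd m l)).symm
  have h2 : D' = -((G y)⁻¹ * D * (G y)⁻¹) := by
    rw [← Matrix.neg_mul, ← eq_neg_of_add_eq_zero_left h, Matrix.mul_assoc,
      Matrix.mul_nonsing_inv _ (hG.isUnit_det hy), Matrix.mul_one]
  have h3 := congrFun (congrFun h2 i) j
  rw [Matrix.neg_apply, Matrix.mul_apply] at h3
  refine h3.trans ?_
  rw [Finset.sum_comm]
  congr 1
  refine Finset.sum_congr rfl fun l _ => ?_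
  rw [Matrix.mul_apply, Finset.sum_mul]
  rfl

/-- Conjugation turns the `∂g` in the torsion into `∂̄g`, the kind of derivative that arises when
`∂̄` falls on `det G` and on `G⁻¹`. -/
theorem star_etaForm_single (hG : IsHermitianOn G U) (hy : y ∈ U) (b : Fin n) :
    star (etaForm G y (Pi.single b 1)) = ∑ k, ∑ l, (G y)⁻¹ k l *
      (wirtBar (Pi.single k 1) (fun z => G z l b) y
        - wirtBar (Pi.single b 1) (fun z => G z l k) y) := by
  have hd := hG.differentiableAt_entry hy
  have hs : ∀ u i j, star (wirt u (fun z => G z i j) y) = wirtBar u (fun z => G z j i) y := by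
    intro u i j
    rw [← wirtBar_star u (hd i j)]
    refine wirtBar_congr ?_
    filter_upwards [hG.isOpen.mem_nhds hy] with z hz
    exact (hG.isHermitian hz).apply j i
  have hinv : ∀ l k, star ((G y)⁻¹ l k) = (G y)⁻¹ k l := fun l k =>
    (hG.isHermitian hy).inv.apply k l
  rw [etaForm_apply, star_sum]
  refine Finset.sum_congr rfl fun k _ => ?_
  simp only [torsion, nabla, wirt_const, zero_add, Pi.sub_apply, Matrix.single_one_vecMul,
    chernMatrix, Matrix.row_apply, Matrix.mul_apply, Matrix.of_apply, ← Finset.sum_sub_distrib,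
    star_sum]
  refine Finset.sum_congr rfl fun l _ => ?_
  rw [← sub_mul, star_mul', star_sub, hs, hs, hinv, mul_comm]

/-- The coordinates of the vector field dual to `η`, times `det G`. -/
noncomputable def etaField (G : (Fin n → ℂ) → Matrix (Fin n) (Fin n) ℂ) (b : Fin n)
    (y : Fin n → ℂ) : ℂ :=
  (G y).det * ∑ a, (G y)⁻¹ b a * etaForm G y (Pi.single a 1)

/-- The product rule gives three contributions. The derivative of `η` gives `χ`; Jacobi's formula
for `det G` and the derivative of `G⁻¹` give the two halves of `-|η|²`, which is where the torsion
of the metric enters. -/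
theorem sum_wirtBar_etaField (hG : IsHermitianOn G U) (hy : y ∈ U) :
    ∑ b, wirtBar (Pi.single b 1) (etaField G b) y =
      (G y).det * (chiCoord G y - etaSq G y) := by
  have hd := hG.differentiableAt_entry hy
  have hdet := hG.differentiableAt_of hG.contDiffOn_det hy
  have hi : ∀ i j, DifferentiableAt ℝ (fun z => (G z)⁻¹ i j) y := fun i j =>
    hG.differentiableAt_of (hG.contDiffOn_inv i j) hy
  have hη : ∀ a : Fin n, DifferentiableAt ℝ (fun z => etaForm G z (Pi.single a 1)) y := fun a =>
    hG.differentiableAt_of (hG.contDiffOn_etaForm_apply _) hy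
  have hadj : ∀ i j, (G y).adjugate i j = (G y).det * (G y)⁻¹ i j := by
    intro i j
    rw [Matrix.inv_def, Matrix.smul_apply, smul_eq_mul, ← mul_assoc,
      Ring.mul_inverse_cancel _ (hG.isUnit_det hy), one_mul]
  have h1 : ∀ b, wirtBar (Pi.single b 1) (etaField G b) y =
      (G y).det * (∑ a, ∑ k, ∑ l, (G y)⁻¹ b a * etaForm G y (Pi.single a 1) *
          ((G y)⁻¹ k l * wirtBar (Pi.single b 1) (fun z => G z l k) y)
        - ∑ a, ∑ k, ∑ l, (G y)⁻¹ b k * wirtBar (Pi.single b 1) (fun z => G z k l) y *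
          (G y)⁻¹ l a * etaForm G y (Pi.single a 1)
        + ∑ a, (G y)⁻¹ b a * nablaBarEta G (Pi.single b 1) y (Pi.single a 1)) := by
    intro b
    have hs : DifferentiableAt ℝ
        (fun z => ∑ a, (G z)⁻¹ b a * etaForm G z (Pi.single a 1)) y :=
      DifferentiableAt.fun_sum fun a _ => (hi b a).fun_mul (hη a)
    have e1 : wirtBar (Pi.single b 1) (etaField G b) y =
        wirtBar (Pi.single b 1) (fun z => (G z).det) y *
          ∑ a, (G y)⁻¹ b a * etaForm G y (Pi.single a 1) + (G y).det *
          wirtBar (Pi.single b 1)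
            (fun z => ∑ a, (G z)⁻¹ b a * etaForm G z (Pi.single a 1)) y :=
      wirtBar_mul _ hdet hs
    have e2 : ∀ a, wirtBar (Pi.single b 1)
        (fun z => (G z)⁻¹ b a * etaForm G z (Pi.single a 1)) y =
        -∑ k, ∑ l, (G y)⁻¹ b k * wirtBar (Pi.single b 1) (fun z => G z k l) y * (G y)⁻¹ l a
            * etaForm G y (Pi.single a 1)
          + (G y)⁻¹ b a * nablaBarEta G (Pi.single b 1) y (Pi.single a 1) := by
      intro a
      rw [wirtBar_mul _ (hi b a) (hη a), wirtBar_inv hG hy, nablaBarEta_eq, neg_mul]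
      simp only [Finset.sum_mul]
    rw [e1, wirtBar_det hd, wirtBar_sum _ _ fun a _ => (hi b a).fun_mul (hη a)]
    simp only [e2, hadj, Finset.sum_add_distrib, Finset.sum_neg_distrib]
    rw [mul_add, mul_add, mul_sub, mul_neg, ← add_assoc, sub_eq_add_neg]
    congr 2
    simp only [Finset.mul_sum, Finset.sum_mul]
    exact Finset.sum_congr rfl fun a _ => Finset.sum_congr rfl fun k _ =>
      Finset.sum_congr rfl fun l _ => by ring
  have h2 : etaSq G y =
      ∑ b, ∑ a, ∑ k, ∑ l, (G y)⁻¹ b a * etaForm G y (Pi.single a 1) *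
          ((G y)⁻¹ k l * wirtBar (Pi.single k 1) (fun z => G z l b) y)
      - ∑ b, ∑ a, ∑ k, ∑ l, (G y)⁻¹ b a * etaForm G y (Pi.single a 1) *
          ((G y)⁻¹ k l * wirtBar (Pi.single b 1) (fun z => G z l k) y) := by
    rw [etaSq, hermTrace, Finset.sum_comm]
    simp only [star_etaForm_single hG hy, Finset.mul_sum, ← Finset.sum_sub_distrib]
    exact Finset.sum_congr rfl fun b _ => Finset.sum_congr rfl fun a _ =>
      Finset.sum_congr rfl fun k _ => Finset.sum_congr rfl fun l _ => by ring
  -- A relabelling of summation indices: the `∂̄G⁻¹` contribution is the first half of `|η|²` in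
  -- `h2`.
  have h3 : ∑ b, ∑ a, ∑ k, ∑ l, (G y)⁻¹ b k * wirtBar (Pi.single b 1) (fun z => G z k l) y *
          (G y)⁻¹ l a * etaForm G y (Pi.single a 1) =
      ∑ b, ∑ a, ∑ k, ∑ l, (G y)⁻¹ b a * etaForm G y (Pi.single a 1) *
          ((G y)⁻¹ k l * wirtBar (Pi.single k 1) (fun z => G z l b) y) := by
    rw [Finset.sum_comm]
    conv_rhs => rw [Finset.sum_comm]
    refine Finset.sum_congr rfl fun a _ => ?_
    conv_rhs => rw [Finset.sum_comm]
    refine Finset.sum_congr rfl fun k _ => ?_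
    conv_rhs => rw [Finset.sum_comm]
    exact Finset.sum_congr rfl fun l _ => Finset.sum_congr rfl fun b _ => by ring
  have h4 : chiCoord G y =
      ∑ b, ∑ a, (G y)⁻¹ b a * nablaBarEta G (Pi.single b 1) y (Pi.single a 1) := by
    rw [chiCoord, hermTrace, Finset.sum_comm]
  simp only [h1]
  rw [← Finset.mul_sum]
  simp only [Finset.sum_add_distrib, Finset.sum_sub_distrib]
  rw [h3, h2, h4]
  ring

theorem sum_wirtBar_mul_etaField (f : (Fin n → ℂ) → ℂ) :
    ∑ b, wirtBar (Pi.single b 1) f y * etaField G b y = (G y).det * gradPair G f y := by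
  simp only [etaField, gradPair, hermTrace, Finset.mul_sum]
  rw [Finset.sum_comm]
  exact Finset.sum_congr rfl fun a _ => Finset.sum_congr rfl fun b _ => by ring

end Divergence

/-! ### Integration by parts -/

section IntegrationByParts

variable {n : ℕ} {G : (Fin n → ℂ) → Matrix (Fin n) (Fin n) ℂ} {U : Set (Fin n → ℂ)}

/-- `g` is controlled only on `U`, but the product vanishes near every point outside the support of
`f`, so it is continuous on all of `ℂⁿ`. -/
theorem integrable_mul_of_tsupport_subset (hU : IsOpen U) {f g : (Fin n → ℂ) → ℂ}
    (hf : Continuous f) (hc : HasCompactSupport f) (hs : tsupport f ⊆ U)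
    (hg : ContinuousOn g U) : Integrable (fun y => f y * g y) := by
  refine Continuous.integrable_of_hasCompactSupport ?_ hc.mul_right
  refine continuous_of_tsupport fun y hy => ?_
  exact hf.continuousAt.mul (hg.continuousAt (hU.mem_nhds (hs (tsupport_mul_subset_left hy))))

theorem integral_mul_wirtBar (hU : IsOpen U) {f g : (Fin n → ℂ) → ℂ}
    (hf : ContDiff ℝ ∞ f) (hc : HasCompactSupport f) (hs : tsupport f ⊆ U)
    (hg : ContDiffOn ℝ ∞ g U) (u : Fin n → ℂ) :
    ∫ y, f y * wirtBar u g y = -∫ y, wirtBar u f y * g y := by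
  have hf' : ∀ v : Fin n → ℂ, Continuous (fun y => fderiv ℝ f y v) := fun v =>
    (hf.continuous_fderiv (by simp)).clm_apply continuous_const
  have hg' : ∀ v : Fin n → ℂ, ContinuousOn (fun y => fderiv ℝ g y v) U := fun v =>
    (hg.continuousOn_fderiv_of_isOpen hU (by simp)).clm_apply continuousOn_const
  have i1 : ∀ v : Fin n → ℂ, Integrable (fun y => fderiv ℝ f y v * g y) := fun v =>
    integrable_mul_of_tsupport_subset hU (hf' v) (hc.fderiv_apply ℝ v)
      ((tsupport_fderiv_apply_subset ℝ v).trans hs) hg.continuousOn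
  have i2 : ∀ v : Fin n → ℂ, Integrable (fun y => f y * fderiv ℝ g y v) := fun v =>
    integrable_mul_of_tsupport_subset hU hf.continuous hc hs (hg' v)
  have key : ∀ v : Fin n → ℂ, ∫ y, f y * fderiv ℝ g y v = -∫ y, fderiv ℝ f y v * g y := fun v =>
    integral_mul_fderiv_eq_neg_fderiv_mul_of_integrable (i1 v) (i2 v)
      (integrable_mul_of_tsupport_subset hU hf.continuous hc hs hg.continuousOn)
      (fun y _ => hf.differentiable (by simp) y)
      (fun y hy => (hg.contDiffAt (hU.mem_nhds (hs hy))).differentiableAt (by simp))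
  have e1 : ∀ y, f y * wirtBar u g y = (1 / 2 : ℂ) * (f y * fderiv ℝ g y u
      + Complex.I * (f y * fderiv ℝ g y (Complex.I • u))) := fun y => by
    simp only [wirtBar, smul_eq_mul]
    ring
  have e2 : ∀ y, wirtBar u f y * g y = (1 / 2 : ℂ) * (fderiv ℝ f y u * g y
      + Complex.I * (fderiv ℝ f y (Complex.I • u) * g y)) := fun y => by
    simp only [wirtBar, smul_eq_mul]
    ring
  simp only [e1, e2]
  rw [integral_const_mul, integral_const_mul, integral_add (i2 u) ((i2 _).const_mul _),
    integral_add (i1 u) ((i1 _).const_mul _), integral_const_mul, integral_const_mul, key, key]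
  ring

theorem IsHermitianOn.contDiffOn_etaField (hG : IsHermitianOn G U) (b : Fin n) :
    ContDiffOn ℝ ∞ (etaField G b) U :=
  hG.contDiffOn_det.mul (ContDiffOn.sum fun a _ =>
    (hG.contDiffOn_inv b a).mul (hG.contDiffOn_etaForm_apply _))

/-- The divergence theorem for the vector field dual to `η`. -/
theorem IsHermitianOn.integral_divergence (hG : IsHermitianOn G U) {f : (Fin n → ℂ) → ℂ}
    (hf : ContDiff ℝ ∞ f) (hc : HasCompactSupport f) (hs : tsupport f ⊆ U) :
    ∫ y, (G y).det * (f y * (chiCoord G y - etaSq G y)) =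
      -∫ y, (G y).det * gradPair G f y := by
  have hW := hG.contDiffOn_etaField
  have e1 : ∀ y, (G y).det * (f y * (chiCoord G y - etaSq G y)) =
      ∑ b, f y * wirtBar (Pi.single b 1) (etaField G b) y := by
    intro y
    by_cases hy : y ∈ U
    · rw [← Finset.mul_sum, sum_wirtBar_etaField hG hy]
      ring
    · have : f y = 0 := by
        by_contra h
        exact hy (hs (subset_tsupport f h))
      simp [this]
  have hwf : ∀ b : Fin n, Continuous (fun y => wirtBar (Pi.single b 1) f y) := fun b => by
    have := ContDiffOn.wirtBar isOpen_univ hf.contDiffOn (Pi.single b 1)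
    exact (contDiffOn_univ.1 this).continuous
  have htf : ∀ b : Fin n, tsupport (fun y => wirtBar (Pi.single b 1) f y) ⊆ tsupport f := by
    intro b
    refine closure_minimal (fun y hy => ?_) (isClosed_tsupport f)
    by_contra h
    refine hy ?_
    change wirtBar _ f y = 0
    rw [wirtBar_congr (notMem_tsupport_iff_eventuallyEq.1 h)]
    exact wirtBar_const _ 0 y
  simp only [e1, ← sum_wirtBar_mul_etaField]
  rw [integral_finsetSum, integral_finsetSum, ← Finset.sum_neg_distrib]
  · exact Finset.sum_congr rfl fun b _ => integral_mul_wirtBar hG.isOpen hf hc hs (hW b) _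
  · exact fun b _ => integrable_mul_of_tsupport_subset hG.isOpen (hwf b)
      (HasCompactSupport.of_support_subset_isCompact hc ((subset_tsupport _).trans (htf b)))
      ((htf b).trans hs) (hW b).continuousOn
  · exact fun b _ => integrable_mul_of_tsupport_subset hG.isOpen hf.continuous hc hs
      (ContDiffOn.wirtBar hG.isOpen (hW b) _).continuousOn

end IntegrationByParts

/-! ### Holomorphic isometries -/

section Isometry

variable {n : ℕ}

theorem fderiv_real_eq {F : Type*} [NormedAddCommGroup F] [NormedSpace ℂ F]
    {f : (Fin n → ℂ) → F} {y : Fin n → ℂ} (hf : DifferentiableAt ℂ f y) :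
    fderiv ℝ f y = (fderiv ℂ f y).restrictScalars ℝ :=
  hf.fderiv_restrictScalars ℝ

theorem wirt_eq_fderiv {F : Type*} [NormedAddCommGroup F] [NormedSpace ℂ F]
    {f : (Fin n → ℂ) → F} {y : Fin n → ℂ} (hf : DifferentiableAt ℂ f y) (u : Fin n → ℂ) :
    wirt u f y = fderiv ℂ f y u := by
  simp only [wirt, fderiv_real_eq hf, ContinuousLinearMap.coe_restrictScalars', map_smul,
    I_smul_I_smul]
  module

theorem wirtBar_eq_zero {F : Type*} [NormedAddCommGroup F] [NormedSpace ℂ F]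
    {f : (Fin n → ℂ) → F} {y : Fin n → ℂ} (hf : DifferentiableAt ℂ f y) (u : Fin n → ℂ) :
    wirtBar u f y = 0 := by
  simp only [wirtBar, fderiv_real_eq hf, ContinuousLinearMap.coe_restrictScalars', map_smul,
    I_smul_I_smul]
  module

theorem fderiv_comp_holomorphic {F : Type*} [NormedAddCommGroup F] [NormedSpace ℂ F]
    {ψ : (Fin n → ℂ) → Fin n → ℂ} {f : (Fin n → ℂ) → F} {y : Fin n → ℂ}
    (hψ : DifferentiableAt ℂ ψ y) (hf : DifferentiableAt ℝ f (ψ y)) (u : Fin n → ℂ) :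
    fderiv ℝ (fun z => f (ψ z)) y u = fderiv ℝ f (ψ y) (fderiv ℂ ψ y u) := by
  have h : HasFDerivAt (fun z => f (ψ z)) _ y :=
    hf.hasFDerivAt.comp y (hψ.restrictScalars ℝ).hasFDerivAt
  rw [h.fderiv, fderiv_real_eq hψ]
  rfl

/-- The differential of `ψ` is complex-linear, so the chain rule does not mix `∂` and `∂̄`. -/
theorem wirt_comp_holomorphic {F : Type*} [NormedAddCommGroup F] [NormedSpace ℂ F]
    {ψ : (Fin n → ℂ) → Fin n → ℂ} {f : (Fin n → ℂ) → F} {y : Fin n → ℂ}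
    (hψ : DifferentiableAt ℂ ψ y) (hf : DifferentiableAt ℝ f (ψ y)) (u : Fin n → ℂ) :
    wirt u (fun z => f (ψ z)) y = wirt (fderiv ℂ ψ y u) f (ψ y) := by
  simp only [wirt, fderiv_comp_holomorphic hψ hf, map_smul]

theorem wirtBar_comp_holomorphic {F : Type*} [NormedAddCommGroup F] [NormedSpace ℂ F]
    {ψ : (Fin n → ℂ) → Fin n → ℂ} {f : (Fin n → ℂ) → F} {y : Fin n → ℂ}
    (hψ : DifferentiableAt ℂ ψ y) (hf : DifferentiableAt ℝ f (ψ y)) (u : Fin n → ℂ) :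
    wirtBar u (fun z => f (ψ z)) y = wirtBar (fderiv ℂ ψ y u) f (ψ y) := by
  simp only [wirtBar, fderiv_comp_holomorphic hψ hf, map_smul]

/-- `ψ` is a holomorphic isometry on the open set `W` from the metric `G` to the metric `G'`. -/
structure IsIsometryOn (G G' : (Fin n → ℂ) → Matrix (Fin n) (Fin n) ℂ)
    (ψ : (Fin n → ℂ) → Fin n → ℂ) (W U' : Set (Fin n → ℂ)) : Prop where
  left : IsHermitianOn G W
  right : IsHermitianOn G' U'
  contDiffOn : ContDiffOn ℂ ∞ ψ W
  mapsTo : Set.MapsTo ψ W U'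
  pair_eq : ∀ z ∈ W, ∀ u v, pair G z u v = pair G' (ψ z) (fderiv ℂ ψ z u) (fderiv ℂ ψ z v)

namespace IsIsometryOn

variable {G G' : (Fin n → ℂ) → Matrix (Fin n) (Fin n) ℂ} {ψ : (Fin n → ℂ) → Fin n → ℂ}
  {W U' : Set (Fin n → ℂ)} {y : Fin n → ℂ} (hψ : IsIsometryOn G G' ψ W U') (hy : y ∈ W)

include hψ hy

theorem contDiffAt : ContDiffAt ℂ ∞ ψ y := hψ.contDiffOn.contDiffAt (hψ.left.isOpen.mem_nhds hy)

theorem differentiableAt : DifferentiableAt ℂ ψ y := (hψ.contDiffAt hy).differentiableAt (by simp)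

theorem differentiableAt_fderiv : DifferentiableAt ℂ (fderiv ℂ ψ) y :=
  ((hψ.contDiffAt hy).fderiv_right (m := 1) (by norm_cast)).differentiableAt (by simp)

theorem wirt_fderiv (u v : Fin n → ℂ) :
    wirt u (fun z => fderiv ℂ ψ z v) y = fderiv ℂ (fderiv ℂ ψ) y u v := by
  have hd := hψ.differentiableAt_fderiv hy
  rw [wirt_eq_fderiv (hd.clm_apply (differentiableAt_const _)),
    fderiv_clm_apply hd (differentiableAt_const _)]
  simp

/-- Under `ψ` the derivative `∇_u v` acquires the extra term `D²ψ(u, v)`, because a constant field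
is not sent to a constant field. That term is symmetric in `u, v` and drops out of the torsion. -/
theorem pair_torsion (u v x : Fin n → ℂ) :
    pair G y (torsion G y u v) x = pair G' (ψ y)
      (torsion G' (ψ y) (fderiv ℂ ψ y u) (fderiv ℂ ψ y v)) (fderiv ℂ ψ y x) := by
  have hd := hψ.differentiableAt_fderiv hy
  have hdv : ∀ v, DifferentiableAt ℂ (fun z => fderiv ℂ ψ z v) y := fun v =>
    hd.clm_apply (differentiableAt_const _)
  have hy' := hψ.mapsTo hy
  have hent : ∀ i j, DifferentiableAt ℝ (fun z => G' (ψ z) i j) y := fun i j =>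
    (hψ.right.differentiableAt_entry hy' i j).comp y
      ((hψ.differentiableAt hy).restrictScalars ℝ)
  have key : ∀ u v, pair G y (nabla G u (fun _ => v) y) x =
      pair G' (ψ y) (fderiv ℂ (fderiv ℂ ψ) y u v
        + nabla G' (fderiv ℂ ψ y u) (fun _ => fderiv ℂ ψ y v) (ψ y)) (fderiv ℂ ψ y x) := by
    intro u v
    have h1 : (fun z => pair G z v x) =ᶠ[nhds y]
        fun z => pair (fun z => G' (ψ z)) z (fderiv ℂ ψ z v) (fderiv ℂ ψ z x) := by
      filter_upwards [hψ.left.isOpen.mem_nhds hy] with z hz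
      exact hψ.pair_eq z hz v x
    -- `z ↦ dψ_z x` is holomorphic, so compatibility in the target metric again leaves only the term
    -- with `∇_u`.
    have h2 : nablaBar u (fun z => fderiv ℂ ψ z x) y = 0 := wirtBar_eq_zero (hdv x) u
    have h3 : chernMatrix (fun z => G' (ψ z)) u y = chernMatrix G' (fderiv ℂ ψ y u) (ψ y) := by
      rw [chernMatrix, chernMatrix]
      congr 1
      ext i j
      exact wirt_comp_holomorphic (hψ.differentiableAt hy)
        (hψ.right.differentiableAt_entry hy' i j) u
    rw [hψ.left.pair_nabla hy, wirt_congr h1,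
      wirt_pair (G := fun z => G' (ψ z)) (hψ.right.isUnit_det hy') hent u
        ((hdv v).restrictScalars ℝ) ((hdv x).restrictScalars ℝ), h2, pair_zero_right, add_zero,
      nabla, hψ.wirt_fderiv hy, h3]
    simp only [nabla, wirt_const, zero_add]
    rfl
  have hsymm : fderiv ℂ (fderiv ℂ ψ) y u v = fderiv ℂ (fderiv ℂ ψ) y v u :=
    (((hψ.contDiffAt hy).of_le (WithTop.coe_le_coe.2 (le_top : (2 : ℕ∞) ≤ ⊤))).isSymmSndFDerivAt
      (by simp)).eq u v
  rw [torsion, torsion, pair_sub_left, key, key, hsymm, ← pair_sub_left, add_sub_add_left_eq_sub]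

variable {e : Fin n → Fin n → ℂ}

theorem isUnitaryFrame (he : IsUnitaryFrame G y e) :
    IsUnitaryFrame G' (ψ y) (fun i => fderiv ℂ ψ y (e i)) := fun i j => by
  rw [← hψ.pair_eq y hy, he i j]

theorem torsionC_eq (i k j : Fin n) :
    torsionC G' (ψ y) (fun i => fderiv ℂ ψ y (e i)) i k j = torsionC G y e i k j :=
  (hψ.pair_torsion hy _ _ _).symm

theorem etaForm_eq (he : IsUnitaryFrame G y e) (u : Fin n → ℂ) :
    etaForm G' (ψ y) (fderiv ℂ ψ y u) = etaForm G y u := by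
  rw [he.etaForm_eq, (hψ.isUnitaryFrame hy he).etaForm_eq]
  exact Finset.sum_congr rfl fun k _ => (hψ.pair_torsion hy _ _ _).symm

theorem normSqTorsion_eq :
    normSqTorsion G' (ψ y) (fun i => fderiv ℂ ψ y (e i)) = normSqTorsion G y e := by
  simp only [normSqTorsion, hψ.torsionC_eq hy]

theorem normSqEta_eq (he : IsUnitaryFrame G y e) :
    normSqEta G' (ψ y) (fun i => fderiv ℂ ψ y (e i)) = normSqEta G y e := by
  simp only [normSqEta, etaC, hψ.etaForm_eq hy he]

theorem gradPair_eq (he : IsUnitaryFrame G y e) {f : (Fin n → ℂ) → ℂ}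
    (hf : DifferentiableAt ℝ f (ψ y)) :
    gradPair G' f (ψ y) = gradPair G (fun z => f (ψ z)) y := by
  rw [he.gradPair_eq, (hψ.isUnitaryFrame hy he).gradPair_eq]
  exact Finset.sum_congr rfl fun i _ => by
    rw [hψ.etaForm_eq hy he, wirtBar_comp_holomorphic (hψ.differentiableAt hy) hf]

theorem det_eq :
    (G y).det = (fderiv ℂ ψ y).det * (G' (ψ y)).det * star (fderiv ℂ ψ y).det := by
  set A := LinearMap.toMatrix' (fderiv ℂ ψ y : (Fin n → ℂ) →ₗ[ℂ] (Fin n → ℂ)) with hA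
  have hd : (fderiv ℂ ψ y).det = A.det := (LinearMap.det_toMatrix' _).symm
  have h : G y = A.transpose * G' (ψ y) * A.conjTranspose.transpose := by
    ext a b
    rw [← pair_single_single (G := G), hψ.pair_eq y hy, pair, Finset.sum_comm]
    simp only [Matrix.mul_apply, Matrix.transpose_apply, Matrix.conjTranspose_apply,
      Finset.sum_mul, hA, LinearMap.toMatrix'_apply]
    exact Finset.sum_congr rfl fun j _ => Finset.sum_congr rfl fun i _ => by
      rw [mul_comm (G' (ψ y) i j)]
      rfl
  rw [hd, h, Matrix.det_mul, Matrix.det_mul, Matrix.det_transpose, Matrix.det_transpose,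
    Matrix.det_conjTranspose]

/-- The real Jacobian of a holomorphic map is the squared modulus of the complex one, which is
exactly the factor between `det G` and `det G'`. -/
theorem abs_det_fderiv_mul :
    |(fderiv ℝ ψ y).det| * (G' (ψ y)).det.re = (G y).det.re := by
  have h1 : (fderiv ℝ ψ y).det = Complex.normSq (fderiv ℂ ψ y).det := by
    rw [fderiv_real_eq (hψ.differentiableAt hy)]
    change LinearMap.det ((fderiv ℂ ψ y : (Fin n → ℂ) →ₗ[ℂ] (Fin n → ℂ)).restrictScalars ℝ) = _
    rw [LinearMap.det_restrictScalars, Algebra.norm_complex_eq]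
    rfl
  rw [h1, abs_of_nonneg (Complex.normSq_nonneg _), hψ.det_eq hy, mul_right_comm, Complex.star_def,
    Complex.mul_conj, Complex.re_ofReal_mul]

end IsIsometryOn

end Isometry

/-! ### Holomorphic charts of a Hermitian manifold -/

section Charts

variable {n : ℕ} {M : Type*} [TopologicalSpace M]

/-- The set of points at which the coordinate change from `φ` to `φ'` is defined. -/
def overlap (φ φ' : OpenPartialHomeomorph M (Fin n → ℂ)) : Set (Fin n → ℂ) :=
  φ.target ∩ φ.symm ⁻¹' φ'.source

theorem isOpen_overlap {φ φ' : OpenPartialHomeomorph M (Fin n → ℂ)} :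
    IsOpen (overlap φ φ') :=
  φ.isOpen_inter_preimage_symm φ'.open_source

variable [ChartedSpace (Fin n → ℂ) M]

/-- The differential of the inverse of a chart, as a map on `ℂⁿ`. -/
noncomputable def chartDeriv (φ : OpenPartialHomeomorph M (Fin n → ℂ)) (y : Fin n → ℂ) :
    (Fin n → ℂ) →L[ℂ] (Fin n → ℂ) :=
  mfderiv 𝓘(ℂ, Fin n → ℂ) 𝓘(ℂ, Fin n → ℂ) φ.symm y

/-- The metric as a function on `ℂⁿ`. -/
noncomputable def HermitianMetric.form (h : HermitianMetric n M) (p : M) (u v : Fin n → ℂ) : ℂ :=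
  h.inner p u v

theorem HermitianMetric.isSesquilinear_form (h : HermitianMetric n M) (p : M) :
    IsSesquilinear (h.form p) where
  add_left u u' v := by
    have := congrArg (fun l => l v) ((h.inner p).map_add u u')
    exact this
  smul_left c u v := by
    have := congrArg (fun l => l v) ((h.inner p).map_smul c u)
    exact this
  add_right u v v' := (h.inner p u).map_add v v'
  smul_right c u v := (h.inner p u).map_smulₛₗ c v

theorem HermitianMetric.pair_coord (h : HermitianMetric n M)
    (φ : OpenPartialHomeomorph M (Fin n → ℂ)) (y u v : Fin n → ℂ) :
    pair (h.coord φ) y u v = h.form (φ.symm y) (chartDeriv φ y u) (chartDeriv φ y v) := by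
  conv_rhs => rw [pi_eq_sum_univ' u, pi_eq_sum_univ' v, map_sum, map_sum]
  simp only [map_smul]
  rw [(h.isSesquilinear_form _).sum_smul_sum_smul, pair]
  exact Finset.sum_congr rfl fun i _ => Finset.sum_congr rfl fun j _ => by
    rw [mul_assoc, mul_comm]
    rfl

section Transition

variable {φ φ' : OpenPartialHomeomorph M (Fin n → ℂ)}

variable (hφ : φ ∈ IsManifold.maximalAtlas 𝓘(ℂ, Fin n → ℂ) ω M)
  (hφ' : φ' ∈ IsManifold.maximalAtlas 𝓘(ℂ, Fin n → ℂ) ω M)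

include hφ hφ'

theorem contDiffOn_transition : ContDiffOn ℂ ω (φ' ∘ φ.symm) (overlap φ φ') :=
  contMDiffOn_iff_contDiffOn.1 <| (contMDiffOn_of_mem_maximalAtlas hφ').comp
    ((contMDiffOn_symm_of_mem_maximalAtlas hφ).mono Set.inter_subset_left) fun _ hy => hy.2

theorem chartDeriv_transition {y : Fin n → ℂ} (hy : y ∈ overlap φ φ') (u : Fin n → ℂ) :
    chartDeriv φ y u =
      chartDeriv φ' ((φ' ∘ φ.symm) y) (fderiv ℂ (φ' ∘ φ.symm) y u) := by
  have h1 : φ.symm =ᶠ[nhds y] φ'.symm ∘ (φ' ∘ φ.symm) := by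
    filter_upwards [isOpen_overlap.mem_nhds hy] with z hz
    exact (φ'.left_inv hz.2).symm
  have h2 : MDifferentiableAt 𝓘(ℂ, Fin n → ℂ) 𝓘(ℂ, Fin n → ℂ) (φ' ∘ φ.symm) y :=
    (((contDiffOn_transition hφ hφ').contDiffAt
      (isOpen_overlap.mem_nhds hy)).differentiableAt (by simp)).mdifferentiableAt
  have h3 : MDifferentiableAt 𝓘(ℂ, Fin n → ℂ) 𝓘(ℂ, Fin n → ℂ) φ'.symm ((φ' ∘ φ.symm) y) :=
    (contMDiffAt_symm_of_mem_maximalAtlas hφ' (φ'.map_source hy.2)).mdifferentiableAt (by simp)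
  have h4 := mfderiv_comp y h3 h2
  rw [mfderiv_eq_fderiv] at h4
  have h5 : chartDeriv φ y = _ := h1.mfderiv_eq.trans h4
  rw [h5]
  rfl

omit hφ' in
-- Differentiating `φ ∘ φ⁻¹ = id` supplies a left inverse. Positivity of the metric on tangent
-- vectors needs this to give positivity of the coordinate matrix.
theorem chartDeriv_injective {y : Fin n → ℂ} (hy : y ∈ φ.target) :
    Function.Injective (chartDeriv φ y) := by
  have h1 : (fun z => z) =ᶠ[nhds y] φ ∘ φ.symm := by
    filter_upwards [φ.open_target.mem_nhds hy] with z hz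
    exact (φ.right_inv hz).symm
  have h2 : MDifferentiableAt 𝓘(ℂ, Fin n → ℂ) 𝓘(ℂ, Fin n → ℂ) φ.symm y :=
    (contMDiffAt_symm_of_mem_maximalAtlas hφ hy).mdifferentiableAt (by simp)
  have h3 : MDifferentiableAt 𝓘(ℂ, Fin n → ℂ) 𝓘(ℂ, Fin n → ℂ) φ (φ.symm y) :=
    (contMDiffAt_of_mem_maximalAtlas hφ (φ.map_target hy)).mdifferentiableAt (by simp)
  have h4 := h1.mfderiv_eq (I := 𝓘(ℂ, Fin n → ℂ)) (I' := 𝓘(ℂ, Fin n → ℂ))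
    |>.trans (mfderiv_comp y h3 h2)
  intro u v huv
  have h5 : ∀ w : Fin n → ℂ, w = mfderiv 𝓘(ℂ, Fin n → ℂ) 𝓘(ℂ, Fin n → ℂ) φ (φ.symm y)
      (chartDeriv φ y w) := by
    intro w
    have := congrArg (fun l => l w) h4
    rw [mfderiv_eq_fderiv, fderiv_fun_id] at this
    exact this
  rw [h5 u, huv, ← h5 v]

variable (h : HermitianMetric n M)

omit hφ' in
theorem HermitianMetric.isHermitianOn_coord : IsHermitianOn (h.coord φ) φ.target where
  isOpen := φ.open_target
  contDiffOn i j := h.smooth φ hφ i j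
  posDef y hy := by
    refine Matrix.PosDef.of_dotProduct_mulVec_pos ?_ ?_
    · ext i j
      exact h.conj_symm _ _ _
    · intro x hx
      -- `pair` conjugates its second argument and the matrix quadratic form its first, hence `star
      -- x`.
      have h1 : dotProduct (star x) (Matrix.mulVec (h.coord φ y) x) =
          pair (h.coord φ) y (star x) (star x) := by
        simp only [dotProduct, Matrix.mulVec, Finset.mul_sum, pair, Pi.star_apply, star_star]
        exact Finset.sum_congr rfl fun i _ => Finset.sum_congr rfl fun j _ => by ring
      rw [h1, h.pair_coord]
      have h2 : chartDeriv φ y (star x) ≠ 0 := by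
        intro h0
        rw [← map_zero (chartDeriv φ y)] at h0
        exact hx (by simpa using chartDeriv_injective hφ hy h0)
      rw [Complex.lt_def]
      refine ⟨h.pos _ _ h2, ?_⟩
      have h3 := congrArg Complex.im (h.conj_symm (φ.symm y) (chartDeriv φ y (star x))
        (chartDeriv φ y (star x)))
      simp only [Complex.star_def, Complex.conj_im] at h3
      change 0 = (h.inner (φ.symm y) (chartDeriv φ y (star x)) (chartDeriv φ y (star x))).im
      linarith

/-- Both matrices represent the same inner product on the tangent space; this is the source of all
chart independence below. -/
theorem HermitianMetric.isIsometryOn_transition :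
    IsIsometryOn (h.coord φ) (h.coord φ') (φ' ∘ φ.symm) (overlap φ φ') φ'.target where
  left :=
    { isOpen := isOpen_overlap
      contDiffOn := fun i j =>
        ((h.isHermitianOn_coord hφ).contDiffOn i j).mono Set.inter_subset_left
      posDef := fun z hz => (h.isHermitianOn_coord hφ).posDef z hz.1 }
  right := h.isHermitianOn_coord hφ'
  contDiffOn := (contDiffOn_transition hφ hφ').of_le (by simp)
  mapsTo y hy := φ'.map_source hy.2
  pair_eq y hy u v := by
    have h1 : φ'.symm ((φ' ∘ φ.symm) y) = φ.symm y := φ'.left_inv hy.2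
    rw [h.pair_coord, h.pair_coord, chartDeriv_transition hφ hφ' hy,
      chartDeriv_transition hφ hφ' hy, h1]

end Transition

variable (n M) in
/-- The underlying real manifold of a complex manifold. -/
theorem isManifold_real [IsManifold 𝓘(ℂ, Fin n → ℂ) ω M] :
    IsManifold 𝓘(ℝ, Fin n → ℂ) ∞ M := by
  refine isManifold_of_contDiffOn _ _ _ fun e e' he he' => ?_
  have h := contDiffOn_transition (IsManifold.subset_maximalAtlas (I := 𝓘(ℂ, Fin n → ℂ))
    (n := ω) he) (IsManifold.subset_maximalAtlas he')
  have h' : ContDiffOn ℝ ∞ (e' ∘ e.symm) (overlap e e') :=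
    (h.restrict_scalars ℝ).of_le (by simp)
  refine h'.mono ?_
  intro y hy
  simpa [overlap] using hy

end Charts

/-! ### The volume measure -/

section Volume

variable {n : ℕ} {M : Type*} [TopologicalSpace M] [ChartedSpace (Fin n → ℂ) M]
  (h : HermitianMetric n M)
  {φ φ' : OpenPartialHomeomorph M (Fin n → ℂ)}

/-- The density of the volume measure in a chart. -/
noncomputable def HermitianMetric.density (φ : OpenPartialHomeomorph M (Fin n → ℂ))
    (y : Fin n → ℂ) : ℝ :=
  2 ^ n * (h.coord φ y).det.re

section

variable (hφ : φ ∈ IsManifold.maximalAtlas 𝓘(ℂ, Fin n → ℂ) ω M)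

include hφ

theorem HermitianMetric.density_pos {y : Fin n → ℂ} (hy : y ∈ φ.target) : 0 < h.density φ y := by
  have h1 := ((h.isHermitianOn_coord hφ).posDef y hy).det_pos
  exact mul_pos (by positivity) (Complex.lt_def.1 h1).1

theorem HermitianMetric.ofReal_density {y : Fin n → ℂ} (hy : y ∈ φ.target) :
    (h.density φ y : ℂ) = 2 ^ n * (h.coord φ y).det := by
  have h1 := (Complex.lt_def.1 ((h.isHermitianOn_coord hφ).posDef y hy).det_pos).2
  rw [density, Complex.ofReal_mul]
  push_cast
  congr 1
  exact Complex.ext rfl (by simpa using h1)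

theorem HermitianMetric.continuousOn_density : ContinuousOn (h.density φ) φ.target :=
  continuousOn_const.mul
    (Complex.continuous_re.comp_continuousOn (h.isHermitianOn_coord hφ).contDiffOn_det.continuousOn)

end

variable [MeasurableSpace M] [BorelSpace M]

/-- The volume measure of a chart domain. -/
noncomputable def HermitianMetric.chartMeasure (φ : OpenPartialHomeomorph M (Fin n → ℂ)) :
    Measure M :=
  Measure.map φ.symm ((MeasureTheory.volume.restrict φ.target).withDensity
    fun y => ENNReal.ofReal (h.density φ y))

omit [ChartedSpace (Fin n → ℂ) M] in
theorem aemeasurable_symm : AEMeasurable φ.symm (volume.restrict φ.target) :=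
  φ.continuousOn_symm.aemeasurable φ.open_target.measurableSet

theorem HermitianMetric.aemeasurable_symm_withDensity : AEMeasurable φ.symm
    ((MeasureTheory.volume.restrict φ.target).withDensity fun y => ENNReal.ofReal (h.density φ y)) :=
  aemeasurable_symm.mono_ac (withDensity_absolutelyContinuous _ _)

theorem HermitianMetric.chartMeasure_apply {A : Set M} (hA : MeasurableSet A) :
    h.chartMeasure φ A =
      ∫⁻ y in φ.target ∩ φ.symm ⁻¹' A, ENNReal.ofReal (h.density φ y) := by
  rw [chartMeasure, Measure.map_apply_of_aemeasurable h.aemeasurable_symm_withDensity hA,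
    withDensity_apply', Measure.restrict_restrict' φ.open_target.measurableSet, Set.inter_comm]

omit [ChartedSpace (Fin n → ℂ) M] in
theorem measurableSet_target_inter_preimage {A : Set M} (hA : MeasurableSet A) :
    MeasurableSet (φ.target ∩ φ.symm ⁻¹' A) := by
  have h1 : Measurable (φ.target.domRestrict φ.symm) :=
    (continuousOn_iff_continuous_domRestrict.1 φ.continuousOn_symm).measurable
  have h2 := φ.open_target.measurableSet.subtype_image (h1 hA)
  convert h2 using 1
  ext y
  simp [Set.domRestrict, and_comm]

variable (hφ : φ ∈ IsManifold.maximalAtlas 𝓘(ℂ, Fin n → ℂ) ω M)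
  (hφ' : φ' ∈ IsManifold.maximalAtlas 𝓘(ℂ, Fin n → ℂ) ω M)

include hφ

include hφ' in
-- Change of variables along the transition map, whose real Jacobian converts one density into the
-- other.
theorem HermitianMetric.chartMeasure_eq {A : Set M} (hA : MeasurableSet A)
    (h1 : A ⊆ φ.source) (h2 : A ⊆ φ'.source) : h.chartMeasure φ A = h.chartMeasure φ' A := by
  set S := φ.target ∩ φ.symm ⁻¹' A
  have hS : S ⊆ overlap φ φ' := fun y hy => ⟨hy.1, h2 hy.2⟩
  have hψ := h.isIsometryOn_transition hφ hφ'
  have himage : φ'.target ∩ φ'.symm ⁻¹' A = (φ' ∘ φ.symm) '' S := by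
    ext z
    constructor
    · rintro ⟨hz, hzA⟩
      refine ⟨φ (φ'.symm z), ⟨φ.map_source (h1 hzA), ?_⟩, ?_⟩
      · change φ.symm (φ (φ'.symm z)) ∈ A
        rwa [φ.left_inv (h1 hzA)]
      · simp [φ.left_inv (h1 hzA), φ'.right_inv hz]
    · rintro ⟨y, hy, rfl⟩
      refine ⟨φ'.map_source (h2 hy.2), ?_⟩
      change φ'.symm (φ' (φ.symm y)) ∈ A
      rw [φ'.left_inv (h2 hy.2)]
      exact hy.2
  have hinj : Set.InjOn (φ' ∘ φ.symm) S := fun y hy z hz hyz =>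
    φ.symm.injOn hy.1 hz.1 (φ'.injOn (h2 hy.2) (h2 hz.2) hyz)
  have hSm : MeasurableSet S := measurableSet_target_inter_preimage hA
  rw [h.chartMeasure_apply hA, h.chartMeasure_apply hA, himage,
    lintegral_image_eq_lintegral_abs_det_fderiv_mul MeasureTheory.volume hSm
      (f' := fun y => fderiv ℝ (φ' ∘ φ.symm) y)
      (fun y hy => ((hψ.differentiableAt (hS hy)).restrictScalars
        ℝ).hasFDerivAt.hasFDerivWithinAt) hinj]
  refine setLIntegral_congr_fun hSm fun y hy => ?_
  rw [← ENNReal.ofReal_mul (abs_nonneg _), density, density, mul_left_comm,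
    hψ.abs_det_fderiv_mul (hS hy)]

omit hφ in
theorem HermitianMetric.chartMeasure_compl : h.chartMeasure φ φ.sourceᶜ = 0 := by
  rw [h.chartMeasure_apply φ.open_source.measurableSet.compl]
  have : φ.target ∩ φ.symm ⁻¹' φ.sourceᶜ = ∅ := by
    ext y
    simp only [Set.mem_inter_iff, Set.mem_preimage, Set.mem_compl_iff, Set.mem_empty_iff_false,
      iff_false, not_and, not_not]
    exact fun hy => φ.map_target hy
  rw [this]
  simp

include hφ' in
-- Only an inequality is available, since the measure of `φ'` does not charge points outside the
-- domain of `φ'`. It is what bounding a supremum requires.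
theorem HermitianMetric.restrict_chartMeasure_le :
    (h.chartMeasure φ').restrict φ.source ≤ h.chartMeasure φ := by
  refine Measure.le_iff.2 fun A hA => ?_
  have hm : MeasurableSet (A ∩ φ.source ∩ φ'.source) :=
    (hA.inter φ.open_source.measurableSet).inter φ'.open_source.measurableSet
  calc (h.chartMeasure φ').restrict φ.source A
      = h.chartMeasure φ' (A ∩ φ.source) := Measure.restrict_apply hA
    _ = h.chartMeasure φ' (A ∩ φ.source ∩ φ'.source) :=
        (measure_inter_conull h.chartMeasure_compl).symm
    _ = h.chartMeasure φ (A ∩ φ.source ∩ φ'.source) :=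
        (h.chartMeasure_eq hφ hφ' hm (fun p hp => hp.1.2) fun p hp => hp.2).symm
    _ ≤ h.chartMeasure φ A := measure_mono fun p hp => hp.1.1

/-- On a chart domain the volume measure is the measure defined by the chart. -/
theorem HermitianMetric.volume_restrict_source :
    h.volume.restrict φ.source = h.chartMeasure φ := by
  have hle : ∀ φ' : IsManifold.maximalAtlas 𝓘(ℂ, Fin n → ℂ) ω M,
      h.chartMeasure φ'.1 ≤ h.volume :=
    le_iSup (fun φ' : IsManifold.maximalAtlas 𝓘(ℂ, Fin n → ℂ) ω M => h.chartMeasure φ'.1)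
  refine le_antisymm ?_ ?_
  -- Split each chart measure along the domain of `φ`. The inside is dominated by the measure of
  -- `φ`, the outside by the volume itself, and restricting to the domain removes the outside term.
  · have hub : h.volume ≤ h.chartMeasure φ + h.volume.restrict φ.sourceᶜ := by
      refine iSup_le fun φ' => ?_
      change h.chartMeasure φ'.1 ≤ _
      conv_lhs => rw [← Measure.restrict_add_restrict_compl (μ := h.chartMeasure φ'.1)
        φ.open_source.measurableSet]
      exact add_le_add (h.restrict_chartMeasure_le hφ φ'.2)
        (Measure.restrict_mono subset_rfl (hle φ'))
    calc h.volume.restrict φ.source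
        ≤ (h.chartMeasure φ + h.volume.restrict φ.sourceᶜ).restrict φ.source :=
          Measure.restrict_mono subset_rfl hub
      _ = (h.chartMeasure φ).restrict φ.source := by
          rw [Measure.restrict_add, Measure.restrict_restrict φ.open_source.measurableSet,
            Set.inter_compl_self, Measure.restrict_empty, add_zero]
      _ ≤ h.chartMeasure φ := Measure.restrict_le_self
  · calc h.chartMeasure φ = (h.chartMeasure φ).restrict φ.source :=
          (Measure.restrict_eq_self_of_ae_mem (by
            rw [ae_iff]; exact h.chartMeasure_compl)).symm
      _ ≤ h.volume.restrict φ.source := Measure.restrict_mono subset_rfl (hle ⟨φ, hφ⟩)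

theorem HermitianMetric.setIntegral_source {F : M → ℂ} (hF : Continuous F) :
    ∫ p in φ.source, F p ∂h.volume =
      ∫ y in φ.target, (h.density φ y : ℂ) * F (φ.symm y) := by
  rw [h.volume_restrict_source hφ, chartMeasure,
    integral_map h.aemeasurable_symm_withDensity hF.aestronglyMeasurable,
    integral_withDensity_eq_integral_toReal_smul₀
      ((h.continuousOn_density hφ).aemeasurable φ.open_target.measurableSet).ennreal_ofReal
      (Filter.Eventually.of_forall fun _ => ENNReal.ofReal_lt_top)]
  refine setIntegral_congr_fun φ.open_target.measurableSet fun y hy => ?_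
  simp only [ENNReal.toReal_ofReal (h.density_pos hφ hy).le, Complex.real_smul]

omit hφ in
theorem HermitianMetric.isLocallyFiniteMeasure_volume [T2Space M]
    [IsManifold 𝓘(ℂ, Fin n → ℂ) ω M] : IsLocallyFiniteMeasure h.volume := by
  refine ⟨fun p => ?_⟩
  set φ := chartAt (Fin n → ℂ) p
  have hφ : φ ∈ IsManifold.maximalAtlas 𝓘(ℂ, Fin n → ℂ) ω M := IsManifold.chart_mem_maximalAtlas p
  have hp : p ∈ φ.source := mem_chart_source _ p
  obtain ⟨K, hK, hKy, hKt⟩ := exists_compact_subset φ.open_target (φ.map_source hp)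
  refine ⟨φ.source ∩ φ ⁻¹' K, ?_, ?_⟩
  · exact Filter.inter_mem (φ.open_source.mem_nhds hp)
      ((φ.continuousAt hp).preimage_mem_nhds (mem_interior_iff_mem_nhds.1 hKy))
  · have hcK : IsCompact (φ.symm '' K) := hK.image_of_continuousOn (φ.continuousOn_symm.mono hKt)
    have hsub : φ.source ∩ φ ⁻¹' K ⊆ φ.symm '' K := fun q hq => ⟨φ q, hq.2, φ.left_inv hq.1⟩
    have hset : φ.target ∩ φ.symm ⁻¹' (φ.symm '' K) ⊆ K := by
      rintro y ⟨hy, z, hz, hzy⟩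
      rwa [← φ.symm.injOn (hKt hz) hy hzy]
    calc h.volume (φ.source ∩ φ ⁻¹' K)
        = h.volume.restrict φ.source (φ.source ∩ φ ⁻¹' K) :=
          (Measure.restrict_eq_self _ Set.inter_subset_left).symm
      _ = h.chartMeasure φ (φ.source ∩ φ ⁻¹' K) := by rw [h.volume_restrict_source hφ]
      _ ≤ h.chartMeasure φ (φ.symm '' K) := measure_mono hsub
      _ ≤ ∫⁻ y in K, ENNReal.ofReal (h.density φ y) := by
          rw [h.chartMeasure_apply hcK.measurableSet]
          exact lintegral_mono_set hset
      _ < ⊤ := (((h.continuousOn_density hφ).mono hKt).integrableOn_compact hK).lintegral_lt_top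

end Volume

/-! ### The integral identity on a compact manifold -/

section Global

variable {n : ℕ}

theorem gradPair_congr {G : (Fin n → ℂ) → Matrix (Fin n) (Fin n) ℂ} {f g : (Fin n → ℂ) → ℂ}
    {y : Fin n → ℂ} (hfg : f =ᶠ[nhds y] g) : gradPair G f y = gradPair G g y := by
  simp only [gradPair, wirtBar_congr hfg]

theorem gradPair_const (G : (Fin n → ℂ) → Matrix (Fin n) (Fin n) ℂ) (a : ℂ) (y : Fin n → ℂ) :
    gradPair G (fun _ => a) y = 0 := by
  simp [gradPair, hermTrace]

theorem IsUnitaryFrame.gradPair_sum {G : (Fin n → ℂ) → Matrix (Fin n) (Fin n) ℂ}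
    {y : Fin n → ℂ} {e : Fin n → Fin n → ℂ} (he : IsUnitaryFrame G y e) {ι : Type*}
    (s : Finset ι) {f : ι → (Fin n → ℂ) → ℂ} (hf : ∀ i ∈ s, DifferentiableAt ℝ (f i) y) :
    gradPair G (fun z => ∑ i ∈ s, f i z) y = ∑ i ∈ s, gradPair G (f i) y := by
  simp only [he.gradPair_eq, wirtBar_sum s _ hf, Finset.mul_sum]
  exact Finset.sum_comm

variable {M : Type*} [TopologicalSpace M] [ChartedSpace (Fin n → ℂ) M]

variable (n) in
/-- The function `f` is smooth in the charts of the atlas. -/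
def IsSmoothInCharts (f : M → ℂ) : Prop :=
  ∀ φ ∈ atlas (Fin n → ℂ) M, ContDiffOn ℝ ∞ (fun z => f (φ.symm z)) φ.target

theorem IsSmoothInCharts.differentiableAt {f : M → ℂ} (hf : IsSmoothInCharts n f)
    {φ : OpenPartialHomeomorph M (Fin n → ℂ)} (hφ : φ ∈ atlas (Fin n → ℂ) M)
    {y : Fin n → ℂ} (hy : y ∈ φ.target) : DifferentiableAt ℝ (fun z => f (φ.symm z)) y :=
  ((hf φ hφ).contDiffAt (φ.open_target.mem_nhds hy)).differentiableAt (by simp)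

theorem isSmoothInCharts_of_contMDiff [IsManifold 𝓘(ℂ, Fin n → ℂ) ω M] {f : M → ℝ}
    (hf : ContMDiff 𝓘(ℝ, Fin n → ℂ) 𝓘(ℝ, ℝ) ∞ f) :
    IsSmoothInCharts n fun p => (f p : ℂ) := by
  intro φ hφ
  have := isManifold_real n M
  have h1 : ContMDiffOn 𝓘(ℝ, Fin n → ℂ) 𝓘(ℝ, Fin n → ℂ) ∞ φ.symm φ.target :=
    contMDiffOn_symm_of_mem_maximalAtlas (IsManifold.subset_maximalAtlas hφ)
  have h2 : ContDiffOn ℝ ∞ (fun z => f (φ.symm z)) φ.target :=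
    (hf.comp_contMDiffOn h1).contDiffOn
  exact Complex.ofRealCLM.contDiff.comp_contDiffOn h2

/-- The function `f ∘ φ⁻¹` extended by zero. -/
noncomputable def extendZero (φ : OpenPartialHomeomorph M (Fin n → ℂ)) (f : M → ℂ) :
    (Fin n → ℂ) → ℂ :=
  φ.target.indicator fun z => f (φ.symm z)

section ExtendZero

variable {φ : OpenPartialHomeomorph M (Fin n → ℂ)} {f : M → ℂ}

omit [ChartedSpace (Fin n → ℂ) M] in
theorem extendZero_eventuallyEq {y : Fin n → ℂ} (hy : y ∈ φ.target) :
    extendZero φ f =ᶠ[nhds y] fun z => f (φ.symm z) := by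
  filter_upwards [φ.open_target.mem_nhds hy] with z hz
  exact Set.indicator_of_mem hz _

variable [CompactSpace M] (hs : tsupport f ⊆ φ.source)

include hs

omit [ChartedSpace (Fin n → ℂ) M] in
-- Compactness of `M` makes the image of the support compact, hence closed in `ℂⁿ`. The support of
-- the extension therefore stays away from the boundary of the target, and extending by zero loses
-- no smoothness.
theorem tsupport_extendZero_subset : tsupport (extendZero φ f) ⊆ φ '' tsupport f := by
  have hK : IsCompact (φ '' tsupport f) :=
    (isClosed_tsupport f).isCompact.image_of_continuousOn (φ.continuousOn.mono hs)
  refine closure_minimal (fun y hy => ?_) hK.isClosed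
  have hy' := Set.mem_of_indicator_ne_zero hy
  refine ⟨φ.symm y, subset_tsupport f ?_, φ.right_inv hy'⟩
  have h1 : extendZero φ f y ≠ 0 := hy
  rwa [(extendZero_eventuallyEq hy').eq_of_nhds] at h1

omit [ChartedSpace (Fin n → ℂ) M] in
theorem tsupport_extendZero_subset_target : tsupport (extendZero φ f) ⊆ φ.target := by
  refine (tsupport_extendZero_subset hs).trans ?_
  rintro _ ⟨p, hp, rfl⟩
  exact φ.map_source (hs hp)

omit [ChartedSpace (Fin n → ℂ) M] in
theorem hasCompactSupport_extendZero : HasCompactSupport (extendZero φ f) :=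
  ((isClosed_tsupport f).isCompact.image_of_continuousOn
    (φ.continuousOn.mono hs)).of_isClosed_subset (isClosed_tsupport _)
    (tsupport_extendZero_subset hs)

theorem IsSmoothInCharts.contDiff_extendZero (hf : IsSmoothInCharts n f)
    (hφ : φ ∈ atlas (Fin n → ℂ) M) : ContDiff ℝ ∞ (extendZero φ f) := by
  refine contDiff_iff_contDiffAt.2 fun y => ?_
  by_cases hy : y ∈ φ.target
  · exact ((hf φ hφ).contDiffAt (φ.open_target.mem_nhds hy)).congr_of_eventuallyEq
      (extendZero_eventuallyEq hy)
  · exact contDiffAt_const.congr_of_eventuallyEq (notMem_tsupport_iff_eventuallyEq.1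
      fun h => hy (tsupport_extendZero_subset_target hs h))

end ExtendZero

variable [IsManifold 𝓘(ℂ, Fin n → ℂ) ω M] (h : HermitianMetric n M)

/-- The pairing of `η` with `∂̄f`, computed in the preferred chart at each point. -/
noncomputable def HermitianMetric.gradAt (f : M → ℂ) (p : M) : ℂ :=
  gradPair (h.coord (chartAt (Fin n → ℂ) p)) (fun z => f ((chartAt (Fin n → ℂ) p).symm z))
    (chartAt (Fin n → ℂ) p p)

omit [IsManifold 𝓘(ℂ, Fin n → ℂ) ω M] in
theorem HermitianMetric.gradAt_eq_zero_of_notMem_tsupport {f : M → ℂ} {p : M}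
    (hp : p ∉ tsupport f) : h.gradAt f p = 0 := by
  have hs := mem_chart_source (Fin n → ℂ) p
  have hc := (chartAt (Fin n → ℂ) p).continuousAt_symm (mem_chart_target _ p)
  have h1 : (fun z => f ((chartAt (Fin n → ℂ) p).symm z)) =ᶠ[nhds (chartAt (Fin n → ℂ) p p)]
      fun _ => 0 := by
    refine hc.eventually (p := fun q => f q = 0) ?_
    rw [(chartAt (Fin n → ℂ) p).left_inv hs]
    exact notMem_tsupport_iff_eventuallyEq.1 hp
  rw [gradAt, gradPair_congr h1, gradPair_const]

/-- A choice of a unitary frame at each point, in the preferred chart at that point. -/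
def HermitianMetric.IsFrameField (e : M → Fin n → Fin n → ℂ) : Prop :=
  ∀ p : M, IsUnitaryFrame (h.coord (chartAt (Fin n → ℂ) p)) (chartAt (Fin n → ℂ) p p) (e p)

/-- `|η|²` as a function on the manifold. -/
noncomputable def HermitianMetric.etaNormSq (e : M → Fin n → Fin n → ℂ) (p : M) : ℝ :=
  normSqEta (h.coord (chartAt (Fin n → ℂ) p)) (chartAt (Fin n → ℂ) p p) (e p)

/-- `|T|²` as a function on the manifold. -/
noncomputable def HermitianMetric.torsionNormSq (e : M → Fin n → Fin n → ℂ) (p : M) : ℝ :=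
  normSqTorsion (h.coord (chartAt (Fin n → ℂ) p)) (chartAt (Fin n → ℂ) p p) (e p)

namespace HermitianMetric.IsFrameField

variable {h} {e : M → Fin n → Fin n → ℂ} (he : h.IsFrameField e)

include he

section Pointwise

variable {φ : OpenPartialHomeomorph M (Fin n → ℂ)} (hφ : φ ∈ atlas (Fin n → ℂ) M) {p : M}
  (hp : p ∈ φ.source)

include hφ hp

omit he hφ [IsManifold 𝓘(ℂ, Fin n → ℂ) ω M] in
theorem _root_.ChernGeometry.chartAt_mem_overlap :
    chartAt (Fin n → ℂ) p p ∈ overlap (chartAt (Fin n → ℂ) p) φ := by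
  refine ⟨mem_chart_target _ p, ?_⟩
  rwa [Set.mem_preimage, (chartAt (Fin n → ℂ) p).left_inv (mem_chart_source _ p)]

omit he hφ hp [IsManifold 𝓘(ℂ, Fin n → ℂ) ω M] in
theorem _root_.ChernGeometry.transition_chartAt :
    (φ ∘ (chartAt (Fin n → ℂ) p).symm) (chartAt (Fin n → ℂ) p p) = φ p := by
  rw [Function.comp_apply, (chartAt (Fin n → ℂ) p).left_inv (mem_chart_source _ p)]

/-- The frame transported to another chart. -/
theorem exists_isUnitaryFrame : ∃ e', IsUnitaryFrame (h.coord φ) (φ p) e' ∧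
    normSqEta (h.coord φ) (φ p) e' = h.etaNormSq e p ∧
    normSqTorsion (h.coord φ) (φ p) e' = h.torsionNormSq e p := by
  have hψ := h.isIsometryOn_transition (IsManifold.chart_mem_maximalAtlas p)
    (IsManifold.subset_maximalAtlas hφ)
  have hy := chartAt_mem_overlap (n := n) hp
  have h1 := hψ.isUnitaryFrame hy (he p)
  have h2 := hψ.normSqEta_eq hy (he p)
  have h3 := hψ.normSqTorsion_eq (e := e p) hy
  rw [transition_chartAt] at h1 h2 h3
  exact ⟨_, h1, h2, h3⟩

theorem ofReal_etaNormSq : (h.etaNormSq e p : ℂ) = etaSq (h.coord φ) (φ p) := by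
  obtain ⟨e', he', h1, -⟩ := he.exists_isUnitaryFrame hφ hp
  rw [← h1, he'.etaSq_eq]

theorem ofReal_torsionNormSq : (h.torsionNormSq e p : ℂ) = torsionSq (h.coord φ) (φ p) := by
  obtain ⟨e', he', -, h1⟩ := he.exists_isUnitaryFrame hφ hp
  rw [← h1, he'.torsionSq_eq (h.isHermitianOn_coord (IsManifold.subset_maximalAtlas hφ))
    (φ.map_source hp)]

theorem two_mul_chiCoord (hpl : h.IsPluriclosed) :
    2 * chiCoord (h.coord φ) (φ p) = (h.torsionNormSq e p : ℂ) := by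
  have hm := IsManifold.subset_maximalAtlas (I := 𝓘(ℂ, Fin n → ℂ)) (n := ω) hφ
  obtain ⟨e', he', -, h1⟩ := he.exists_isUnitaryFrame hφ hp
  rw [← h1, he'.chiCoord_eq (h.isHermitianOn_coord hm) (φ.map_source hp),
    he'.two_mul_chi (h.isHermitianOn_coord hm) (φ.map_source hp)
      (hpl φ hm _ (φ.map_source hp))]

theorem gradAt_eq {f : M → ℂ} (hf : IsSmoothInCharts n f) :
    h.gradAt f p = gradPair (h.coord φ) (fun z => f (φ.symm z)) (φ p) := by
  have hψ := h.isIsometryOn_transition (IsManifold.chart_mem_maximalAtlas p)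
    (IsManifold.subset_maximalAtlas hφ)
  have hy := chartAt_mem_overlap (n := n) hp
  have h1 := hψ.gradPair_eq hy (he p) (f := fun z => f (φ.symm z))
    (by rw [transition_chartAt]; exact hf.differentiableAt hφ (φ.map_source hp))
  rw [transition_chartAt] at h1
  rw [h1, gradAt]
  refine gradPair_congr ?_
  filter_upwards [isOpen_overlap.mem_nhds hy] with z hz
  rw [Function.comp_apply, φ.left_inv hz.2]

end Pointwise

omit he [IsManifold 𝓘(ℂ, Fin n → ℂ) ω M] in
theorem _root_.ChernGeometry.continuous_of_charts {f : M → ℂ}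
    {F : OpenPartialHomeomorph M (Fin n → ℂ) → (Fin n → ℂ) → ℂ}
    (hF : ∀ φ ∈ atlas (Fin n → ℂ) M, ContinuousOn (F φ) φ.target)
    (hfF : ∀ φ ∈ atlas (Fin n → ℂ) M, ∀ p ∈ φ.source, f p = F φ (φ p)) : Continuous f := by
  refine continuous_iff_continuousAt.2 fun p => ?_
  set φ := chartAt (Fin n → ℂ) p
  have hφ : φ ∈ atlas (Fin n → ℂ) M := chart_mem_atlas _ p
  have hp : p ∈ φ.source := mem_chart_source _ p
  have h1 : ContinuousAt (fun q => F φ (φ q)) p :=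
    ((hF φ hφ).continuousAt (φ.open_target.mem_nhds (φ.map_source hp))).comp (φ.continuousAt hp)
  refine h1.congr ?_
  filter_upwards [φ.open_source.mem_nhds hp] with q hq
  exact (hfF φ hφ q hq).symm

/-- The frames `e p` need not vary continuously. Continuity holds because the value is
frame-independent and equals the smooth coordinate trace `etaSq` in any chart of the atlas. -/
theorem continuous_etaNormSq : Continuous (h.etaNormSq e) := by
  have h1 : Continuous fun p => (h.etaNormSq e p : ℂ) :=
    continuous_of_charts (n := n) (F := fun φ => etaSq (h.coord φ))
      (fun φ hφ => (h.isHermitianOn_coord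
        (IsManifold.subset_maximalAtlas hφ)).contDiffOn_etaSq.continuousOn)
      fun φ hφ p hp => he.ofReal_etaNormSq hφ hp
  exact Complex.continuous_re.comp h1

theorem continuous_torsionNormSq : Continuous (h.torsionNormSq e) := by
  have h1 : Continuous fun p => (h.torsionNormSq e p : ℂ) :=
    continuous_of_charts (n := n) (F := fun φ => torsionSq (h.coord φ))
      (fun φ hφ => (h.isHermitianOn_coord
        (IsManifold.subset_maximalAtlas hφ)).contDiffOn_torsionSq.continuousOn)
      fun φ hφ p hp => he.ofReal_torsionNormSq hφ hp
  exact Complex.continuous_re.comp h1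

theorem continuous_gradAt {f : M → ℂ} (hf : IsSmoothInCharts n f) : Continuous (h.gradAt f) :=
  continuous_of_charts (n := n) (F := fun φ => gradPair (h.coord φ) fun z => f (φ.symm z))
    (fun φ hφ => ((h.isHermitianOn_coord
      (IsManifold.subset_maximalAtlas hφ)).contDiffOn_gradPair (hf φ hφ)).continuousOn)
    fun _ hφ _ hp => he.gradAt_eq hφ hp hf

omit [IsManifold 𝓘(ℂ, Fin n → ℂ) ω M] in
-- The sum has constant value `a`, so its `∂̄` vanishes. For a partition of unity this is the
-- cancellation of all boundary contributions.
theorem sum_gradAt {ι : Type*} (s : Finset ι) {f : ι → M → ℂ}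
    (hf : ∀ i ∈ s, IsSmoothInCharts n (f i)) {a : ℂ} (hs : ∀ p, ∑ i ∈ s, f i p = a) (p : M) :
    ∑ i ∈ s, h.gradAt (f i) p = 0 := by
  have h1 := (he p).gradPair_sum s
    (f := fun i z => f i ((chartAt (Fin n → ℂ) p).symm z))
    fun i hi => (hf i hi).differentiableAt (chart_mem_atlas _ p) (mem_chart_target _ p)
  simp only [hs, gradPair_const] at h1
  exact h1.symm

variable [MeasurableSpace M] [BorelSpace M] [CompactSpace M]

theorem integral_mul_eq_neg_integral_gradAt (hpl : h.IsPluriclosed)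
    {φ : OpenPartialHomeomorph M (Fin n → ℂ)} (hφ : φ ∈ atlas (Fin n → ℂ) M) {f : M → ℂ}
    (hf : IsSmoothInCharts n f) (hfc : Continuous f) (hs : tsupport f ⊆ φ.source) :
    ∫ p, f p * ((h.torsionNormSq e p : ℂ) / 2 - (h.etaNormSq e p : ℂ)) ∂h.volume =
      -∫ p, h.gradAt f p ∂h.volume := by
  have hm := IsManifold.subset_maximalAtlas (I := 𝓘(ℂ, Fin n → ℂ)) (n := ω) hφ
  have hG := h.isHermitianOn_coord hm
  have hT := tsupport_extendZero_subset_target hs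
  have hF : Continuous
      fun p => f p * ((h.torsionNormSq e p : ℂ) / 2 - (h.etaNormSq e p : ℂ)) :=
    hfc.mul (((Complex.continuous_ofReal.comp he.continuous_torsionNormSq).div_const 2).sub
      (Complex.continuous_ofReal.comp he.continuous_etaNormSq))
  have h1 : ∀ p, p ∉ φ.source → f p = 0 := fun p hp => by
    by_contra hne
    exact hp (hs (subset_tsupport f hne))
  have h2 : ∀ p, p ∉ φ.source → h.gradAt f p = 0 := fun p hp =>
    h.gradAt_eq_zero_of_notMem_tsupport fun hp' => hp (hs hp')
  have h3 : ∀ y, y ∉ φ.target → extendZero φ f y = 0 := fun y hy => Set.indicator_of_notMem hy _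
  have h4 : ∀ y, y ∉ φ.target → gradPair (h.coord φ) (extendZero φ f) y = 0 := fun y hy => by
    have h5 : extendZero φ f =ᶠ[nhds y] fun _ => 0 :=
      notMem_tsupport_iff_eventuallyEq.1 fun hy' => hy (hT hy')
    rw [gradPair_congr h5, gradPair_const]
  rw [← setIntegral_eq_integral_of_forall_compl_eq_zero (s := φ.source)
      fun p hp => by rw [h1 p hp, zero_mul],
    ← setIntegral_eq_integral_of_forall_compl_eq_zero (s := φ.source) h2,
    h.setIntegral_source hm hF, h.setIntegral_source hm (he.continuous_gradAt hf)]
  -- On the target the density is `2ⁿ det G`, and pluriclosedness identifies `|T|²/2` with `χ`, so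
  -- the integrand is the one in the local divergence theorem.
  have e1 : ∫ y in φ.target, (h.density φ y : ℂ) * (f (φ.symm y) *
        ((h.torsionNormSq e (φ.symm y) : ℂ) / 2 - (h.etaNormSq e (φ.symm y) : ℂ))) =
      ∫ y in φ.target, 2 ^ n * ((h.coord φ y).det *
        (extendZero φ f y * (chiCoord (h.coord φ) y - etaSq (h.coord φ) y))) := by
    refine setIntegral_congr_fun φ.open_target.measurableSet fun y hy => ?_
    have hp := φ.map_target hy
    have a1 := he.two_mul_chiCoord hφ hp hpl
    have a2 := he.ofReal_etaNormSq hφ hp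
    rw [φ.right_inv hy] at a1 a2
    simp only [h.ofReal_density hm hy, ← a1, a2, (extendZero_eventuallyEq hy).eq_of_nhds]
    ring
  have e2 : ∫ y in φ.target, (h.density φ y : ℂ) * h.gradAt f (φ.symm y) =
      ∫ y in φ.target, 2 ^ n * ((h.coord φ y).det * gradPair (h.coord φ) (extendZero φ f) y) := by
    refine setIntegral_congr_fun φ.open_target.measurableSet fun y hy => ?_
    have a1 := he.gradAt_eq hφ (φ.map_target hy) hf
    rw [φ.right_inv hy] at a1
    simp only [h.ofReal_density hm hy, a1, gradPair_congr (extendZero_eventuallyEq hy)]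
    ring
  -- Both integrands vanish off the target, so the integrals extend to `ℂⁿ`, where the local theorem
  -- applies to the function extended by zero.
  rw [e1, e2, setIntegral_eq_integral_of_forall_compl_eq_zero fun y hy => by simp [h3 y hy],
    setIntegral_eq_integral_of_forall_compl_eq_zero fun y hy => by simp [h4 y hy],
    integral_const_mul, integral_const_mul,
    hG.integral_divergence (hf.contDiff_extendZero hs hφ) (hasCompactSupport_extendZero hs) hT]
  ring

variable [T2Space M]

omit he in
theorem _root_.ChernGeometry.HermitianMetric.integrable_of_continuous {E : Type*}
    [NormedAddCommGroup E] {f : M → E} (hf : Continuous f) : Integrable f h.volume := by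
  have := h.isLocallyFiniteMeasure_volume
  exact hf.integrable_of_hasCompactSupport (HasCompactSupport.of_compactSpace f)

/-- Multiply by a partition of unity subordinate to charts, integrate each piece by parts, and add:
the remaining gradient terms sum to zero. -/
theorem integral_torsionNormSq_sub (hpl : h.IsPluriclosed) :
    ∫ p, ((h.torsionNormSq e p : ℂ) / 2 - (h.etaNormSq e p : ℂ)) ∂h.volume = 0 := by
  -- A finite subcover makes the index set of the partition finite, so that sums and integrals may
  -- be exchanged.
  obtain ⟨t, ht⟩ := CompactSpace.elim_nhds_subcover
    (fun p : M => (chartAt (Fin n → ℂ) p).source) fun p => chart_source_mem_nhds _ p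
  have := isManifold_real n M
  obtain ⟨ρ, hρ⟩ := SmoothPartitionOfUnity.exists_isSubordinate 𝓘(ℝ, Fin n → ℂ)
    (isClosed_univ (X := M)) (fun p : t => (chartAt (Fin n → ℂ) p.1).source)
    (fun p => (chartAt (Fin n → ℂ) p.1).open_source) (by
      intro p _
      have : p ∈ ⋃ x ∈ t, (chartAt (Fin n → ℂ) x).source := ht ▸ Set.mem_univ p
      simpa using this)
  have hsum : ∀ p : M, ∑ i, (ρ i p : ℂ) = 1 := fun p => by
    have := ρ.sum_eq_one (Set.mem_univ p)
    rw [finsum_eq_sum_of_fintype] at this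
    exact_mod_cast this
  have hsm : ∀ i, IsSmoothInCharts n fun p : M => (ρ i p : ℂ) := fun i =>
    isSmoothInCharts_of_contMDiff (ρ i).contMDiff
  have hc : ∀ i, Continuous fun p : M => (ρ i p : ℂ) := fun i =>
    Complex.continuous_ofReal.comp (ρ i).contMDiff.continuous
  have hts : ∀ i, tsupport (fun p : M => (ρ i p : ℂ)) ⊆ (chartAt (Fin n → ℂ) i.1).source :=
    fun i => (closure_mono fun p hp => by simpa using hp).trans (hρ i)
  have hF : Continuous
      fun p => ((h.torsionNormSq e p : ℂ) / 2 - (h.etaNormSq e p : ℂ)) :=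
    ((Complex.continuous_ofReal.comp he.continuous_torsionNormSq).div_const 2).sub
      (Complex.continuous_ofReal.comp he.continuous_etaNormSq)
  calc ∫ p, ((h.torsionNormSq e p : ℂ) / 2 - (h.etaNormSq e p : ℂ)) ∂h.volume
      = ∫ p, ∑ i, (ρ i p : ℂ) *
          ((h.torsionNormSq e p : ℂ) / 2 - (h.etaNormSq e p : ℂ)) ∂h.volume := by
        simp only [← Finset.sum_mul, hsum, one_mul]
    _ = ∑ i, -∫ p, h.gradAt (fun p => (ρ i p : ℂ)) p ∂h.volume := by
        rw [integral_finsetSum]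
        swap
        · exact fun i _ => h.integrable_of_continuous ((hc i).mul hF)
        exact Finset.sum_congr rfl fun i _ => he.integral_mul_eq_neg_integral_gradAt hpl
          (chart_mem_atlas _ _) (hsm i) (hc i) (hts i)
    _ = -∫ p, ∑ i, h.gradAt (fun p => (ρ i p : ℂ)) p ∂h.volume := by
        rw [integral_finsetSum _ fun i _ =>
          h.integrable_of_continuous (he.continuous_gradAt (hsm i)), Finset.sum_neg_distrib]
    _ = 0 := by simp only [he.sum_gradAt Finset.univ (fun i _ => hsm i) hsum, integral_zero, neg_zero]

theorem two_mul_integral_etaNormSq (hpl : h.IsPluriclosed) :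
    2 * ∫ p, h.etaNormSq e p ∂h.volume = ∫ p, h.torsionNormSq e p ∂h.volume := by
  have h1 : ∫ p, (((h.torsionNormSq e p / 2 - h.etaNormSq e p : ℝ)) : ℂ) ∂h.volume = 0 := by
    rw [← he.integral_torsionNormSq_sub hpl]
    push_cast
    rfl
  rw [integral_complex_ofReal, Complex.ofReal_eq_zero, integral_sub, integral_div] at h1
  · linarith
  · exact h.integrable_of_continuous (he.continuous_torsionNormSq.div_const 2)
  · exact h.integrable_of_continuous he.continuous_etaNormSq

end HermitianMetric.IsFrameField

end Global

end ChernGeometry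

theorem theorem2 {n : ℕ} {M : Type*} [TopologicalSpace M] [T2Space M]
    [ChartedSpace (Fin n → ℂ) M] [IsManifold 𝓘(ℂ, Fin n → ℂ) ω M]
    [MeasurableSpace M] [BorelSpace M]
    (h : HermitianMetric n M) (c : ℝ)
    (hpl : h.IsPluriclosed) (hH : h.HasConstantHolSec c) :
    -- the pointwise identities, in every holomorphic chart and every unitary frame
    (∀ φ ∈ IsManifold.maximalAtlas 𝓘(ℂ, Fin n → ℂ) ω M, ∀ y ∈ φ.target,
      ∀ e : Fin n → Fin n → ℂ, IsUnitaryFrame (h.coord φ) y e →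
        (∀ i j k l : Fin n,
          torsionD (h.coord φ) y e i k j l - torsionD (h.coord φ) y e i k l j =
            ∑ r, torsionC (h.coord φ) y e i k r * star (torsionC (h.coord φ) y e j l r)) ∧
        (∀ i j k l : Fin n,
          curvC (h.coord φ) y e i j k l =
            (c / 2 : ℂ) * ((if i = j then 1 else 0) * (if k = l then 1 else 0)
                + (if i = l then 1 else 0) * (if k = j then 1 else 0))
              - (1 / 4 : ℂ) *
                ∑ r, torsionC (h.coord φ) y e i k r * star (torsionC (h.coord φ) y e j l r)
              - (1 / 2 : ℂ) * (torsionD (h.coord φ) y e i k l j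
                + star (torsionD (h.coord φ) y e j l k i))) ∧
        (∀ i j : Fin n,
          xiC (h.coord φ) y e i j + etaD (h.coord φ) y e i j = sigmaC (h.coord φ) y e i j) ∧
        formOf (h.coord φ) y e (xiC (h.coord φ) y e) =
          Complex.I • delbarEta (h.coord φ) y
            + formOf (h.coord φ) y e (sigmaC (h.coord φ) y e) ∧
        2 * chi (h.coord φ) y e = (normSqTorsion (h.coord φ) y e : ℂ) ∧
        formOf (h.coord φ) y e (ricci1 (h.coord φ) y e) =
          (c / 2 * (n + 1) : ℂ) • kahlerForm (h.coord φ) y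
            - (1 / 4 : ℂ) • formOf (h.coord φ) y e (sigmaC (h.coord φ) y e)
            + (Complex.I / 2) • (delEtaBar (h.coord φ) y - delbarEta (h.coord φ) y) ∧
        formOf (h.coord φ) y e (ricci2 (h.coord φ) y e) =
          (c / 2 * (n + 1) : ℂ) • kahlerForm (h.coord φ) y
            + (3 / 4 : ℂ) • formOf (h.coord φ) y e (sigmaC (h.coord φ) y e)
            - (Complex.I / 2) • (delEtaBar (h.coord φ) y - delbarEta (h.coord φ) y) ∧
        formOf (h.coord φ) y e (ricci3 (h.coord φ) y e) =
          (c / 2 * (n + 1) : ℂ) • kahlerForm (h.coord φ) y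
            - (1 / 4 : ℂ) • formOf (h.coord φ) y e (sigmaC (h.coord φ) y e)
            + (Complex.I / 2) • (delEtaBar (h.coord φ) y + delbarEta (h.coord φ) y)) ∧
    -- the integral identity, with `|η|²` and `|T|²` computed in any unitary frame at each point
    (CompactSpace M →
      ∀ e : M → Fin n → Fin n → ℂ,
        (∀ p : M, IsUnitaryFrame (h.coord (chartAt (Fin n → ℂ) p)) (chartAt (Fin n → ℂ) p p)
          (e p)) →
        Integrable (fun p : M => normSqEta (h.coord (chartAt (Fin n → ℂ) p))
          (chartAt (Fin n → ℂ) p p) (e p)) h.volume ∧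
        Integrable (fun p : M => normSqTorsion (h.coord (chartAt (Fin n → ℂ) p))
          (chartAt (Fin n → ℂ) p p) (e p)) h.volume ∧
        2 * ∫ p : M, normSqEta (h.coord (chartAt (Fin n → ℂ) p))
            (chartAt (Fin n → ℂ) p p) (e p) ∂h.volume =
          ∫ p : M, normSqTorsion (h.coord (chartAt (Fin n → ℂ) p))
            (chartAt (Fin n → ℂ) p p) (e p) ∂h.volume) := by
  refine ⟨fun φ hφ y hy e he => ?_, fun _ e he => ?_⟩
  · have hG := h.isHermitianOn_coord hφ
    have hpl' := hpl φ hφ y hy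
    have hH' := hH φ hφ y hy
    exact ⟨he.torsionD_sub hG hy hpl', he.curvC_eq hG hy hpl' hH',
      he.xiC_add_etaD hG hy hpl', he.formOf_xiC hG hy hpl', he.two_mul_chi hG hy hpl',
      he.formOf_ricci1 hG hy hpl' hH', he.formOf_ricci2 hG hy hpl' hH',
      he.formOf_ricci3 hG hy hpl' hH'⟩
  · have he' : h.IsFrameField e := he
    exact ⟨h.integrable_of_continuous he'.continuous_etaNormSq,
      h.integrable_of_continuous he'.continuous_torsionNormSq,
      he'.two_mul_integral_etaNormSq hpl⟩
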